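/- **Theorem (Hyperbolicity relative to HHGs).** Let $G$ be a finitely generated group that is hyperbolic relative to a finite collection $\mathcal P$ of subgroups. 1. If each $P\in\mathcal P$, with some word metric of a finite generating set, is a hierarchically hyperbolic space (HHS), then $G$, with the word metric of any finite generating set, is an HHS. 2. If each $P\in\mathcal P$ is a hierarchically hyperbolic group (HHG), then $G$ is an HHG. The notions are as follows. *Relative hyperbolicity.* $G$ is hyperbolic relative to $\mathcal P$ if, for some finite generating set, the coned-off Cayley graph (the Cayley graph with one extra vertex for each left coset $gP$, $P\in\mathcal P$, joined by edges to all elements of $gP$) is Gromov hyperbolic and fine: for each $n$, each edge lies on only finitely many circuits (embedded cycles) of length $n$. *HHS.* Distances $d_W$ between nonempty subsets of $\mathcal CW$ are infima of distances between points. Let $X$ be a metric space in which, for some $q\ge1$, any two points are joined by a $(q,q)$-quasigeodesic. $X$ is an HHS if there are an index set $\mathfrak S$, geodesic $\delta$-hyperbolic spaces $\mathcal CW$ ($W\in\mathfrak S$), constants $\delta,\xi,\kappa_0\ge0$, $K$, $\lambda\geq1$, $E\ge\max\{\xi,\kappa_0\}$, $\alpha$, $n$ and a function $\theta_u$ such that: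 - *Projections.* There are maps $\pi_W$ from $X$ to the nonempty subsets of $\mathcal CW$ of diameter $\le\xi$, with $d_W(\pi_W(x),\pi_W(y))\le K\,d(x,y)+K$. - *Nesting.* $\mathfrak S$ has a partial order $\sqsubseteq$ and is empty or has a unique maximal element. For $V\sqsubsetneq W$ there are a nonempty $\rho^V_W\subseteq\mathcal CW$ of diameter $\le\xi$ and a map $\rho^W_V$ from $\mathcal CW$ to the nonempty subsets of $\mathcal CV$. - *Orthogonality.* $\mathfrak S$ has a symmetric anti-reflexive relation $\bot$; $V\sqsubseteq W\bot U$ implies $V\bot U$; orthogonal elements are not $\sqsubseteq$-comparable; if $U\sqsubseteq T$ and some $V\sqsubseteq T$ has $V\bot U$, there is $W\sqsubsetneq T$ such that all $V\sqsubseteq T$ with $V\bot U$ satisfy $V\sqsubseteq W$. - *Transversality and consistency.* $V\pitchfork W$ means that $V,W$ are neither orthogonal nor $\sqsubseteq$-comparable; then there are nonempty $\rho^V_W\subseteq\mathcal CW$ and $\rho^W_V\subseteq\mathcal CV$ of diameter $\le\xi$ with $\min\{d_W(\pi_W(x),\rho^V_W),d_V(\pi_V(x),\rho^W_V)\}\le\kappa_0$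 for all $x\in X$. If $V\sqsubsetneq W$, then $\min\{d_W(\pi_W(x),\rho^V_W),\operatorname{diam}(\pi_V(x)\cup\rho^W_V(\pi_W(x)))\}\le\kappa_0$ for all $x\in X$. If $U\sqsubseteq V$, then $d_W(\rho^U_W,\rho^V_W)\le\kappa_0$ whenever $V\sqsubsetneq W$, or $V\pitchfork W$ and $W\not\perp U$. - *Finite complexity.* Sets of pairwise $\sqsubseteq$-comparable elements have at most $n$ elements. - *Large links.* For $W\in\mathfrak S$ and $x,x'\in X$ put $N=\lambda d_W(\pi_W(x),\pi_W(x'))+\lambda$. There are at most $\lfloor N\rfloor$ elements $T_i\sqsubsetneq W$, each with $d_W(\pi_W(x),\rho^{T_i}_W)\le N$, such that each $T\sqsubsetneq W$ is nested in some $T_i$ or has $d_T(\pi_T(x),\pi_T(x'))<E$. - *Bounded geodesic image.* If $V\sqsubsetneq W$ and $\gamma$ is a geodesic of $\mathcal CW$, then $\operatorname{diam}(\rho^W_V(\gamma))\le E$ or $\gamma$ meets the $E$-neighbourhood of $\rho^V_W$. - *Partial realization.* If $\{V_j\}$ are pairwise orthogonal and $p_j\in\bigcup_{y\in X}\pi_{V_j}(y)$,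 there is $x\in X$ such that for all $j$: $d_{V_j}(\pi_{V_j}(x),p_j)\le\alpha$, and $d_W(\pi_W(x),\rho^{V_j}_W)\le\alpha$ whenever $V_j\sqsubsetneq W$ or $W\pitchfork V_j$. - *Uniqueness.* For each $\kappa\ge0$, if $d(x,y)\ge\theta_u(\kappa)$, then $d_V(\pi_V(x),\pi_V(y))\ge\kappa$ for some $V\in\mathfrak S$. *HHG.* An automorphism of $(X,\mathfrak S)$ consists of a map $f:X\to X$, a bijection $f^\diamondsuit$ of $\mathfrak S$ preserving nesting, orthogonality and transversality, and isometries $f^*(U):\mathcal CU\to\mathcal C(f^\diamondsuit U)$, that commute with the $\pi_U$ and the $\rho^U_V$ up to bounded Hausdorff distance. A finitely generated group is an HHG if it acts on some HHS $(X,\mathfrak S)$ by automorphisms with uniform constants (an action on $\mathfrak S$ and on the spaces $\mathcal CU$, a quasi-action on $X$ by uniform quasi-isometric embeddings), such that the quasi-action on $X$ is metrically proper and cobounded and $\mathfrak S$ has finitely many orbits. -/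

import Mathlib

universe u

noncomputable section

namespace HHS

/-! ### Coarse geometry of metric spaces -/

/-- The distance between two subsets of a metric space: the infimum of the distances between a
point of the first and a point of the second. It is only ever used for nonempty sets. -/
def setDist {X : Type*} [MetricSpace X] (A B : Set X) : ℝ :=
  sInf {r : ℝ | ∃ a ∈ A, ∃ b ∈ B, r = dist a b}

/-- The subset `A` has diameter at most `r`. -/
def DiamLE {X : Type*} [MetricSpace X] (A : Set X) (r : ℝ) : Prop :=
  ∀ a ∈ A, ∀ b ∈ A, dist a b ≤ r

/-- Each of the two subsets lies in the `r`-neighbourhood of the other one. -/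
def CoarselyEqual {X : Type*} [MetricSpace X] (r : ℝ) (A B : Set X) : Prop :=
  (∀ a ∈ A, ∃ b ∈ B, dist a b ≤ r) ∧ (∀ b ∈ B, ∃ a ∈ A, dist a b ≤ r)

/-- `γ` restricted to `[0, ℓ]` is a geodesic. -/
def IsGeodesic {X : Type*} [MetricSpace X] (ℓ : ℝ) (γ : ℝ → X) : Prop :=
  0 ≤ ℓ ∧ ∀ s ∈ Set.Icc 0 ℓ, ∀ t ∈ Set.Icc 0 ℓ, dist (γ s) (γ t) = |s - t|

/-- Any two points are joined by a geodesic. -/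
def IsGeodesicSpace (X : Type*) [MetricSpace X] : Prop :=
  ∀ x y : X, ∃ (ℓ : ℝ) (γ : ℝ → X), IsGeodesic ℓ γ ∧ γ 0 = x ∧ γ ℓ = y

/-- `γ` restricted to `[0, ℓ]` is a `(q, q)`-quasigeodesic, that is, a `(q, q)`-quasi-isometric
embedding of this interval. -/
def IsQuasigeodesic {X : Type*} [MetricSpace X] (q ℓ : ℝ) (γ : ℝ → X) : Prop :=
  0 ≤ ℓ ∧ ∀ s ∈ Set.Icc 0 ℓ, ∀ t ∈ Set.Icc 0 ℓ,
    q⁻¹ * |s - t| - q ≤ dist (γ s) (γ t) ∧ dist (γ s) (γ t) ≤ q * |s - t| + q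

/-- A quasigeodesic space: for some `q ≥ 1`, any two points are joined by a
`(q, q)`-quasigeodesic. -/
def IsQuasigeodesicSpace (X : Type*) [MetricSpace X] : Prop :=
  ∃ q : ℝ, 1 ≤ q ∧ ∀ x y : X, ∃ (ℓ : ℝ) (γ : ℝ → X), IsQuasigeodesic q ℓ γ ∧ γ 0 = x ∧ γ ℓ = y

/-- Gromov's four-point condition for a distance function `d`. -/
def FourPoint {X : Type*} (d : X → X → ℝ) (δ : ℝ) : Prop :=
  ∀ x y z w : X, d x y + d z w ≤ max (d x z + d y w) (d x w + d y z) + 2 * δ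

/-- A `δ`-hyperbolic (geodesic) space. -/
def IsHyperbolicSpace (X : Type*) [MetricSpace X] (δ : ℝ) : Prop :=
  IsGeodesicSpace X ∧ FourPoint (fun x y : X => dist x y) δ

/-! ### Hierarchically hyperbolic spaces -/

/-- Transversality: not orthogonal, and neither one is nested in the other. -/
def IsTransverse {I : Type*} [LE I] (perp : I → I → Prop) (V W : I) : Prop :=
  ¬ perp V W ∧ ¬ V ≤ W ∧ ¬ W ≤ V

/-- A hierarchically hyperbolic structure on the metric space `X`. The order `V ≤ W` on the index
set is nesting, `perp` is orthogonality. -/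
structure HHSStructure (X : Type u) [MetricSpace X] where
  /-- the index set -/
  Idx : Type u
  /-- nesting -/
  [order : PartialOrder Idx]
  /-- the hyperbolic space associated with an index -/
  C : Idx → Type u
  [metric : ∀ W, MetricSpace (C W)]
  /-- orthogonality -/
  perp : Idx → Idx → Prop
  /-- the projections `π_W` -/
  proj : ∀ W, X → Set (C W)
  /-- the subset `ρ^V_W` of `C W`; meaningful if `V` is properly nested in `W` or transverse
  to `W` -/
  rhoSet : Idx → ∀ W : Idx, Set (C W)
  /-- the projection `ρ^W_V : C W → 2 ^ (C V)`; meaningful if `V` is properly nested in `W` -/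
  rhoMap : ∀ W V : Idx, C W → Set (C V)
  -- the constants
  δ : ℝ
  ξ : ℝ
  K : ℝ
  κ₀ : ℝ
  lam : ℝ
  E : ℝ
  α : ℝ
  complexity : ℕ
  θ : ℝ → ℝ
  δ_nonneg : 0 ≤ δ
  ξ_nonneg : 0 ≤ ξ
  κ₀_nonneg : 0 ≤ κ₀
  one_le_lam : 1 ≤ lam
  E_ge : max ξ κ₀ ≤ E
  hyperbolic : ∀ W, IsHyperbolicSpace (C W) δ
  -- projections
  proj_nonempty : ∀ W x, (proj W x).Nonempty
  proj_diam : ∀ W x, DiamLE (proj W x) ξ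
  proj_lipschitz : ∀ W x y, setDist (proj W x) (proj W y) ≤ K * dist x y + K
  -- nesting
  exists_max : IsEmpty Idx ∨ ∃! S : Idx, IsMax S
  rhoSet_nonempty_of_lt : ∀ V W, V < W → (rhoSet V W).Nonempty
  rhoSet_diam_of_lt : ∀ V W, V < W → DiamLE (rhoSet V W) ξ
  rhoMap_nonempty : ∀ V W, V < W → ∀ p : C W, (rhoMap W V p).Nonempty
  -- orthogonality
  perp_symm : ∀ V W, perp V W → perp W V
  perp_irrefl : ∀ V, ¬ perp V V
  perp_of_le : ∀ V W U, V ≤ W → perp W U → perp V U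
  perp_container : ∀ T U, U ≤ T → (∃ V, V ≤ T ∧ perp V U) →
    ∃ W, W < T ∧ ∀ V, perp V U → V ≤ T → V ≤ W
  perp_not_le : ∀ V W, perp V W → ¬ V ≤ W ∧ ¬ W ≤ V
  -- transversality and consistency
  rhoSet_nonempty_of_transverse : ∀ V W, IsTransverse perp V W →
    (rhoSet V W).Nonempty
  rhoSet_diam_of_transverse : ∀ V W, IsTransverse perp V W →
    DiamLE (rhoSet V W) ξ
  consistency_transverse : ∀ V W, IsTransverse perp V W → ∀ x : X,
    min (setDist (proj W x) (rhoSet V W)) (setDist (proj V x) (rhoSet W V)) ≤ κ₀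
  consistency_nested : ∀ V W, V < W → ∀ x : X,
    setDist (proj W x) (rhoSet V W) ≤ κ₀ ∨
      DiamLE (proj V x ∪ ⋃ p ∈ proj W x, rhoMap W V p) κ₀
  consistency_rho : ∀ U V W, U ≤ V →
    (V < W ∨ (IsTransverse perp V W ∧ ¬ perp W U)) →
    setDist (rhoSet U W) (rhoSet V W) ≤ κ₀
  -- finite complexity
  finite_complexity : ∀ s : Set Idx, IsChain (· ≤ ·) s → s.encard ≤ complexity
  -- large links
  large_links : ∀ (W : Idx) (x x' : X), ∃ s : Finset Idx,
    s.card ≤ ⌊lam * setDist (proj W x) (proj W x') + lam⌋₊ ∧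
    (∀ T ∈ s, T < W) ∧
    (∀ T, T < W → (∃ T' ∈ s, T ≤ T') ∨ setDist (proj T x) (proj T x') < E) ∧
    (∀ T ∈ s, setDist (proj W x) (rhoSet T W) ≤ lam * setDist (proj W x) (proj W x') + lam)
  -- bounded geodesic image
  bounded_geodesic_image : ∀ V W, V < W → ∀ (ℓ : ℝ) (γ : ℝ → C W), IsGeodesic ℓ γ →
    DiamLE (⋃ t ∈ Set.Icc 0 ℓ, rhoMap W V (γ t)) E ∨
      ∃ t ∈ Set.Icc 0 ℓ, setDist {γ t} (rhoSet V W) ≤ E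
  -- partial realization
  partial_realization : ∀ (J : Set Idx) (p : ∀ V, C V),
    (∀ V ∈ J, ∀ W ∈ J, V ≠ W → perp V W) →
    (∀ V ∈ J, ∃ y : X, p V ∈ proj V y) →
    ∃ x : X, ∀ V ∈ J, setDist (proj V x) {p V} ≤ α ∧
      (∀ W, V < W → setDist (proj W x) (rhoSet V W) ≤ α) ∧
      (∀ W, IsTransverse perp W V → setDist (proj W x) (rhoSet V W) ≤ α)
  -- uniqueness
  uniqueness : ∀ κ : ℝ, 0 ≤ κ → ∀ x y : X, θ κ ≤ dist x y →
    ∃ V, κ ≤ setDist (proj V x) (proj V y)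

attribute [instance] HHSStructure.order HHSStructure.metric

/-- The metric space `X` is a hierarchically hyperbolic space. -/
def IsHHS (X : Type u) [MetricSpace X] : Prop :=
  IsQuasigeodesicSpace X ∧ Nonempty (HHSStructure X)

namespace HHSStructure

variable {X : Type u} [MetricSpace X]

/-- Transversality. -/
def Transverse (H : HHSStructure X) (V W : H.Idx) : Prop :=
  IsTransverse H.perp V W

/-- The underlying data of an automorphism of `(X, 𝔖)`: a map `X → X`, a bijection of the index
set that preserves nesting, orthogonality and transversality, and isometries between the
associated hyperbolic spaces. -/
structure PreAut (H : HHSStructure X) where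
  toFun : X → X
  idx : H.Idx ≃ H.Idx
  iso : ∀ U, H.C U ≃ᵢ H.C (idx U)
  map_le : ∀ U V, U ≤ V → idx U ≤ idx V
  map_perp : ∀ U V, H.perp U V → H.perp (idx U) (idx V)
  map_transverse : ∀ U V, H.Transverse U V → H.Transverse (idx U) (idx V)

/-- The data form an automorphism whose defining diagrams commute up to the error `k`. -/
structure PreAut.CoarselyCommutes {H : HHSStructure X} (f : H.PreAut) (k : ℝ) : Prop where
  proj : ∀ U x, CoarselyEqual k (f.iso U '' H.proj U x) (H.proj (f.idx U) (f.toFun x))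
  rhoSet : ∀ U V, (U < V ∨ H.Transverse U V) →
    CoarselyEqual k (f.iso V '' H.rhoSet U V) (H.rhoSet (f.idx U) (f.idx V))
  rhoMap : ∀ U V, V < U → ∀ p : H.C U,
    CoarselyEqual k (f.iso V '' H.rhoMap U V p) (H.rhoMap (f.idx U) (f.idx V) (f.iso U p))

end HHSStructure

/-- An action of the group `G` on the hierarchically hyperbolic space `(X, 𝔖)` by automorphisms,
with uniform constant `k`: an honest action on the index set and on the hyperbolic spaces, and a
uniform quasi-action on `X`. -/
structure HHSAction (G : Type u) [Group G] {X : Type u} [MetricSpace X]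
    (H : HHSStructure X) where
  aut : G → H.PreAut
  k : ℝ
  one_le_k : 1 ≤ k
  commutes : ∀ g, (aut g).CoarselyCommutes k
  idx_mul : ∀ g h U, (aut (g * h)).idx U = (aut g).idx ((aut h).idx U)
  iso_mul : ∀ g h U (p : H.C U),
    (⟨(aut (g * h)).idx U, (aut (g * h)).iso U p⟩ : Σ V, H.C V) =
      ⟨(aut g).idx ((aut h).idx U), (aut g).iso ((aut h).idx U) ((aut h).iso U p)⟩
  quasi_one : ∀ x, dist ((aut 1).toFun x) x ≤ k
  quasi_mul : ∀ g h x, dist ((aut (g * h)).toFun x) ((aut g).toFun ((aut h).toFun x)) ≤ k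
  quasi_isometry : ∀ g x y, k⁻¹ * dist x y - k ≤ dist ((aut g).toFun x) ((aut g).toFun y) ∧
    dist ((aut g).toFun x) ((aut g).toFun y) ≤ k * dist x y + k

/-- The group `G` is a hierarchically hyperbolic group: it is finitely generated and acts by
automorphisms on a hierarchically hyperbolic space, metrically properly and coboundedly, with
finitely many orbits of indices. -/
def IsHHG (G : Type u) [Group G] : Prop :=
  Group.FG G ∧ ∃ (X : Type u) (_ : MetricSpace X) (H : HHSStructure X) (A : HHSAction G H),
    IsQuasigeodesicSpace X ∧
    (∀ (x : X) (r : ℝ), {g : G | ∃ y, dist y x ≤ r ∧ dist ((A.aut g).toFun y) x ≤ r}.Finite) ∧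
    (∃ (x : X) (r : ℝ), ∀ y, ∃ g : G, dist y ((A.aut g).toFun x) ≤ r) ∧
    (∃ F : Set H.Idx, F.Finite ∧ ∀ U, ∃ V ∈ F, ∃ g : G, U = (A.aut g).idx V)

/-! ### Word metrics -/

section WordMetric

variable {G : Type u} [Group G]

theorem cayley_connected (S : Set G) (hS : Subgroup.closure S = ⊤) :
    (SimpleGraph.mulCayley S).Connected := by
  have key : ∀ g : G, ∀ x : G, (SimpleGraph.mulCayley S).Reachable x (x * g) := by
    intro g
    have hg : g ∈ Subgroup.closure S := hS ▸ Subgroup.mem_top g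
    induction hg using Subgroup.closure_induction with
    | mem s hs =>
      intro x
      by_cases h : x = x * s
      · rw [← h]
      · exact SimpleGraph.Adj.reachable
          ((SimpleGraph.mulCayley_adj S x (x * s)).2 ⟨h, Or.inl (by simpa using hs)⟩)
    | one => intro x; simp
    | mul a b _ _ ha hb =>
      intro x
      rw [← mul_assoc]
      exact (ha x).trans (hb (x * a))
    | inv a _ ha =>
      intro x
      simpa using (ha (x * a⁻¹)).symm
  have : Nonempty G := ⟨1⟩
  exact ⟨fun x y => by simpa using key (x⁻¹ * y) x⟩

/-- The group `G`, as a metric space with the word metric of the generating set `S`. -/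
def WordSpace (S : Set G) (_ : Subgroup.closure S = ⊤) : Type u := G

/-- The word metric is the graph metric on the vertices of the Cayley graph. -/
instance (S : Set G) (hS : Subgroup.closure S = ⊤) : MetricSpace (WordSpace S hS) where
  dist x y := ((SimpleGraph.mulCayley S).dist (x : G) (y : G) : ℝ)
  dist_self x := by exact_mod_cast (SimpleGraph.mulCayley S).dist_self (v := (x : G))
  dist_comm x y := by
    exact_mod_cast (SimpleGraph.mulCayley S).dist_comm (u := (x : G)) (v := (y : G))
  dist_triangle x y z := by exact_mod_cast (cayley_connected S hS).dist_triangle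
  eq_of_dist_eq_zero {x y} h := by
    have h' : (SimpleGraph.mulCayley S).dist (x : G) (y : G) = 0 := by exact_mod_cast h
    exact (cayley_connected S hS).dist_eq_zero_iff.1 h'

end WordMetric

/-! ### Relatively hyperbolic groups -/

section RelHyp

variable {G : Type u} [Group G]

/-- Vertices of the coned-off Cayley graph: the elements of `G`, and one cone point for each left
coset of each member of `Ps`. -/
abbrev ConedVertex (Ps : Set (Subgroup G)) : Type u := G ⊕ (Σ P : Ps, G ⧸ (P : Subgroup G))

/-- The coned-off Cayley graph: the Cayley graph of `G` with respect to `S`, together with an edge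
from each element of a left coset `gP` to the cone point of `gP`. -/
def conedOff (S : Set G) (Ps : Set (Subgroup G)) : SimpleGraph (ConedVertex Ps) where
  Adj
    | Sum.inl g, Sum.inl h => (SimpleGraph.mulCayley S).Adj g h
    | Sum.inl g, Sum.inr c => (g : G ⧸ (c.1 : Subgroup G)) = c.2
    | Sum.inr c, Sum.inl g => (g : G ⧸ (c.1 : Subgroup G)) = c.2
    | Sum.inr _, Sum.inr _ => False
  symm := ⟨by
    rintro (g | c) (h | d) hgh
    · exact SimpleGraph.Adj.symm hgh
    · exact hgh
    · exact hgh
    · exact hgh⟩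
  loopless := ⟨by
    rintro (g | c) hg
    · exact SimpleGraph.irrefl _ hg
    · exact hg⟩

/-- A graph is fine if for each `n` each edge lies on only finitely many circuits (embedded cycles)
of length `n`; a circuit through the edge `uv` is recorded as a cycle based at `u`. -/
def IsFine {V : Type*} (Γ : SimpleGraph V) : Prop :=
  ∀ (u v : V), Γ.Adj u v → ∀ n : ℕ,
    {c : Γ.Walk u u | c.IsCycle ∧ c.length = n ∧ s(u, v) ∈ c.edges}.Finite

/-- The graph metric is Gromov hyperbolic. -/
def IsHyperbolicGraph {V : Type*} (Γ : SimpleGraph V) : Prop :=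
  ∃ δ : ℝ, FourPoint (fun x y : V => (Γ.dist x y : ℝ)) δ

/-- The group `G` is hyperbolic relative to the collection `Ps` of subgroups: for some finite
generating set, the coned-off Cayley graph is hyperbolic and fine. -/
def IsHyperbolicRelativeTo (G : Type u) [Group G] (Ps : Set (Subgroup G)) : Prop :=
  ∃ S : Set G, S.Finite ∧ Subgroup.closure S = ⊤ ∧
    IsHyperbolicGraph (conedOff S Ps) ∧ IsFine (conedOff S Ps)

end RelHyp

end HHS

end

/-! Let Γ be the coned-off Cayley graph. The index set for the group is the disjoint union of the
index sets of all cosets gP, each with a copy of the structure of P, together with a new largest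
element whose hyperbolic space is the geometric realization of Γ. Indices of different cosets are
transverse. To project an element x to an index of gP, take a gate of x, that is, the first vertex
after the cone point on a geodesic of Γ from the cone point of gP to x, and apply the projection of
P.

Everything rests on one property of hyperbolic fine graphs. If a geodesic from v to w avoids a
vertex c, or if the Gromov product of v and w at c is large, then the gates of v and w at c are
joined by a path of bounded length that avoids c (`IsGate.detour_of_geodesic`,
`IsGate.detour_of_gromovProduct`). Closed up through c, such a path becomes a circuit through a
given edge at c, so fineness leaves finitely many possibilities (`IsFine.finite_detour`). By
translation, and as there are finitely many peripheral subgroups, the two gates are uniformly close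
in the model of P (`RelHypData.exists_dist_pt_le_of_detour`). Hence a coset sees a geodesic of Γ
only if its cone point is on it or near it; this gives consistency, large links and bounded geodesic
image. Uniqueness holds because a short geodesic of Γ, all of whose passages through cosets are
short in the models, connects x to xg for only finitely many g (`RelHypData.finite_of_dist_le`).

The facts about gates are collected in `CombinationData`, from which
`CombinationData.toHHSStructure` deduces the axioms. A peripheral subgroup enters only through an
`OrbitModel`, a hierarchically hyperbolic space with a coarse orbit map; this covers word metrics as
well as spaces on which P acts.

In the second statement the structures of the cosets are permuted by the group: after a choice of
coset representatives, g maps the structure of gate coset a to that of ga by an element of P, and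
the cocycle identity turns the actions of the peripheral subgroups into an action of the whole
group. Every element of P occurs in this way, so there are still finitely many orbits of indices. -/

noncomputable section

namespace HHS

/-! ### Distances between bounded subsets -/

section SetDist

variable {X : Type*} [MetricSpace X] {A B C : Set X} {r ξ : ℝ}

theorem setDist_le_dist {a b : X} (ha : a ∈ A) (hb : b ∈ B) : setDist A B ≤ dist a b :=
  csInf_le ⟨0, by rintro _ ⟨a, -, b, -, rfl⟩; exact dist_nonneg⟩ ⟨a, ha, b, hb, rfl⟩

theorem setDist_nonneg (A B : Set X) : 0 ≤ setDist A B :=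
  Real.sInf_nonneg (by rintro _ ⟨a, -, b, -, rfl⟩; exact dist_nonneg)

theorem exists_dist_lt_of_setDist_lt (hA : A.Nonempty) (hB : B.Nonempty) (h : setDist A B < r) :
    ∃ a ∈ A, ∃ b ∈ B, dist a b < r := by
  obtain ⟨a, ha⟩ := hA
  obtain ⟨b, hb⟩ := hB
  have hne : {r : ℝ | ∃ a ∈ A, ∃ b ∈ B, r = dist a b}.Nonempty := ⟨_, a, ha, b, hb, rfl⟩
  obtain ⟨_, ⟨a, ha, b, hb, rfl⟩, h⟩ := exists_lt_of_csInf_lt hne h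
  exact ⟨a, ha, b, hb, h⟩

theorem setDist_singleton (a b : X) : setDist {a} {b} = dist a b := by
  have : {r : ℝ | ∃ x ∈ ({a} : Set X), ∃ y ∈ ({b} : Set X), r = dist x y} = {dist a b} := by
    ext r; simp
  rw [setDist, this, csInf_singleton]

theorem dist_le_of_setDist_le (hA : A.Nonempty) (hB : B.Nonempty) (dA : DiamLE A ξ)
    (dB : DiamLE B ξ) (h : setDist A B ≤ r) {a b : X} (ha : a ∈ A) (hb : b ∈ B) :
    dist a b ≤ r + 2 * ξ := by
  refine le_of_forall_pos_lt_add fun ε hε => ?_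
  obtain ⟨a', ha', b', hb', h'⟩ :=
    exists_dist_lt_of_setDist_lt hA hB (lt_of_le_of_lt h (lt_add_of_pos_right r hε))
  have := dist_triangle4 a a' b' b
  have := dA a ha a' ha'
  have := dB b' hb' b hb
  linarith

/-- `setDist` alone violates the triangle inequality; crossing the middle set costs its diameter. -/
theorem setDist_triangle (hA : A.Nonempty) (hB : B.Nonempty) (hC : C.Nonempty)
    (dB : DiamLE B ξ) : setDist A C ≤ setDist A B + ξ + setDist B C := by
  refine le_of_forall_pos_lt_add fun ε hε => ?_
  obtain ⟨a, ha, b, hb, h⟩ := exists_dist_lt_of_setDist_lt hA hB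
    (lt_add_of_pos_right (setDist A B) (half_pos hε))
  obtain ⟨b', hb', c, hc, h'⟩ := exists_dist_lt_of_setDist_lt hB hC
    (lt_add_of_pos_right (setDist B C) (half_pos hε))
  have := dist_triangle4 a b b' c
  have := dB b hb b' hb'
  have := setDist_le_dist ha hc
  linarith

theorem DiamLE.mono {r s : ℝ} (h : DiamLE A r) (hrs : r ≤ s) : DiamLE A s :=
  fun a ha b hb => (h a ha b hb).trans hrs

end SetDist

/-! ### The index set of a combination -/

/-- A family of index sets together with a new largest element. -/
inductive CombIdx {A : Type u} (I : A → Type u) : Type u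
  | top : CombIdx I
  | piece (a : A) (U : I a) : CombIdx I

namespace CombIdx

variable {A : Type u} {I : A → Type u}

/-- Elements of distinct members of the family are incomparable. -/
inductive Le [∀ a, LE (I a)] : CombIdx I → CombIdx I → Prop
  | le_top (x : CombIdx I) : Le x top
  | piece (a : A) (U V : I a) (h : U ≤ V) : Le (piece a U) (piece a V)

/-- The relations on the members of the family, side by side. -/
inductive Side (perp : ∀ a, I a → I a → Prop) : CombIdx I → CombIdx I → Prop
  | piece (a : A) (U V : I a) (h : perp a U V) : Side perp (piece a U) (piece a V)

variable {perp : ∀ a, I a → I a → Prop}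

theorem side_piece {a : A} {U V : I a} : Side perp (piece a U) (piece a V) ↔ perp a U V :=
  ⟨fun h => by cases h; assumption, fun h => Side.piece a U V h⟩

instance [∀ a, PartialOrder (I a)] : PartialOrder (CombIdx I) where
  le := Le
  le_refl x := by
    cases x with
    | top => exact .le_top _
    | piece a U => exact .piece a U U le_rfl
  le_trans x y z h h' := by
    cases h' with
    | le_top => exact .le_top _
    | piece a U V h' =>
      cases h with
      | piece _ W _ h => exact .piece a W V (h.trans h')
  le_antisymm x y h h' := by
    cases h with
    | le_top => cases h'; rfl
    | piece a U V h =>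
      cases h' with
      | piece _ _ _ h' => rw [le_antisymm h h']

variable [∀ a, PartialOrder (I a)]

theorem le_top (x : CombIdx I) : x ≤ top := Le.le_top x

theorem piece_le_piece {a : A} {U V : I a} : piece a U ≤ piece a V ↔ U ≤ V :=
  ⟨fun h => by cases h; assumption, fun h => Le.piece a U V h⟩

theorem le_piece {x : CombIdx I} {a : A} {V : I a} :
    x ≤ piece a V ↔ ∃ U, x = piece a U ∧ U ≤ V :=
  ⟨fun h => by cases h with | piece _ U _ h => exact ⟨U, rfl, h⟩,
    by rintro ⟨U, rfl, h⟩; exact piece_le_piece.2 h⟩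

theorem piece_le {x : CombIdx I} {a : A} {U : I a} :
    piece a U ≤ x ↔ x = top ∨ ∃ V, x = piece a V ∧ U ≤ V :=
  ⟨fun h => by
    cases h with
    | le_top => exact .inl rfl
    | piece _ _ V h => exact .inr ⟨V, rfl, h⟩,
    by
      rintro (rfl | ⟨V, rfl, h⟩)
      · exact le_top _
      · exact piece_le_piece.2 h⟩

theorem top_le {x : CombIdx I} : top ≤ x ↔ x = top :=
  ⟨fun h => by cases h; rfl, by rintro rfl; exact le_rfl⟩

theorem piece_lt_piece {a : A} {U V : I a} : piece a U < piece a V ↔ U < V := by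
  rw [lt_iff_le_not_ge, lt_iff_le_not_ge, piece_le_piece, piece_le_piece]

theorem piece_lt_top (a : A) (U : I a) : piece a U < (top : CombIdx I) :=
  lt_iff_le_not_ge.2 ⟨le_top _, fun h => by cases h⟩

theorem not_top_lt (x : CombIdx I) : ¬ top < x := fun h => by
  rw [top_le.1 h.le] at h; exact lt_irrefl _ h

theorem lt_piece {x : CombIdx I} {a : A} {V : I a} :
    x < piece a V ↔ ∃ U, x = piece a U ∧ U < V :=
  ⟨fun h => by
    obtain ⟨U, rfl, -⟩ := le_piece.1 h.le
    exact ⟨U, rfl, piece_lt_piece.1 h⟩,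
    by rintro ⟨U, rfl, h⟩; exact piece_lt_piece.2 h⟩

theorem isTransverse_piece {a : A} {U V : I a} :
    IsTransverse (Side perp) (piece a U) (piece a V) ↔ IsTransverse (perp a) U V := by
  simp only [IsTransverse, side_piece, piece_le_piece]

/-- Neither nesting nor orthogonality has a constructor that links different members of the family.
-/
theorem isTransverse_piece_of_ne {a b : A} (hab : a ≠ b) (U : I a) (V : I b) :
    IsTransverse (Side perp) (piece a U) (piece b V) :=
  ⟨fun h => by cases h; exact hab rfl, fun h => by cases h; exact hab rfl,
    fun h => by cases h; exact hab rfl⟩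

theorem not_isTransverse_top_left (x : CombIdx I) : ¬ IsTransverse (Side perp) top x :=
  fun h => h.2.2 (le_top x)

theorem not_isTransverse_top_right (x : CombIdx I) : ¬ IsTransverse (Side perp) x top :=
  fun h => h.2.1 (le_top x)

end CombIdx

/-- The axiom only provides a unique maximal element. Finite complexity makes it the largest one:
climbing from `U` without meeting a maximal element would produce chains of every finite length. -/
theorem HHSStructure.exists_forall_le {X : Type u} [MetricSpace X] (H : HHSStructure X)
    (V : H.Idx) : ∃ S : H.Idx, ∀ U, U ≤ S := by
  obtain h | ⟨S, -, hS⟩ := H.exists_max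
  · exact (h.false V).elim
  refine ⟨S, fun U => ?_⟩
  have hchain : ∀ n : ℕ, (∃ S', U ≤ S' ∧ IsMax S') ∨
      ∃ s : Set H.Idx, IsChain (· ≤ ·) s ∧ s.encard = n ∧ ∃ m, U ≤ m ∧ ∀ x ∈ s, x < m := by
    intro n
    induction n with
    | zero => exact .inr ⟨∅, by simp, by simp, U, le_rfl, by simp⟩
    | succ n ih =>
      obtain h | ⟨s, hs, hn, m, hU, hm⟩ := ih
      · exact .inl h
      by_cases hmax : IsMax m
      · exact .inl ⟨m, hU, hmax⟩
      obtain ⟨m', hm'⟩ := not_isMax_iff.1 hmax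
      refine .inr ⟨insert m s, hs.insert fun x hx _ => .inr (hm x hx).le, ?_, m',
        hU.trans hm'.le, ?_⟩
      · rw [Set.encard_insert_of_notMem fun h => lt_irrefl _ (hm m h), hn]; norm_cast
      · rintro x (rfl | hx)
        · exact hm'
        · exact (hm x hx).trans hm'
  obtain ⟨S', hU, hS'⟩ | ⟨s, hs, hn, -⟩ := hchain (H.complexity + 1)
  · rwa [← hS S' hS']
  · have := H.finite_complexity s hs
    rw [hn] at this
    exact absurd (by exact_mod_cast this) (Nat.not_succ_le_self _)

theorem HHSStructure.dist_proj_le {X : Type u} [MetricSpace X] (H : HHSStructure X) {M r : ℝ}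
    (hK : H.K ≤ M) (hξ : H.ξ ≤ M) (hM : 0 ≤ M) {x y : X} (h : dist x y ≤ r) {U : H.Idx}
    {p q : H.C U} (hp : p ∈ H.proj U x) (hq : q ∈ H.proj U y) :
    dist p q ≤ M * r + 3 * M := by
  have h1 := dist_le_of_setDist_le (H.proj_nonempty U x) (H.proj_nonempty U y) (H.proj_diam U x)
    (H.proj_diam U y) (H.proj_lipschitz U x y) hp hq
  have h2 : H.K * dist x y ≤ M * r := mul_le_mul hK h dist_nonneg hM
  linarith

theorem HHSStructure.setDist_proj_le {X : Type u} [MetricSpace X] (H : HHSStructure X) {M r : ℝ}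
    (hK : H.K ≤ M) (hM : 0 ≤ M) {x y : X} (h : dist x y ≤ r) (U : H.Idx) :
    setDist (H.proj U x) (H.proj U y) ≤ M * r + M := by
  have h1 := H.proj_lipschitz U x y
  have h2 : H.K * dist x y ≤ M * r := mul_le_mul hK h dist_nonneg hM
  linarith

/-- A metric space `X` that is hyperbolic relative to a family of hierarchically hyperbolic spaces
`Z a`, in the form of gates: there are a hyperbolic space `Y` with a point `cone a` for each member
of the family, and a coarse projection `gate a` of `Y` to `Z a`. -/
structure CombinationData (X : Type u) [MetricSpace X] where
  Y : Type u
  [metricY : MetricSpace Y]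
  A : Type u
  Z : A → Type u
  [metricZ : ∀ a, MetricSpace (Z a)]
  H : ∀ a, HHSStructure (Z a)
  /-- the coarse map to the hyperbolic space -/
  toY : X → Y
  cone : A → Y
  gate : ∀ a, Y → Set (Z a)
  gate_nonempty : ∀ a y, (gate a y).Nonempty
  /-- the gate of a point of `X` -/
  pr : ∀ a, X → Z a
  /-- the gate in the second member of the cone point of the first one -/
  coneGate : A → ∀ b, Z b
  M : ℝ
  n : ℕ
  θ₀ : ℝ → ℝ
  one_le_M : 1 ≤ M
  δ_le : ∀ a, (H a).δ ≤ M
  ξ_le : ∀ a, (H a).ξ ≤ M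
  K_le : ∀ a, (H a).K ≤ M
  κ₀_le : ∀ a, (H a).κ₀ ≤ M
  lam_le : ∀ a, (H a).lam ≤ M
  E_le : ∀ a, (H a).E ≤ M
  α_le : ∀ a, (H a).α ≤ M
  complexity_le : ∀ a, (H a).complexity ≤ n
  θ_le : ∀ a κ, (H a).θ κ ≤ θ₀ κ
  hyperbolicY : IsHyperbolicSpace Y M
  toY_lipschitz : ∀ x y, dist (toY x) (toY y) ≤ M * dist x y
  pr_lipschitz : ∀ a x y, dist (pr a x) (pr a y) ≤ M * dist x y
  dist_gate_pr_le : ∀ a x, ∀ z ∈ gate a (toY x), dist z (pr a x) ≤ M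
  gate_geodesic : ∀ a (ℓ : ℝ) (γ : ℝ → Y), IsGeodesic ℓ γ →
    (∃ t ∈ Set.Icc 0 ℓ, dist (γ t) (cone a) ≤ M) ∨
      ∀ s ∈ Set.Icc 0 ℓ, ∀ t ∈ Set.Icc 0 ℓ, ∀ z ∈ gate a (γ s), ∀ w ∈ gate a (γ t), dist z w ≤ M
  consistency : ∀ a b, a ≠ b → ∀ x,
    dist (pr a x) (coneGate b a) ≤ M ∨ dist (pr b x) (coneGate a b) ≤ M
  links : ∀ x y, ∃ s : Finset A, (s.card : ℝ) ≤ dist (toY x) (toY y) + 1 ∧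
    (∀ a ∈ s, dist (toY x) (cone a) ≤ dist (toY x) (toY y)) ∧
    ∀ a, a ∉ s → dist (pr a x) (pr a y) ≤ M
  realization : ∀ a (z : Z a), ∃ x, dist (pr a x) z ≤ M ∧ dist (toY x) (cone a) ≤ M ∧
    ∀ b, a ≠ b → dist (pr b x) (coneGate a b) ≤ M
  uniqueness : ∀ r : ℝ, ∃ R : ℝ, ∀ x y, R ≤ dist x y →
    r ≤ dist (toY x) (toY y) ∨ ∃ a, r ≤ dist (pr a x) (pr a y)

attribute [instance] CombinationData.metricY CombinationData.metricZ

/-! ### The hierarchically hyperbolic structure of a combination -/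

namespace CombinationData

variable {X : Type u} [MetricSpace X] (D : CombinationData X)

/-- The index set of the combination. -/
abbrev Idx : Type u := CombIdx fun a => (D.H a).Idx

/-- The hyperbolic spaces of the combination. -/
def C : D.Idx → Type u
  | .top => D.Y
  | .piece a U => (D.H a).C U

instance : ∀ W : D.Idx, MetricSpace (D.C W)
  | .top => inferInstanceAs (MetricSpace D.Y)
  | .piece a U => inferInstanceAs (MetricSpace ((D.H a).C U))

/-- The projections of the combination. -/
def proj : ∀ W : D.Idx, X → Set (D.C W)
  | .top, x => ({D.toY x} : Set D.Y)
  | .piece a U, x => (D.H a).proj U (D.pr a x)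

open Classical in
/-- The subset `ρ^V_W` of `C W`. -/
def rhoSet : D.Idx → ∀ W : D.Idx, Set (D.C W)
  | .top, _ => ∅
  | .piece a _, .top => ({D.cone a} : Set D.Y)
  | .piece a U, .piece b V =>
    if h : a = b then (D.H b).rhoSet (h ▸ U) V else (D.H b).proj V (D.coneGate a b)

open Classical in
/-- The map `ρ^W_V` from `C W` to the subsets of `C V`. -/
def rhoMap : ∀ W V : D.Idx, D.C W → Set (D.C V)
  | _, .top, _ => Set.univ
  | .top, .piece a V, y => ⋃ z ∈ D.gate a y, (D.H a).proj V z
  | .piece a U, .piece b V, p =>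
    if h : a = b then
      (D.H b).rhoMap (h ▸ U) V (cast (by subst h; rfl) p)
    else Set.univ

theorem rhoSet_piece (a : D.A) (U V : (D.H a).Idx) :
    D.rhoSet (.piece a U) (.piece a V) = (D.H a).rhoSet U V := by
  unfold rhoSet; exact dif_pos rfl

theorem rhoSet_piece_of_ne {a b : D.A} (h : a ≠ b) (U : (D.H a).Idx) (V : (D.H b).Idx) :
    D.rhoSet (.piece a U) (.piece b V) = (D.H b).proj V (D.coneGate a b) := by
  unfold rhoSet; exact dif_neg h

theorem rhoMap_piece (a : D.A) (U V : (D.H a).Idx) (p : (D.H a).C U) :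
    D.rhoMap (.piece a U) (.piece a V) p = (D.H a).rhoMap U V p := by
  unfold rhoMap; exact dif_pos rfl

/-- A constant that is large enough for all axioms of the combination. -/
def bound : ℝ := 4 * D.M * D.M + 8 * D.M + 1

theorem M_le_sq : D.M ≤ D.M * D.M := by nlinarith [D.one_le_M]

theorem M_le_bound : D.M ≤ D.bound := by
  have := D.M_le_sq; have := D.one_le_M; unfold bound; linarith

/-- The allowance `2 * D.M` suits two gate points that are both within `D.M` of `pr a x`. -/
theorem dist_proj_le {a : D.A} {U : (D.H a).Idx} {z w : D.Z a} (h : dist z w ≤ 2 * D.M)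
    {p q : (D.H a).C U} (hp : p ∈ (D.H a).proj U z) (hq : q ∈ (D.H a).proj U w) :
    dist p q ≤ D.bound := by
  have h1 := (D.H a).dist_proj_le (D.K_le a) (D.ξ_le a) (zero_le_one.trans D.one_le_M) h hp hq
  have := D.M_le_sq; have := D.one_le_M; unfold bound; linarith

theorem setDist_proj_le {a : D.A} {z w : D.Z a} (h : dist z w ≤ D.M) (U : (D.H a).Idx) :
    setDist ((D.H a).proj U z) ((D.H a).proj U w) ≤ D.M * D.M + D.M :=
  (D.H a).setDist_proj_le (D.K_le a) (zero_le_one.trans D.one_le_M) h U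

theorem setDist_proj_le_of_near {a : D.A} {z w : D.Z a} (h : dist z w ≤ D.M) {U : (D.H a).Idx}
    {S : Set ((D.H a).C U)} (hS : S.Nonempty) (hw : setDist ((D.H a).proj U w) S ≤ D.M) :
    setDist ((D.H a).proj U z) S ≤ D.bound := by
  have h1 := D.setDist_proj_le h U
  have h2 := setDist_triangle ((D.H a).proj_nonempty U z) ((D.H a).proj_nonempty U w) hS
    ((D.H a).proj_diam U w)
  have := D.ξ_le a; have := D.M_le_sq; have := D.one_le_M; unfold bound; linarith

/-- A chain that meets a member of the family stays in it except for the top, which adds one to the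
complexity. -/
theorem isChain_encard_le (s : Set D.Idx) (hs : IsChain (· ≤ ·) s) :
    s.encard ≤ ((D.n + 1 : ℕ) : ℕ∞) := by
  by_cases h : ∃ a U, CombIdx.piece a U ∈ s
  · obtain ⟨a, U, hU⟩ := h
    have hsub : s ⊆ insert .top (CombIdx.piece a '' {V | CombIdx.piece a V ∈ s}) := by
      intro x hx
      cases x with
      | top => exact .inl rfl
      | piece b V =>
        obtain h | h := hs.total hU hx
        · cases h with | piece _ _ _ h => exact .inr ⟨_, hx, rfl⟩
        · cases h with | piece _ _ _ h => exact .inr ⟨_, hx, rfl⟩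
    have hchain : IsChain (· ≤ ·) {V | CombIdx.piece a V ∈ s} := by
      intro V hV W hW hne
      have := hs hV hW fun h => hne (by cases h; rfl)
      simpa only [CombIdx.piece_le_piece] using this
    calc s.encard ≤ _ := Set.encard_le_encard hsub
      _ ≤ _ := Set.encard_insert_le _ _
      _ ≤ _ := by
        push_cast
        gcongr
        refine (Set.encard_image_le _ _).trans (((D.H a).finite_complexity _ hchain).trans ?_)
        exact_mod_cast D.complexity_le a
  · have hsub : s ⊆ {.top} := by
      intro x hx
      cases x with
      | top => rfl
      | piece b V => exact (h ⟨b, V, hx⟩).elim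
    refine (Set.encard_le_encard hsub).trans ?_
    rw [Set.encard_singleton]
    exact_mod_cast Nat.le_add_left 1 D.n

theorem exists_links (W : D.Idx) (x x' : X) : ∃ s : Finset D.Idx,
    s.card ≤ ⌊D.bound * setDist (D.proj W x) (D.proj W x') + D.bound⌋₊ ∧
    (∀ T ∈ s, T < W) ∧
    (∀ T, T < W → (∃ T' ∈ s, T ≤ T') ∨ setDist (D.proj T x) (D.proj T x') < D.bound) ∧
    (∀ T ∈ s, setDist (D.proj W x) (D.rhoSet T W) ≤
      D.bound * setDist (D.proj W x) (D.proj W x') + D.bound) := by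
  classical
  have hM := D.one_le_M
  have hB := D.M_le_bound
  cases W with
  | top =>
    obtain ⟨s, hcard, hs, hs'⟩ := D.links x x'
    have hd : setDist (D.proj .top x) (D.proj .top x') = dist (D.toY x) (D.toY x') :=
      setDist_singleton _ _
    rw [hd]
    have hle : dist (D.toY x) (D.toY x') + 1 ≤ D.bound * dist (D.toY x) (D.toY x') + D.bound := by
      have : 1 * dist (D.toY x) (D.toY x') ≤ D.bound * dist (D.toY x) (D.toY x') := by
        gcongr; linarith
      linarith
    let f : D.A → D.Idx := fun a =>
      if h : Nonempty (D.H a).Idx then .piece a ((D.H a).exists_forall_le h.some).choose else .top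
    have hf : ∀ a (V : (D.H a).Idx), ∃ S, f a = .piece a S ∧ V ≤ S := fun a V => by
      have h : Nonempty (D.H a).Idx := ⟨V⟩
      exact ⟨_, dif_pos h, ((D.H a).exists_forall_le h.some).choose_spec V⟩
    refine ⟨(s.filter fun a => Nonempty (D.H a).Idx).image f, ?_, ?_, ?_, ?_⟩
    · refine Nat.le_floor (le_trans ?_ (hcard.trans hle))
      exact_mod_cast Finset.card_image_le.trans (Finset.card_filter_le _ _)
    · intro T hT
      obtain ⟨a, ha, rfl⟩ := Finset.mem_image.1 hT
      obtain ⟨S, hS, -⟩ := hf a (Finset.mem_filter.1 ha).2.some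
      rw [hS]
      exact CombIdx.piece_lt_top _ _
    · intro T hT
      cases T with
      | top => exact (lt_irrefl _ hT).elim
      | piece a V =>
        by_cases ha : a ∈ s
        · obtain ⟨S, hS, hV⟩ := hf a V
          refine .inl ⟨f a, Finset.mem_image_of_mem _ (Finset.mem_filter.2 ⟨ha, ⟨V⟩⟩), ?_⟩
          rw [hS]
          exact CombIdx.piece_le_piece.2 hV
        · refine .inr (lt_of_le_of_lt (D.setDist_proj_le (hs' a ha) V) ?_)
          have := D.M_le_sq
          unfold bound; linarith
    · intro T hT
      obtain ⟨a, ha, rfl⟩ := Finset.mem_image.1 hT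
      obtain ⟨S, hS, -⟩ := hf a (Finset.mem_filter.1 ha).2.some
      rw [hS]
      have : setDist (D.proj .top x) (D.rhoSet (.piece a S) .top) = dist (D.toY x) (D.cone a) :=
        setDist_singleton _ _
      rw [this]
      have := hs a (Finset.mem_filter.1 ha).1
      linarith
  | piece a W =>
    obtain ⟨s, hcard, h1, h2, h3⟩ := (D.H a).large_links W (D.pr a x) (D.pr a x')
    have hd := setDist_nonneg ((D.H a).proj W (D.pr a x)) ((D.H a).proj W (D.pr a x'))
    have hle : (D.H a).lam * setDist ((D.H a).proj W (D.pr a x)) ((D.H a).proj W (D.pr a x')) +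
        (D.H a).lam ≤ D.bound * setDist ((D.H a).proj W (D.pr a x))
          ((D.H a).proj W (D.pr a x')) + D.bound := by
      have := (D.lam_le a).trans hB
      gcongr
    refine ⟨s.image (CombIdx.piece a), ?_, ?_, ?_, ?_⟩
    · exact Finset.card_image_le.trans (hcard.trans (Nat.floor_le_floor hle))
    · intro T hT
      obtain ⟨V, hV, rfl⟩ := Finset.mem_image.1 hT
      exact CombIdx.piece_lt_piece.2 (h1 V hV)
    · intro T hT
      obtain ⟨V, rfl, hV⟩ := CombIdx.lt_piece.1 hT
      obtain ⟨T', hT', hle'⟩ | h := h2 V hV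
      · exact .inl ⟨_, Finset.mem_image_of_mem _ hT', CombIdx.piece_le_piece.2 hle'⟩
      · exact .inr (h.trans_le ((D.E_le a).trans hB))
    · intro T hT
      obtain ⟨V, hV, rfl⟩ := Finset.mem_image.1 hT
      rw [rhoSet_piece]
      exact (h3 V hV).trans hle

theorem exists_realization [Nonempty X] (J : Set D.Idx) (p : ∀ V, D.C V)
    (hJ : ∀ V ∈ J, ∀ W ∈ J, V ≠ W → CombIdx.Side (fun a => (D.H a).perp) V W)
    (hp : ∀ V ∈ J, ∃ y : X, p V ∈ D.proj V y) :
    ∃ x : X, ∀ V ∈ J, setDist (D.proj V x) {p V} ≤ D.bound ∧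
      (∀ W, V < W → setDist (D.proj W x) (D.rhoSet V W) ≤ D.bound) ∧
      (∀ W, IsTransverse (CombIdx.Side fun a => (D.H a).perp) W V →
        setDist (D.proj W x) (D.rhoSet V W) ≤ D.bound) := by
  have hM := D.one_le_M
  have hB := D.M_le_bound
  -- Nothing is orthogonal to the top, and orthogonality stays inside one member of the family. So
  -- `J` consists of the top alone, lies in one member, or is empty; in the last case any point of
  -- `X` will do.
  by_cases htop : .top ∈ J
  · obtain ⟨y, hy⟩ := hp _ htop
    refine ⟨y, fun V hV => ?_⟩
    cases V with
    | top =>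
      refine ⟨?_, fun W hW => (CombIdx.not_top_lt _ hW).elim,
        fun W hW => (CombIdx.not_isTransverse_top_right _ hW).elim⟩
      have : setDist (D.proj .top y) {p .top} ≤ dist (p .top) (p .top) :=
        setDist_le_dist hy rfl
      rw [dist_self] at this
      linarith
    | piece a V => cases hJ _ htop _ hV (by simp)
  by_cases hpiece : ∃ a U, CombIdx.piece a U ∈ J
  · obtain ⟨a, U, hU⟩ := hpiece
    have hall : ∀ V ∈ J, ∃ V', V = .piece a V' := by
      intro V hV
      by_cases h : CombIdx.piece a U = V
      · exact ⟨U, h.symm⟩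
      · cases hJ _ hU _ hV h with | piece _ _ V' _ => exact ⟨V', rfl⟩
    obtain ⟨z, hz⟩ := (D.H a).partial_realization {V | CombIdx.piece a V ∈ J}
      (fun V => p (.piece a V))
      (fun V hV W hW hne => CombIdx.side_piece.1 (hJ _ hV _ hW fun h => hne (by cases h; rfl)))
      (fun V hV => by
        obtain ⟨y, hy⟩ := hp _ hV
        exact ⟨D.pr a y, hy⟩)
    obtain ⟨x, hx, hxc, hxb⟩ := D.realization a z
    refine ⟨x, fun V hV => ?_⟩
    obtain ⟨V, rfl⟩ := hall V hV
    obtain ⟨h1, h2, h3⟩ := hz V hV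
    refine ⟨D.setDist_proj_le_of_near hx (Set.singleton_nonempty _) (h1.trans (D.α_le a)), ?_, ?_⟩
    · intro W hW
      obtain rfl | ⟨W, rfl, -⟩ := CombIdx.piece_le.1 hW.le
      · have : setDist (D.proj .top x) (D.rhoSet (.piece a V) .top) = dist (D.toY x) (D.cone a) :=
          setDist_singleton _ _
        rw [this]
        linarith
      · rw [CombIdx.piece_lt_piece] at hW
        rw [rhoSet_piece]
        exact D.setDist_proj_le_of_near hx ((D.H a).rhoSet_nonempty_of_lt _ _ hW)
          ((h2 W hW).trans (D.α_le a))
    · intro W hW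
      cases W with
      | top => exact (CombIdx.not_isTransverse_top_left _ hW).elim
      | piece b W =>
        by_cases hab : a = b
        · subst hab
          rw [CombIdx.isTransverse_piece] at hW
          rw [rhoSet_piece]
          refine D.setDist_proj_le_of_near hx ((D.H a).rhoSet_nonempty_of_transverse _ _
            ⟨fun h => hW.1 ((D.H a).perp_symm _ _ h), hW.2.2, hW.2.1⟩)
            ((h3 W hW).trans (D.α_le a))
        · rw [rhoSet_piece_of_ne _ hab]
          refine (D.setDist_proj_le (hxb b hab) W).trans ?_
          have := D.M_le_sq
          unfold bound; linarith
  · obtain ⟨x⟩ := ‹Nonempty X›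
    refine ⟨x, fun V hV => ?_⟩
    cases V with
    | top => exact (htop hV).elim
    | piece a V => exact (hpiece ⟨a, V, hV⟩).elim

/-- The hierarchically hyperbolic structure on a space that is hyperbolic relative to a family of
hierarchically hyperbolic spaces. -/
def toHHSStructure [Nonempty X] : HHSStructure X where
  Idx := D.Idx
  C := D.C
  perp := CombIdx.Side fun a => (D.H a).perp
  proj := D.proj
  rhoSet := D.rhoSet
  rhoMap := D.rhoMap
  δ := D.M
  ξ := D.M
  K := D.bound
  κ₀ := D.bound
  lam := D.bound
  E := D.bound
  α := D.bound
  complexity := D.n + 1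
  -- The maximum serves both outcomes: `κ` is needed if the top sees the distance, and `θ₀ κ` if a
  -- member of the family does and its own uniqueness axiom is applied.
  θ κ := (D.uniqueness (max κ (D.θ₀ κ))).choose
  δ_nonneg := zero_le_one.trans D.one_le_M
  ξ_nonneg := zero_le_one.trans D.one_le_M
  κ₀_nonneg := (zero_le_one.trans D.one_le_M).trans D.M_le_bound
  one_le_lam := D.one_le_M.trans D.M_le_bound
  E_ge := max_le D.M_le_bound le_rfl
  hyperbolic
    | .top => D.hyperbolicY
    | .piece a U => ⟨((D.H a).hyperbolic U).1, fun x y z w =>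
        (((D.H a).hyperbolic U).2 x y z w).trans (add_le_add_right
          (mul_le_mul_of_nonneg_left (D.δ_le a) zero_le_two) _)⟩
  proj_nonempty
    | .top, _ => Set.singleton_nonempty _
    | .piece a U, x => (D.H a).proj_nonempty U _
  proj_diam
    | .top, x => by
      rintro _ rfl _ rfl
      refine (dist_self (α := D.Y) _).le.trans ?_
      exact zero_le_one.trans D.one_le_M
    | .piece a U, x => ((D.H a).proj_diam U _).mono (D.ξ_le a)
  proj_lipschitz W x y := by
    have hM := D.one_le_M
    have hMM := D.M_le_sq
    cases W with
    | top =>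
      refine (setDist_singleton _ _).le.trans ((D.toY_lipschitz x y).trans ?_)
      have : D.M * dist x y ≤ D.bound * dist x y := by gcongr; exact D.M_le_bound
      have := D.M_le_bound
      linarith
    | piece a U =>
      refine ((D.H a).setDist_proj_le (D.K_le a) (by linarith) (D.pr_lipschitz a x y) U).trans ?_
      have h : D.M * D.M * dist x y ≤ D.bound * dist x y := by
        gcongr
        unfold bound
        linarith
      have := D.M_le_bound
      linarith
  exists_max := .inr ⟨.top, fun x _ => CombIdx.le_top x,
    fun S hS => CombIdx.top_le.1 (hS (CombIdx.le_top S))⟩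
  rhoSet_nonempty_of_lt V W h := by
    cases W with
    | top =>
      cases V with
      | top => exact (lt_irrefl _ h).elim
      | piece a V => exact Set.singleton_nonempty _
    | piece a W =>
      obtain ⟨V, rfl, h'⟩ := CombIdx.lt_piece.1 h
      rw [rhoSet_piece]
      exact (D.H a).rhoSet_nonempty_of_lt _ _ h'
  rhoSet_diam_of_lt V W h := by
    cases W with
    | top =>
      cases V with
      | top => exact (lt_irrefl _ h).elim
      | piece a V =>
        rintro _ rfl _ rfl
        refine (dist_self (α := D.Y) _).le.trans ?_
        exact zero_le_one.trans D.one_le_M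
    | piece a W =>
      obtain ⟨V, rfl, h'⟩ := CombIdx.lt_piece.1 h
      rw [rhoSet_piece]
      exact ((D.H a).rhoSet_diam_of_lt _ _ h').mono (D.ξ_le a)
  rhoMap_nonempty V W h p := by
    cases W with
    | top =>
      cases V with
      | top => exact (lt_irrefl _ h).elim
      | piece a V =>
        obtain ⟨z, hz⟩ := D.gate_nonempty a p
        exact ((D.H a).proj_nonempty V z).mono (Set.subset_biUnion_of_mem (u := fun z =>
          (D.H a).proj V z) hz)
    | piece a W =>
      obtain ⟨V, rfl, h'⟩ := CombIdx.lt_piece.1 h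
      exact ((D.H a).rhoMap_nonempty _ _ h' p).mono (D.rhoMap_piece a W V p).ge
  perp_symm := by
    rintro _ _ ⟨a, U, V, h⟩
    exact CombIdx.side_piece.2 ((D.H a).perp_symm _ _ h)
  perp_irrefl V h := by
    cases h with | piece a U _ h => exact (D.H a).perp_irrefl _ h
  perp_of_le := by
    rintro V _ _ hV ⟨a, W, U, h⟩
    obtain ⟨V, rfl, hV'⟩ := CombIdx.le_piece.1 hV
    exact CombIdx.side_piece.2 ((D.H a).perp_of_le _ _ _ hV' h)
  perp_container T U hU := by
    rintro ⟨_, hV, ⟨a, V, U, hVU⟩⟩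
    obtain rfl | ⟨T, rfl, hUT⟩ := CombIdx.piece_le.1 hU
    -- Everything orthogonal to `U` lies in its own member of the family, so the largest index of
    -- this member is a container properly below the top.
    · obtain ⟨S, hS⟩ := (D.H a).exists_forall_le U
      refine ⟨.piece a S, CombIdx.piece_lt_top _ _, ?_⟩
      rintro _ ⟨_, W, _, -⟩ -
      exact CombIdx.piece_le_piece.2 (hS W)
    · obtain ⟨W, hW, hW'⟩ :=
        (D.H a).perp_container T U hUT ⟨V, CombIdx.piece_le_piece.1 hV, hVU⟩
      refine ⟨.piece a W, CombIdx.piece_lt_piece.2 hW, ?_⟩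
      rintro _ ⟨_, V', _, h⟩ hle
      exact CombIdx.piece_le_piece.2 (hW' V' h (CombIdx.piece_le_piece.1 hle))
  perp_not_le := by
    rintro _ _ ⟨a, U, V, h⟩
    simpa only [CombIdx.piece_le_piece] using (D.H a).perp_not_le _ _ h
  rhoSet_nonempty_of_transverse V W h := by
    cases V with
    | top => exact (CombIdx.not_isTransverse_top_left _ h).elim
    | piece a V =>
      cases W with
      | top => exact (CombIdx.not_isTransverse_top_right _ h).elim
      | piece b W =>
        by_cases hab : a = b
        · subst hab
          rw [rhoSet_piece]
          exact (D.H a).rhoSet_nonempty_of_transverse _ _ (CombIdx.isTransverse_piece.1 h)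
        · rw [rhoSet_piece_of_ne _ hab]
          exact (D.H b).proj_nonempty _ _
  rhoSet_diam_of_transverse V W h := by
    cases V with
    | top => exact (CombIdx.not_isTransverse_top_left _ h).elim
    | piece a V =>
      cases W with
      | top => exact (CombIdx.not_isTransverse_top_right _ h).elim
      | piece b W =>
        by_cases hab : a = b
        · subst hab
          rw [rhoSet_piece]
          exact ((D.H a).rhoSet_diam_of_transverse _ _ (CombIdx.isTransverse_piece.1 h)).mono
            (D.ξ_le a)
        · rw [rhoSet_piece_of_ne _ hab]
          exact ((D.H b).proj_diam _ _).mono (D.ξ_le b)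
  consistency_transverse V W h x := by
    cases V with
    | top => exact (CombIdx.not_isTransverse_top_left _ h).elim
    | piece a V =>
      cases W with
      | top => exact (CombIdx.not_isTransverse_top_right _ h).elim
      | piece b W =>
        by_cases hab : a = b
        · subst hab
          rw [rhoSet_piece, rhoSet_piece]
          exact ((D.H a).consistency_transverse _ _ (CombIdx.isTransverse_piece.1 h) _).trans
            ((D.κ₀_le a).trans D.M_le_bound)
        · rw [rhoSet_piece_of_ne _ hab, rhoSet_piece_of_ne _ (Ne.symm hab), min_le_iff]
          have hle : D.M * D.M + D.M ≤ D.bound := by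
            have := D.M_le_sq; have := D.one_le_M; unfold bound; linarith
          exact (D.consistency a b hab x).symm.imp
            (fun h => (D.setDist_proj_le h W).trans hle)
            (fun h => (D.setDist_proj_le h V).trans hle)
  consistency_nested V W h x := by
    have hM := D.one_le_M
    cases W with
    | top =>
      cases V with
      | top => exact (lt_irrefl _ h).elim
      | piece a V =>
        -- The second alternative always holds here, since the gates of `toY x` are close to `pr a
        -- x`.
        refine .inr ?_
        have key : ∀ p ∈ D.proj (.piece a V) x ∪
            ⋃ y ∈ D.proj .top x, D.rhoMap .top (.piece a V) y,
            ∃ z, dist z (D.pr a x) ≤ D.M ∧ p ∈ (D.H a).proj V z := by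
          rintro p (hp | hp)
          · exact ⟨_, by rw [dist_self]; linarith, hp⟩
          · obtain ⟨y, rfl, hp'⟩ := Set.mem_iUnion₂.1 hp
            obtain ⟨z, hz, hp''⟩ := Set.mem_iUnion₂.1 hp'
            exact ⟨z, D.dist_gate_pr_le a x z hz, hp''⟩
        intro p hp q hq
        obtain ⟨z, hz, hp⟩ := key p hp
        obtain ⟨w, hw, hq⟩ := key q hq
        refine D.dist_proj_le ?_ hp hq
        have := dist_triangle_right z w (D.pr a x)
        linarith
    | piece a W =>
      obtain ⟨V, rfl, h'⟩ := CombIdx.lt_piece.1 h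
      simp only [rhoSet_piece]
      have hle := (D.κ₀_le a).trans D.M_le_bound
      refine ((D.H a).consistency_nested _ _ h' (D.pr a x)).imp (fun h => h.trans hle)
        fun h => ?_
      have : (⋃ p ∈ D.proj (.piece a W) x, D.rhoMap (.piece a W) (.piece a V) p) =
          ⋃ p ∈ (D.H a).proj W (D.pr a x), (D.H a).rhoMap W V p :=
        Set.iUnion₂_congr fun p _ => D.rhoMap_piece a W V p
      rw [this]
      exact h.mono hle
  consistency_rho U V W hUV h := by
    cases W with
    | top =>
      obtain h | h := h
      · cases V with
        | top => exact (lt_irrefl _ h).elim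
        | piece a V =>
          obtain ⟨U, rfl, -⟩ := CombIdx.le_piece.1 hUV
          refine (setDist_singleton _ _).le.trans ((dist_self (α := D.Y) _).le.trans ?_)
          exact (zero_le_one.trans D.one_le_M).trans D.M_le_bound
      · exact (CombIdx.not_isTransverse_top_right _ h.1).elim
    | piece b W =>
      cases V with
      | top =>
        obtain h | h := h
        · exact (CombIdx.not_top_lt _ h).elim
        · exact (CombIdx.not_isTransverse_top_left _ h.1).elim
      | piece a V =>
        obtain ⟨U, rfl, hUV'⟩ := CombIdx.le_piece.1 hUV
        by_cases hab : a = b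
        · subst hab
          rw [rhoSet_piece, rhoSet_piece]
          rw [CombIdx.piece_lt_piece, CombIdx.isTransverse_piece, CombIdx.side_piece] at h
          exact ((D.H a).consistency_rho _ _ _ hUV' h).trans ((D.κ₀_le a).trans D.M_le_bound)
        -- Between different members `ρ` depends only on the member containing the first index, so
        -- the two sets coincide.
        · rw [rhoSet_piece_of_ne _ hab, rhoSet_piece_of_ne _ hab]
          obtain ⟨p, hp⟩ := (D.H b).proj_nonempty W (D.coneGate a b)
          refine (setDist_le_dist hp hp).trans ?_
          rw [dist_self]
          exact (zero_le_one.trans D.one_le_M).trans D.M_le_bound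
  finite_complexity := D.isChain_encard_le
  large_links := D.exists_links
  bounded_geodesic_image V W h ℓ γ hγ := by
    have hM := D.one_le_M
    cases W with
    | top =>
      cases V with
      | top => exact (lt_irrefl _ h).elim
      | piece a V =>
        refine (D.gate_geodesic a ℓ γ hγ).symm.imp (fun h => ?_) ?_
        · intro p hp q hq
          obtain ⟨s, hs, hp⟩ := Set.mem_iUnion₂.1 hp
          obtain ⟨z, hz, hp⟩ := Set.mem_iUnion₂.1 hp
          obtain ⟨t, ht, hq⟩ := Set.mem_iUnion₂.1 hq
          obtain ⟨w, hw, hq⟩ := Set.mem_iUnion₂.1 hq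
          refine D.dist_proj_le ?_ hp hq
          have := h s hs t ht z hz w hw
          linarith
        · rintro ⟨t, ht, h⟩
          exact ⟨t, ht, (setDist_singleton _ _).le.trans (h.trans D.M_le_bound)⟩
    | piece a W =>
      obtain ⟨V, rfl, h'⟩ := CombIdx.lt_piece.1 h
      have hle := (D.E_le a).trans D.M_le_bound
      have := (D.H a).bounded_geodesic_image V W h' ℓ γ hγ
      rw [rhoSet_piece]
      refine this.imp (fun h => ?_) ?_
      · have : (⋃ t ∈ Set.Icc 0 ℓ, D.rhoMap (.piece a W) (.piece a V) (γ t)) =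
            ⋃ t ∈ Set.Icc 0 ℓ, (D.H a).rhoMap W V (γ t) :=
          Set.iUnion₂_congr fun t _ => D.rhoMap_piece a W V (γ t)
        rw [this]
        exact h.mono hle
      · rintro ⟨t, ht, h⟩
        exact ⟨t, ht, h.trans hle⟩
  partial_realization := D.exists_realization
  uniqueness κ hκ x y h := by
    obtain h | ⟨a, h⟩ := (D.uniqueness (max κ (D.θ₀ κ))).choose_spec x y h
    · exact ⟨.top, ((le_max_left _ _).trans h).trans (setDist_singleton _ _).ge⟩
    · obtain ⟨V, hV⟩ := (D.H a).uniqueness κ hκ (D.pr a x) (D.pr a y)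
        ((D.θ_le a κ).trans ((le_max_right _ _).trans h))
      exact ⟨.piece a V, hV⟩

end CombinationData

/-! ### Geodesics -/

section Joined

variable {X : Type*} [MetricSpace X]

/-- The two points are joined by a geodesic. -/
def Joined (x y : X) : Prop :=
  ∃ (ℓ : ℝ) (γ : ℝ → X), IsGeodesic ℓ γ ∧ γ 0 = x ∧ γ ℓ = y

theorem Joined.refl (x : X) : Joined x x :=
  ⟨0, fun _ => x, ⟨le_rfl, fun s hs t ht => by
    rw [dist_self, le_antisymm hs.2 hs.1, le_antisymm ht.2 ht.1]; simp⟩, rfl, rfl⟩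

theorem IsGeodesic.joined_of_le {ℓ s t : ℝ} {γ : ℝ → X} (h : IsGeodesic ℓ γ) (hs : 0 ≤ s)
    (hst : s ≤ t) (ht : t ≤ ℓ) : Joined (γ s) (γ t) := by
  refine ⟨t - s, fun τ => γ (s + τ), ⟨by linarith, fun a ha b hb => ?_⟩, by simp, by simp⟩
  rw [h.2 _ ⟨by linarith [ha.1], by linarith [ha.2]⟩ _ ⟨by linarith [hb.1], by linarith [hb.2]⟩]
  congr 1
  ring

theorem Joined.symm {x y : X} (h : Joined x y) : Joined y x := by
  obtain ⟨ℓ, γ, h, rfl, rfl⟩ := h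
  refine ⟨ℓ, fun τ => γ (ℓ - τ), ⟨h.1, fun a ha b hb => ?_⟩, by simp, by simp⟩
  rw [h.2 _ ⟨by linarith [ha.2], by linarith [ha.1]⟩ _ ⟨by linarith [hb.2], by linarith [hb.1]⟩,
    abs_sub_comm]
  congr 1
  ring

theorem IsGeodesic.joined {ℓ s t : ℝ} {γ : ℝ → X} (h : IsGeodesic ℓ γ) (hs : s ∈ Set.Icc 0 ℓ)
    (ht : t ∈ Set.Icc 0 ℓ) : Joined (γ s) (γ t) := by
  obtain hst | hst := le_total s t
  · exact h.joined_of_le hs.1 hst ht.2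
  · exact (h.joined_of_le ht.1 hst hs.2).symm

/-- The hypothesis is the reverse triangle inequality, so equality holds, and then the concatenation
of the two geodesics is a geodesic. -/
theorem Joined.trans {x y z : X} (h : Joined x y) (h' : Joined y z)
    (hd : dist x y + dist y z ≤ dist x z) : Joined x z := by
  obtain ⟨ℓ, γ, h, rfl, rfl⟩ := h
  obtain ⟨m, η, h', hy, rfl⟩ := h'
  have h0 : (0 : ℝ) ∈ Set.Icc 0 ℓ := ⟨le_rfl, h.1⟩
  have hl : ℓ ∈ Set.Icc 0 ℓ := ⟨h.1, le_rfl⟩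
  have k0 : (0 : ℝ) ∈ Set.Icc 0 m := ⟨le_rfl, h'.1⟩
  have km : m ∈ Set.Icc 0 m := ⟨h'.1, le_rfl⟩
  have e1 : dist (γ 0) (γ ℓ) = ℓ := by rw [h.2 _ h0 _ hl]; simp [abs_of_nonneg h.1]
  have e2 : dist (γ ℓ) (η m) = m := by rw [← hy, h'.2 _ k0 _ km]; simp [abs_of_nonneg h'.1]
  rw [e1, e2] at hd
  have key : ∀ s ∈ Set.Icc 0 ℓ, ∀ t ∈ Set.Icc ℓ (ℓ + m), dist (γ s) (η (t - ℓ)) = t - s := by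
    intro s hs t ht
    have ht' : t - ℓ ∈ Set.Icc 0 m := ⟨by linarith [ht.1], by linarith [ht.2]⟩
    have a1 : dist (γ 0) (γ s) = s := by rw [h.2 _ h0 _ hs]; simp [abs_of_nonneg hs.1]
    have a2 : dist (γ s) (γ ℓ) = ℓ - s := by
      rw [h.2 _ hs _ hl, abs_sub_comm, abs_of_nonneg (by linarith [hs.2])]
    have a3 : dist (γ ℓ) (η (t - ℓ)) = t - ℓ := by
      rw [← hy, h'.2 _ k0 _ ht', zero_sub, abs_neg, abs_of_nonneg ht'.1]
    have a4 : dist (η (t - ℓ)) (η m) = m - (t - ℓ) := by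
      rw [h'.2 _ ht' _ km, abs_sub_comm, abs_of_nonneg (by linarith [ht'.2])]
    have := dist_triangle (γ s) (γ ℓ) (η (t - ℓ))
    have := dist_triangle4 (γ 0) (γ s) (η (t - ℓ)) (η m)
    linarith
  have hm := h'.1
  refine ⟨ℓ + m, fun t => if t ≤ ℓ then γ t else η (t - ℓ), ⟨by linarith [h.1], ?_⟩,
    if_pos h.1, ?_⟩
  · intro s hs t ht
    by_cases hs' : s ≤ ℓ <;> by_cases ht' : t ≤ ℓ
    · simp only [if_pos hs', if_pos ht']
      exact h.2 _ ⟨hs.1, hs'⟩ _ ⟨ht.1, ht'⟩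
    · simp only [if_pos hs', if_neg ht']
      rw [key s ⟨hs.1, hs'⟩ t ⟨by linarith, ht.2⟩, abs_sub_comm, abs_of_nonneg (by linarith)]
    · simp only [if_neg hs', if_pos ht']
      rw [dist_comm, key t ⟨ht.1, ht'⟩ s ⟨by linarith, hs.2⟩, abs_of_nonneg (by linarith)]
    · simp only [if_neg hs', if_neg ht']
      rw [h'.2 _ ⟨by linarith, by linarith [hs.2]⟩ _ ⟨by linarith, by linarith [ht.2]⟩]
      congr 1
      ring
  · by_cases hm0 : ℓ + m ≤ ℓ
    · have : m = 0 := by linarith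
      subst this
      simp [hy]
    · simp only [if_neg hm0, add_sub_cancel_left]

end Joined

/-! ### The geometric realization of a connected graph -/

/-- A point of the geometric realization of a connected graph: a vertex, or a point in the
interior of one of the two segments that are glued in for each edge, one for each direction. -/
@[ext] structure Realization {V : Type u} (Γ : SimpleGraph V) (_ : Γ.Connected) : Type u where
  src : V
  tgt : V
  pos : ℝ
  valid : (src = tgt ∧ pos = 0) ∨ (Γ.Adj src tgt ∧ 0 < pos ∧ pos < 1)

namespace Realization

variable {V : Type u} {Γ : SimpleGraph V} {hΓ : Γ.Connected}

/-- The end points of the segment of a point. -/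
def endpt (p : Realization Γ hΓ) : Bool → V
  | true => p.src
  | false => p.tgt

/-- The distances to the end points of the segment of a point. -/
def off (p : Realization Γ hΓ) : Bool → ℝ
  | true => p.pos
  | false => Γ.dist p.src p.tgt - p.pos

/-- The two points lie on the same segment. -/
def Same (p q : Realization Γ hΓ) : Prop := p.src = q.src ∧ p.tgt = q.tgt

/-- The length of a shortest path between two points that goes through end points. -/
def through (p q : Realization Γ hΓ) (b c : Bool) : ℝ :=
  p.off b + Γ.dist (p.endpt b) (q.endpt c) + q.off c

open Classical in
/-- The path metric. -/
def pathDist (p q : Realization Γ hΓ) : ℝ :=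
  if p.Same q then |p.pos - q.pos| else
    min (min (p.through q true true) (p.through q true false))
      (min (p.through q false true) (p.through q false false))

variable (p q r : Realization Γ hΓ)

theorem pos_nonneg : 0 ≤ p.pos := by
  obtain h | h := p.valid
  · exact h.2.ge
  · exact h.2.1.le

theorem pos_le : p.pos ≤ Γ.dist p.src p.tgt := by
  obtain h | h := p.valid
  · rw [h.2]; positivity
  · rw [SimpleGraph.dist_eq_one_iff_adj.2 h.1]; exact_mod_cast h.2.2.le

theorem len_le : (Γ.dist p.src p.tgt : ℝ) ≤ 1 := by
  obtain h | h := p.valid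
  · rw [h.1]; simp
  · rw [SimpleGraph.dist_eq_one_iff_adj.2 h.1]; simp

theorem off_nonneg (b : Bool) : 0 ≤ p.off b := by
  cases b
  · exact sub_nonneg.2 p.pos_le
  · exact p.pos_nonneg

theorem dist_endpt_le (b c : Bool) : (Γ.dist (p.endpt b) (p.endpt c) : ℝ) ≤ p.off b + p.off c := by
  have := p.pos_nonneg
  have := p.pos_le
  cases b <;> cases c <;> simp only [endpt, off, SimpleGraph.dist_self, Nat.cast_zero]
  · linarith
  · rw [SimpleGraph.dist_comm]; linarith
  · linarith
  · linarith

variable {p q r}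

theorem Same.symm (h : p.Same q) : q.Same p := ⟨h.1.symm, h.2.symm⟩

theorem Same.trans (h : p.Same q) (h' : q.Same r) : p.Same r :=
  ⟨h.1.trans h'.1, h.2.trans h'.2⟩

theorem Same.endpt_eq (h : p.Same q) (b : Bool) : p.endpt b = q.endpt b := by
  cases b
  · exact h.2
  · exact h.1

theorem Same.off_le (h : p.Same q) (b : Bool) : p.off b ≤ |p.pos - q.pos| + q.off b := by
  have := neg_abs_le (p.pos - q.pos)
  have := le_abs_self (p.pos - q.pos)
  cases b
  · simp only [off, h.1, h.2]; linarith
  · simp only [off]; linarith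

/-- The end points of a segment are as far apart as the segment is long, so leaving it never yields
a shortcut. Thus `pathDist` is bounded by every `through`, whether or not the points share a
segment. -/
theorem Same.le_through (h : p.Same q) (b c : Bool) : |p.pos - q.pos| ≤ p.through q b c := by
  have h1 := p.pos_nonneg
  have h2 := p.pos_le
  have h3 := q.pos_nonneg
  have h4 := q.pos_le
  rw [h.1, h.2] at h2
  rw [abs_le]
  cases b <;> cases c <;>
    simp only [through, endpt, off, h.1, h.2, SimpleGraph.dist_self, Nat.cast_zero]
  · constructor <;> linarith
  · rw [SimpleGraph.dist_comm (u := q.tgt)]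
    constructor <;> linarith
  · constructor <;> linarith
  · constructor <;> linarith

theorem pathDist_of_same (h : p.Same q) : pathDist p q = |p.pos - q.pos| := if_pos h

theorem pathDist_le_through (b c : Bool) : pathDist p q ≤ p.through q b c := by
  unfold pathDist
  split_ifs with h
  · exact h.le_through b c
  · cases b <;> cases c
    · exact (min_le_right _ _).trans (min_le_right _ _)
    · exact (min_le_right _ _).trans (min_le_left _ _)
    · exact (min_le_left _ _).trans (min_le_right _ _)
    · exact (min_le_left _ _).trans (min_le_left _ _)

theorem exists_pathDist_eq_through (h : ¬ p.Same q) : ∃ b c, pathDist p q = p.through q b c := by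
  unfold pathDist
  rw [if_neg h]
  obtain h | h := min_choice (min (p.through q true true) (p.through q true false))
      (min (p.through q false true) (p.through q false false)) <;> rw [h]
  · obtain h | h := min_choice (p.through q true true) (p.through q true false) <;> rw [h]
    exacts [⟨_, _, rfl⟩, ⟨_, _, rfl⟩]
  · obtain h | h := min_choice (p.through q false true) (p.through q false false) <;> rw [h]
    exacts [⟨_, _, rfl⟩, ⟨_, _, rfl⟩]

theorem through_comm (b c : Bool) : p.through q b c = q.through p c b := by
  unfold through
  rw [SimpleGraph.dist_comm]
  ring

theorem pathDist_comm (p q : Realization Γ hΓ) : pathDist p q = pathDist q p := by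
  by_cases h : p.Same q
  · rw [pathDist_of_same h, pathDist_of_same h.symm, abs_sub_comm]
  · apply le_antisymm
    · obtain ⟨b, c, h'⟩ := exists_pathDist_eq_through fun h' => h h'.symm
      rw [h', through_comm]
      exact pathDist_le_through _ _
    · obtain ⟨b, c, h'⟩ := exists_pathDist_eq_through h
      rw [h', through_comm]
      exact pathDist_le_through _ _

theorem dist_cast_triangle (hΓ : Γ.Connected) (u v w : V) :
    (Γ.dist u w : ℝ) ≤ Γ.dist u v + Γ.dist v w := by
  exact_mod_cast hΓ.dist_triangle

theorem pathDist_triangle_of_same (h : p.Same q) (h' : ¬ q.Same r) :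
    pathDist p r ≤ pathDist p q + pathDist q r := by
  obtain ⟨b, c, e⟩ := exists_pathDist_eq_through h'
  rw [e, pathDist_of_same h]
  refine (pathDist_le_through b c).trans ?_
  have := h.off_le b
  unfold through
  rw [h.endpt_eq]
  linarith

theorem pathDist_triangle (p q r : Realization Γ hΓ) :
    pathDist p r ≤ pathDist p q + pathDist q r := by
  by_cases h : p.Same q <;> by_cases h' : q.Same r
  · rw [pathDist_of_same h, pathDist_of_same h', pathDist_of_same (h.trans h')]
    exact abs_sub_le _ _ _
  · exact pathDist_triangle_of_same h h'
  · rw [pathDist_comm p r, pathDist_comm p q, pathDist_comm q r, add_comm]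
    exact pathDist_triangle_of_same h'.symm fun h' => h h'.symm
  -- The two paths use end points `c` and `b'` of the segment of `q`; their distance is at most the
  -- length spent on reaching `q` and leaving it.
  · obtain ⟨b, c, e⟩ := exists_pathDist_eq_through h
    obtain ⟨b', c', e'⟩ := exists_pathDist_eq_through h'
    rw [e, e']
    refine (pathDist_le_through b c').trans ?_
    have := q.dist_endpt_le c b'
    have := dist_cast_triangle hΓ (p.endpt b) (q.endpt c) (r.endpt c')
    have := dist_cast_triangle hΓ (q.endpt c) (q.endpt b') (r.endpt c')
    unfold through
    linarith

/-- Interior points have strictly positive offsets, so only vertices qualify. This gives the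
separation axiom of the metric. -/
theorem src_eq_of_off_eq_zero {b : Bool} (h : p.off b = 0) :
    p.src = p.endpt b ∧ p.tgt = p.endpt b ∧ p.pos = 0 := by
  obtain h' | h' := p.valid
  · refine ⟨?_, ?_, h'.2⟩ <;> cases b <;> simp [endpt, h'.1]
  · cases b
    · simp only [off, SimpleGraph.dist_eq_one_iff_adj.2 h'.1, Nat.cast_one] at h
      linarith [h'.2.2]
    · simp only [off] at h
      linarith [h'.2.1]

theorem eq_of_pathDist_eq_zero (h : pathDist p q = 0) : p = q := by
  by_cases hs : p.Same q
  · rw [pathDist_of_same hs, abs_eq_zero, sub_eq_zero] at h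
    exact Realization.ext hs.1 hs.2 h
  · obtain ⟨b, c, e⟩ := exists_pathDist_eq_through hs
    rw [e, through] at h
    have h1 := p.off_nonneg b
    have h2 := q.off_nonneg c
    have h3 : (0 : ℝ) ≤ Γ.dist (p.endpt b) (q.endpt c) := Nat.cast_nonneg _
    have h4 : (Γ.dist (p.endpt b) (q.endpt c) : ℝ) = 0 := by linarith
    have h5 : p.endpt b = q.endpt c := hΓ.dist_eq_zero_iff.1 (by exact_mod_cast h4)
    obtain ⟨p1, p2, p3⟩ := src_eq_of_off_eq_zero (p := p) (b := b) (by linarith)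
    obtain ⟨q1, q2, q3⟩ := src_eq_of_off_eq_zero (p := q) (b := c) (by linarith)
    exact Realization.ext (by rw [p1, q1, h5]) (by rw [p2, q2, h5]) (by rw [p3, q3])

instance : MetricSpace (Realization Γ hΓ) where
  dist := pathDist
  dist_self p := by rw [pathDist_of_same ⟨rfl, rfl⟩]; simp
  dist_comm := pathDist_comm
  dist_triangle := pathDist_triangle
  eq_of_dist_eq_zero := eq_of_pathDist_eq_zero

theorem dist_def (p q : Realization Γ hΓ) : dist p q = pathDist p q := rfl

/-- The vertices of the realization. -/
def vertex (hΓ : Γ.Connected) (v : V) : Realization Γ hΓ := ⟨v, v, 0, .inl ⟨rfl, rfl⟩⟩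

theorem src_vertex (v : V) : (vertex hΓ v).src = v := rfl

theorem endpt_vertex (v : V) (b : Bool) : (vertex hΓ v).endpt b = v := by cases b <;> rfl

theorem off_vertex (v : V) (b : Bool) : (vertex hΓ v).off b = 0 := by
  cases b <;> simp [vertex, off]

theorem dist_vertex (u v : V) : dist (vertex hΓ u) (vertex hΓ v) = Γ.dist u v := by
  rw [dist_def]
  by_cases h : (vertex hΓ u).Same (vertex hΓ v)
  · have : u = v := h.1
    subst this
    rw [pathDist_of_same h]
    simp
  · obtain ⟨b, c, e⟩ := exists_pathDist_eq_through h
    simp [e, through, endpt_vertex, off_vertex]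

theorem dist_endpt (p : Realization Γ hΓ) (b : Bool) : dist p (vertex hΓ (p.endpt b)) = p.off b := by
  rw [dist_def]
  by_cases h : p.Same (vertex hΓ (p.endpt b))
  · have h' : p.src = p.tgt := h.1.trans h.2.symm
    have h'' : p.pos = 0 := by
      obtain h | h := p.valid
      · exact h.2
      · exact (Γ.irrefl (h' ▸ h.1)).elim
    rw [pathDist_of_same h]
    cases b <;> simp [off, vertex, h', h'']
  · apply le_antisymm
    · refine (pathDist_le_through b b).trans ?_
      simp [through, endpt_vertex, off_vertex]
    · obtain ⟨c, c', e⟩ := exists_pathDist_eq_through h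
      rw [e]
      simp only [through, endpt_vertex, off_vertex]
      have h1 := p.pos_nonneg
      have h2 := p.pos_le
      have h3 : (Γ.dist p.tgt p.src : ℝ) = Γ.dist p.src p.tgt := by rw [SimpleGraph.dist_comm]
      cases b <;> cases c <;> simp only [endpt, off, SimpleGraph.dist_self, Nat.cast_zero] <;>
        linarith

theorem dist_vertex_left (p : Realization Γ hΓ) (b : Bool) :
    dist (vertex hΓ (p.endpt b)) p = p.off b := by
  rw [dist_comm, dist_endpt]

/-- The segment of an edge. -/
def edgePt (hΓ : Γ.Connected) {u v : V} (h : Γ.Adj u v) (t : ℝ) : Realization Γ hΓ :=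
  if ht : 0 < t ∧ t < 1 then ⟨u, v, t, .inr ⟨h, ht⟩⟩ else
    if t ≤ 0 then vertex hΓ u else vertex hΓ v

theorem edgePt_of_mem {u v : V} (h : Γ.Adj u v) {t : ℝ} (ht : 0 < t ∧ t < 1) :
    edgePt hΓ h t = ⟨u, v, t, .inr ⟨h, ht⟩⟩ := dif_pos ht

theorem edgePt_zero {u v : V} (h : Γ.Adj u v) : edgePt hΓ h 0 = vertex hΓ u := by
  simp [edgePt]

theorem edgePt_one {u v : V} (h : Γ.Adj u v) : edgePt hΓ h 1 = vertex hΓ v := by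
  simp [edgePt]

theorem isGeodesic_edgePt {u v : V} (h : Γ.Adj u v) : IsGeodesic 1 (edgePt hΓ h) := by
  have hd : Γ.dist u v = 1 := SimpleGraph.dist_eq_one_iff_adj.2 h
  have hl : ∀ t, 0 < t ∧ t < 1 → dist (vertex hΓ u) (edgePt hΓ h t) = t := by
    intro t ht
    rw [edgePt_of_mem h ht]
    exact dist_vertex_left ⟨u, v, t, _⟩ true
  have hr : ∀ t, 0 < t ∧ t < 1 → dist (vertex hΓ v) (edgePt hΓ h t) = 1 - t := by
    intro t ht
    rw [edgePt_of_mem h ht]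
    refine (dist_vertex_left ⟨u, v, t, _⟩ false).trans ?_
    simp [off, hd]
  have key : ∀ s t, 0 ≤ s → s ≤ t → t ≤ 1 →
      dist (edgePt hΓ h s) (edgePt hΓ h t) = t - s := by
    intro s t hs hst ht
    obtain rfl | hs0 := hs.eq_or_lt
    · rw [edgePt_zero]
      obtain rfl | ht0 := hst.eq_or_lt
      · rw [edgePt_zero, dist_self, sub_zero]
      obtain rfl | ht1 := ht.eq_or_lt
      · rw [edgePt_one, dist_vertex, hd]; simp
      · rw [hl t ⟨ht0, ht1⟩, sub_zero]
    obtain rfl | ht1 := ht.eq_or_lt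
    · rw [edgePt_one, dist_comm]
      obtain rfl | hs1 := hst.eq_or_lt
      · rw [edgePt_one, dist_self, sub_self]
      · exact hr s ⟨hs0, hs1⟩
    · have es := edgePt_of_mem (hΓ := hΓ) h ⟨hs0, hst.trans_lt ht1⟩
      have et := edgePt_of_mem (hΓ := hΓ) h ⟨hs0.trans_le hst, ht1⟩
      have hsame : (edgePt hΓ h s).Same (edgePt hΓ h t) := by rw [es, et]; exact ⟨rfl, rfl⟩
      rw [dist_def, pathDist_of_same hsame, es, et, abs_sub_comm]
      exact abs_of_nonneg (sub_nonneg.2 hst)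
  refine ⟨zero_le_one, fun s hs t ht => ?_⟩
  obtain hst | hst := le_total s t
  · rw [key s t hs.1 hst ht.2, abs_sub_comm, abs_of_nonneg (sub_nonneg.2 hst)]
  · rw [dist_comm, key t s ht.1 hst hs.2, abs_of_nonneg (sub_nonneg.2 hst)]

theorem eq_edgePt {p : Realization Γ hΓ} (h : Γ.Adj p.src p.tgt ∧ 0 < p.pos ∧ p.pos < 1) :
    p = edgePt hΓ h.1 p.pos := (edgePt_of_mem h.1 h.2).symm

theorem joined_endpt (p : Realization Γ hΓ) (b : Bool) : Joined p (vertex hΓ (p.endpt b)) := by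
  obtain h | h := p.valid
  · have : p = vertex hΓ (p.endpt b) := by
      cases b
      · exact Realization.ext h.1 rfl h.2
      · exact Realization.ext rfl h.1.symm h.2
    rw [← this]
    exact Joined.refl p
  · have hp := h.2.1.le
    have key := fun t ht => (isGeodesic_edgePt (hΓ := hΓ) h.1).joined ⟨hp, h.2.2.le⟩ (t := t) ht
    rw [← eq_edgePt h] at key
    cases b
    · simpa only [edgePt_one, endpt] using key 1 ⟨zero_le_one, le_rfl⟩
    · simpa only [edgePt_zero, endpt] using key 0 ⟨le_rfl, zero_le_one⟩

theorem joined_vertex_of_adj {u v : V} (h : Γ.Adj u v) : Joined (vertex hΓ u) (vertex hΓ v) := by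
  rw [← edgePt_zero h, ← edgePt_one h]
  exact (isGeodesic_edgePt h).joined ⟨le_rfl, zero_le_one⟩ ⟨zero_le_one, le_rfl⟩

theorem joined_vertex (u v : V) : Joined (vertex hΓ u) (vertex hΓ v) := by
  obtain ⟨p, hp⟩ := hΓ.exists_walk_length_eq_dist u v
  induction p with
  | nil => exact Joined.refl _
  | @cons u w v h p ih =>
    rw [SimpleGraph.Walk.length_cons] at hp
    have h1 : Γ.dist u w = 1 := SimpleGraph.dist_eq_one_iff_adj.2 h
    have h2 : Γ.dist w v ≤ p.length := SimpleGraph.dist_le p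
    have h3 : Γ.dist u v ≤ Γ.dist u w + Γ.dist w v := hΓ.dist_triangle
    refine (joined_vertex_of_adj h).trans (ih (by omega)) ?_
    simp only [dist_vertex]
    exact_mod_cast (by omega : Γ.dist u w + Γ.dist w v ≤ Γ.dist u v)

theorem isGeodesicSpace : IsGeodesicSpace (Realization Γ hΓ) := by
  intro p q
  change Joined p q
  by_cases h : p.Same q
  · obtain h' | h' := p.valid <;> obtain h'' | h'' := q.valid
    · rw [Realization.ext h.1 h.2 (h'.2.trans h''.2.symm)]
      exact Joined.refl q
    · rw [← h.1, ← h.2, h'.1] at h''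
      exact (Γ.irrefl h''.1).elim
    · rw [h.1, h.2, h''.1] at h'
      exact (Γ.irrefl h'.1).elim
    · have hq : q = edgePt hΓ h'.1 q.pos := by
        rw [edgePt_of_mem h'.1 h''.2]
        exact Realization.ext h.1.symm h.2.symm rfl
      rw [eq_edgePt h', hq]
      exact (isGeodesic_edgePt h'.1).joined ⟨h'.2.1.le, h'.2.2.le⟩ ⟨h''.2.1.le, h''.2.2.le⟩
  · obtain ⟨b, c, e⟩ := exists_pathDist_eq_through h
    rw [← dist_def, through] at e
    have h1 := p.dist_endpt b
    have h2 := q.dist_endpt c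
    rw [dist_comm] at h2
    have h3 := dist_vertex (hΓ := hΓ) (p.endpt b) (q.endpt c)
    have h4 := dist_triangle p (vertex hΓ (p.endpt b)) (vertex hΓ (q.endpt c))
    have h5 := dist_triangle p (vertex hΓ (q.endpt c)) q
    refine ((p.joined_endpt b).trans (joined_vertex _ _) ?_).trans (q.joined_endpt c).symm ?_
    · linarith
    · linarith

theorem dist_src_le (p : Realization Γ hΓ) : dist p (vertex hΓ p.src) ≤ 1 := by
  have := p.dist_endpt true
  have := p.pos_le
  have := p.len_le
  simp only [endpt, off] at *
  linarith

theorem abs_dist_sub_le (p q : Realization Γ hΓ) : |dist p q - Γ.dist p.src q.src| ≤ 2 := by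
  rw [← dist_vertex (hΓ := hΓ)]
  have h1 := p.dist_src_le
  have h2 := q.dist_src_le
  have h3 := dist_triangle4 p (vertex hΓ p.src) (vertex hΓ q.src) q
  have h4 := dist_triangle4 (vertex hΓ p.src) p q (vertex hΓ q.src)
  rw [dist_comm (vertex hΓ q.src)] at h3
  rw [dist_comm (vertex hΓ p.src) p] at h4
  rw [abs_le]
  constructor <;> linarith

/-- Rounding to sources changes each distance by at most 2, hence each side of the inequality by at
most 4; the total of 8 is twice the added 4. -/
theorem fourPoint {δ : ℝ} (h : FourPoint (fun x y : V => (Γ.dist x y : ℝ)) δ) :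
    FourPoint (fun x y : Realization Γ hΓ => dist x y) (δ + 4) := by
  intro x y z w
  have key := h x.src y.src z.src w.src
  simp only at key ⊢
  have h1 := abs_le.1 (abs_dist_sub_le x y)
  have h2 := abs_le.1 (abs_dist_sub_le z w)
  have h3 := abs_le.1 (abs_dist_sub_le x z)
  have h4 := abs_le.1 (abs_dist_sub_le y w)
  have h5 := abs_le.1 (abs_dist_sub_le x w)
  have h6 := abs_le.1 (abs_dist_sub_le y z)
  have h7 := le_max_left (dist x z + dist y w) (dist x w + dist y z)
  have h8 := le_max_right (dist x z + dist y w) (dist x w + dist y z)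
  obtain h | h := max_choice ((Γ.dist x.src z.src : ℝ) + Γ.dist y.src w.src)
    (Γ.dist x.src w.src + Γ.dist y.src z.src) <;> rw [h] at key <;> linarith

theorem dist_iso (φ : Γ ≃g Γ) (u v : V) : Γ.dist (φ u) (φ v) = Γ.dist u v := by
  have key : ∀ (ψ : Γ ≃g Γ) (u v : V), Γ.dist (ψ u) (ψ v) ≤ Γ.dist u v := by
    intro ψ u v
    by_cases h : Γ.Reachable u v
    · obtain ⟨p, hp⟩ := h.exists_walk_length_eq_dist
      rw [← hp, ← SimpleGraph.Walk.length_map ψ.toHom p]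
      exact SimpleGraph.dist_le _
    · have h' : ¬ Γ.Reachable (ψ u) (ψ v) := by rwa [SimpleGraph.Iso.reachable_iff]
      simp [SimpleGraph.dist_eq_zero_of_not_reachable h']
  refine le_antisymm (key φ u v) ?_
  simpa using key φ.symm (φ u) (φ v)

/-- The map of realizations that is induced by an automorphism of the graph. -/
def map (φ : Γ ≃g Γ) (p : Realization Γ hΓ) : Realization Γ hΓ :=
  ⟨φ p.src, φ p.tgt, p.pos, p.valid.imp (fun h => ⟨congrArg φ h.1, h.2⟩)
    fun h => ⟨φ.map_adj_iff.2 h.1, h.2⟩⟩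

theorem dist_map (φ : Γ ≃g Γ) (p q : Realization Γ hΓ) : dist (map φ p) (map φ q) = dist p q := by
  have hs : (map φ p).Same (map φ q) ↔ p.Same q := by simp [Same, map]
  have ht : ∀ b c, (map φ p).through (map φ q) b c = p.through q b c := by
    intro b c
    cases b <;> cases c <;> simp [through, map, endpt, off, dist_iso]
  classical
  simp only [dist_def, pathDist, ht]
  exact if_congr hs rfl rfl

/-- The isometry of the realization that is induced by an automorphism of the graph. -/
def mapEquiv (φ : Γ ≃g Γ) : Realization Γ hΓ ≃ᵢ Realization Γ hΓ where
  toFun := map φ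
  invFun := map φ.symm
  left_inv _ := Realization.ext (φ.symm_apply_apply _) (φ.symm_apply_apply _) rfl
  right_inv _ := Realization.ext (φ.apply_symm_apply _) (φ.apply_symm_apply _) rfl
  isometry_toFun := Isometry.of_dist_eq (dist_map φ)

end Realization

/-! ### Gates and detours in hyperbolic and fine graphs -/

section Detour

variable {V : Type u} {Γ : SimpleGraph V}

/-- There is a path of length at most `n` from `a` to `b` that avoids the vertex `c`. -/
def Detour (Γ : SimpleGraph V) (c : V) (n : ℕ) (a b : V) : Prop :=
  ∃ p : Γ.Walk a b, p.length ≤ n ∧ c ∉ p.support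

theorem Detour.symm {c : V} {n : ℕ} {a b : V} (h : Detour Γ c n a b) : Detour Γ c n b a := by
  obtain ⟨p, hp, hc⟩ := h
  exact ⟨p.reverse, by simpa using hp, by simpa using hc⟩

theorem Detour.trans {c : V} {m n : ℕ} {x y z : V} (h : Detour Γ c m x y)
    (h' : Detour Γ c n y z) : Detour Γ c (m + n) x z := by
  obtain ⟨p, hp, hc⟩ := h
  obtain ⟨q, hq, hc'⟩ := h'
  refine ⟨p.append q, ?_, ?_⟩
  · rw [SimpleGraph.Walk.length_append]; omega
  · rw [SimpleGraph.Walk.mem_support_append_iff]; tauto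

theorem Detour.mono {c : V} {m n : ℕ} {x y : V} (h : Detour Γ c m x y) (hmn : m ≤ n) :
    Detour Γ c n x y := by
  obtain ⟨p, hp, hc⟩ := h
  exact ⟨p, hp.trans hmn, hc⟩

/-- A geodesic through `c` would have the length on the right-hand side. -/
theorem detour_of_dist_lt (hΓ : Γ.Connected) {a b c : V}
    (h : Γ.dist a b < Γ.dist a c + Γ.dist c b) : Detour Γ c (Γ.dist a b) a b := by
  classical
  obtain ⟨p, hp⟩ := hΓ.exists_walk_length_eq_dist a b
  refine ⟨p, hp.le, fun hc => ?_⟩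
  have h1 := congrArg SimpleGraph.Walk.length (p.take_spec hc)
  rw [SimpleGraph.Walk.length_append] at h1
  have h2 := SimpleGraph.dist_le (p.takeUntil c hc)
  have h3 := SimpleGraph.dist_le (p.dropUntil c hc)
  omega

theorem detour_getVert_of_le {c v w : V} (p : Γ.Walk v w) (hc : c ∉ p.support) {i j : ℕ}
    (hij : i ≤ j) : Detour Γ c (j - i) (p.getVert i) (p.getVert j) := by
  have e : (p.drop i).getVert (j - i) = p.getVert j := by
    rw [SimpleGraph.Walk.drop_getVert]; congr 1; omega
  rw [← e]
  refine ⟨(p.drop i).take (j - i), ?_, fun h => hc ?_⟩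
  · rw [SimpleGraph.Walk.take_length]; exact min_le_left _ _
  · exact (SimpleGraph.Walk.isSubwalk_drop p i).support_subset
      ((SimpleGraph.Walk.isSubwalk_take (p.drop i) (j - i)).support_subset h)

theorem detour_getVert {c v w : V} (p : Γ.Walk v w) (hc : c ∉ p.support) {i j n : ℕ}
    (hij : i ≤ j + n) (hji : j ≤ i + n) : Detour Γ c n (p.getVert i) (p.getVert j) := by
  obtain h | h := le_total i j
  · exact (detour_getVert_of_le p hc h).mono (by omega)
  · exact (detour_getVert_of_le p hc h).symm.mono (by omega)

theorem dist_getVert {v w : V} (hΓ : Γ.Connected) {p : Γ.Walk v w}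
    (hp : p.length = Γ.dist v w) {i : ℕ} (hi : i ≤ p.length) :
    Γ.dist v (p.getVert i) = i ∧ Γ.dist (p.getVert i) w = p.length - i := by
  have h1 := SimpleGraph.dist_le (p.take i)
  have h2 := SimpleGraph.dist_le (p.drop i)
  rw [SimpleGraph.Walk.take_length] at h1
  rw [SimpleGraph.Walk.drop_length] at h2
  have h3 : Γ.dist v w ≤ Γ.dist v (p.getVert i) + Γ.dist (p.getVert i) w := hΓ.dist_triangle
  omega

theorem exists_dist_eq (hΓ : Γ.Connected) {v w : V} {i : ℕ} (hi : i ≤ Γ.dist v w) :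
    ∃ u, Γ.dist v u = i ∧ Γ.dist u w = Γ.dist v w - i := by
  obtain ⟨p, hp⟩ := hΓ.exists_walk_length_eq_dist v w
  have := dist_getVert hΓ hp (hp ▸ hi)
  exact ⟨p.getVert i, this.1, by rw [this.2, hp]⟩

/-- The vertex `a` is the first one after `c` on a geodesic from `c` to `v`. -/
def IsGate (Γ : SimpleGraph V) (c v a : V) : Prop :=
  Γ.Adj c a ∧ Γ.dist a v + 1 = Γ.dist c v

theorem exists_isGate (hΓ : Γ.Connected) {c v : V} (h : c ≠ v) : ∃ a, IsGate Γ c v a := by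
  have hpos := hΓ.pos_dist_of_ne h
  obtain ⟨a, h1, h2⟩ := exists_dist_eq hΓ (v := c) (w := v) (i := 1) hpos
  exact ⟨a, SimpleGraph.dist_eq_one_iff_adj.1 h1, by omega⟩

theorem isGate_iff_of_adj (hΓ : Γ.Connected) {c v a : V} (h : Γ.Adj c v) :
    IsGate Γ c v a ↔ a = v := by
  have h1 := SimpleGraph.dist_eq_one_iff_adj.2 h
  constructor
  · rintro ⟨-, h2⟩
    exact hΓ.dist_eq_zero_iff.1 (by omega)
  · rintro rfl
    exact ⟨h, by rw [SimpleGraph.dist_self, h1]⟩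

/-- Continue from the gate along a geodesic to `v` until the distance from `c` is `M`, or `v` is
reached. Distances from `c` grow along it, so it avoids `c`. -/
theorem IsGate.exists_leg (hΓ : Γ.Connected) {c v a : V} (h : IsGate Γ c v a) {M : ℕ}
    (hM : 1 ≤ M) : ∃ u, Γ.dist c u = min M (Γ.dist c v) ∧
      Γ.dist u v = Γ.dist c v - min M (Γ.dist c v) ∧ Detour Γ c M a u := by
  have h0 := h.2
  have h1 := SimpleGraph.dist_eq_one_iff_adj.2 h.1
  obtain ⟨u, hu, hu'⟩ := exists_dist_eq hΓ (v := a) (w := v)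
    (i := min M (Γ.dist c v) - 1) (by omega)
  have h2 : Γ.dist c u ≤ Γ.dist c a + Γ.dist a u := hΓ.dist_triangle
  have h3 : Γ.dist c v ≤ Γ.dist c u + Γ.dist u v := hΓ.dist_triangle
  have h4 : Γ.dist a c = Γ.dist c a := SimpleGraph.dist_comm
  exact ⟨u, by omega, by omega, (detour_of_dist_lt hΓ (by omega)).mono (by omega)⟩

/-- The four point condition for the graph metric, with an integral error. -/
def IntFourPoint (Γ : SimpleGraph V) (D : ℕ) : Prop :=
  ∀ x y z w, Γ.dist x y + Γ.dist z w ≤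
    max (Γ.dist x z + Γ.dist y w) (Γ.dist x w + Γ.dist y z) + D

theorem IsHyperbolicGraph.exists_intFourPoint (h : IsHyperbolicGraph Γ) :
    ∃ D, IntFourPoint Γ D := by
  obtain ⟨δ, h⟩ := h
  refine ⟨⌈2 * δ⌉₊, fun x y z w => ?_⟩
  have h1 := h x y z w
  have h2 := Nat.le_ceil (2 * δ)
  have : ((Γ.dist x y + Γ.dist z w : ℕ) : ℝ) ≤
      ((max (Γ.dist x z + Γ.dist y w) (Γ.dist x w + Γ.dist y z) + ⌈2 * δ⌉₊ : ℕ) : ℝ) := by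
    push_cast
    simp only at h1
    linarith
  exact_mod_cast this

/-- If the Gromov product of `v` and `w` based at `c` is large, then the gates of `v` and `w` are
joined by a short path that avoids `c`. -/
theorem IsGate.detour_of_gromovProduct (hΓ : Γ.Connected) {D : ℕ} (hD : IntFourPoint Γ D)
    {c v w a b : V} (ha : IsGate Γ c v a) (hb : IsGate Γ c w b)
    (h : 2 * (2 * D + 1) + Γ.dist v w ≤ Γ.dist c v + Γ.dist c w) :
    Detour Γ c (6 * D + 2) a b := by
  obtain ⟨u, hu, huv, hau⟩ := ha.exists_leg hΓ (M := 2 * D + 1) (by omega)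
  obtain ⟨z, hz, hzw, hbz⟩ := hb.exists_leg hΓ (M := 2 * D + 1) (by omega)
  have t1 : Γ.dist c v ≤ Γ.dist c w + Γ.dist w v := hΓ.dist_triangle
  have t2 : Γ.dist c w ≤ Γ.dist c v + Γ.dist v w := hΓ.dist_triangle
  have s1 : Γ.dist w v = Γ.dist v w := SimpleGraph.dist_comm
  have s2 : Γ.dist z c = Γ.dist c z := SimpleGraph.dist_comm
  have s3 : Γ.dist u c = Γ.dist c u := SimpleGraph.dist_comm
  have s4 : Γ.dist v c = Γ.dist c v := SimpleGraph.dist_comm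
  have s5 : Γ.dist v z = Γ.dist z v := SimpleGraph.dist_comm
  have h1 := hD z v c w
  have h2 := hD u z c v
  -- The Gromov product is at most either distance, so both legs have full length `2 * D + 1`. The
  -- four-point condition is used twice, first to bound the distance from `z` to `v`. A geodesic
  -- from `u` to `z` is then too short to pass through `c`.
  have huz : Γ.dist u z ≤ 2 * D := by omega
  exact ((hau.trans (detour_of_dist_lt hΓ (c := c) (by omega))).trans hbz.symm).mono (by omega)

/-- When the Gromov product at `c` is small, a leg of length `2 * D + 1` towards `v` ends close to
the geodesic from `v` to `w`, at the point with the same distance from `v`. The leg is just longer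
than this gap of at most `2 * D`, so the gap can be crossed without meeting `c`. If `v` is nearer
than that, the leg ends at `v` itself. -/
theorem exists_near_on_geodesic (hΓ : Γ.Connected) {D : ℕ} (hD : IntFourPoint Γ D) {c v w u : V}
    (p : Γ.Walk v w) (hp : p.length = Γ.dist v w)
    (hu : Γ.dist c u = min (2 * D + 1) (Γ.dist c v))
    (huv : Γ.dist u v = Γ.dist c v - min (2 * D + 1) (Γ.dist c v))
    (h : Γ.dist c v + Γ.dist c w < 2 * (2 * D + 1) + Γ.dist v w) (hv : c ≠ v) :
    ∃ i, i ≤ p.length ∧ Γ.dist c (p.getVert i) ≤ 4 * D + 1 ∧ Detour Γ c (2 * D) u (p.getVert i) := by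
  have hpos := hΓ.pos_dist_of_ne hv
  obtain hle | hlt := le_or_gt (Γ.dist c v) (2 * D + 1)
  · have : u = v := hΓ.dist_eq_zero_iff.1 (by omega)
    subst this
    refine ⟨0, Nat.zero_le _, ?_, ?_⟩
    · rw [SimpleGraph.Walk.getVert_zero]; omega
    · rw [SimpleGraph.Walk.getVert_zero]
      exact ⟨.nil, by simp, by simpa using hv⟩
  · have t1 : Γ.dist c v ≤ Γ.dist c w + Γ.dist w v := hΓ.dist_triangle
    have s1 : Γ.dist w v = Γ.dist v w := SimpleGraph.dist_comm
    have s2 : Γ.dist w c = Γ.dist c w := SimpleGraph.dist_comm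
    have s3 : Γ.dist u c = Γ.dist c u := SimpleGraph.dist_comm
    have s4 : Γ.dist v c = Γ.dist c v := SimpleGraph.dist_comm
    have hi : Γ.dist u v ≤ p.length := by omega
    obtain ⟨h1, h2⟩ := dist_getVert hΓ hp hi
    set m := p.getVert (Γ.dist u v) with hm
    have s5 : Γ.dist m v = Γ.dist v m := SimpleGraph.dist_comm
    have s6 : Γ.dist m c = Γ.dist c m := SimpleGraph.dist_comm
    have f1 := hD u w v c
    have f2 := hD u m v w
    have hum : Γ.dist u m ≤ 2 * D := by omega
    have t2 : Γ.dist c m ≤ Γ.dist c u + Γ.dist u m := hΓ.dist_triangle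
    have t3 : Γ.dist c u ≤ Γ.dist c m + Γ.dist m u := hΓ.dist_triangle
    have s7 : Γ.dist m u = Γ.dist u m := SimpleGraph.dist_comm
    have hcm : Γ.dist c m ≤ 4 * D + 1 := by omega
    have hd : Γ.dist u m < Γ.dist u c + Γ.dist c m := by omega
    exact ⟨_, hi, hcm, (detour_of_dist_lt hΓ hd).mono hum⟩

/-- If a geodesic from `v` to `w` avoids `c`, then the gates of `v` and `w` are joined by a short
path that avoids `c`. -/
theorem IsGate.detour_of_geodesic (hΓ : Γ.Connected) {D : ℕ} (hD : IntFourPoint Γ D)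
    {c v w a b : V} (ha : IsGate Γ c v a) (hb : IsGate Γ c w b) (p : Γ.Walk v w)
    (hp : p.length = Γ.dist v w) (hc : c ∉ p.support) : Detour Γ c (16 * D + 4) a b := by
  by_cases h : 2 * (2 * D + 1) + Γ.dist v w ≤ Γ.dist c v + Γ.dist c w
  · exact (ha.detour_of_gromovProduct hΓ hD hb h).mono (by omega)
  have hv : c ≠ v := by rintro rfl; exact hc p.start_mem_support
  have hw : c ≠ w := by rintro rfl; exact hc p.end_mem_support
  have s1 : Γ.dist w v = Γ.dist v w := SimpleGraph.dist_comm
  obtain ⟨u, hu, huv, hau⟩ := ha.exists_leg hΓ (M := 2 * D + 1) (by omega)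
  obtain ⟨z, hz, hzw, hbz⟩ := hb.exists_leg hΓ (M := 2 * D + 1) (by omega)
  obtain ⟨i, hi, hci, hui⟩ := exists_near_on_geodesic hΓ hD p hp hu huv (by omega) hv
  obtain ⟨j, hj, hcj, hzj⟩ := exists_near_on_geodesic hΓ hD p.reverse
    (by rw [SimpleGraph.Walk.length_reverse, hp, s1]) hz hzw (by omega) hw
  rw [SimpleGraph.Walk.length_reverse] at hj
  rw [SimpleGraph.Walk.getVert_reverse] at hcj hzj
  obtain ⟨i1, -⟩ := dist_getVert hΓ hp hi
  obtain ⟨j1, -⟩ := dist_getVert hΓ hp (Nat.sub_le p.length j)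
  have t1 : Γ.dist v (p.getVert i) ≤ Γ.dist v (p.getVert (p.length - j)) +
    Γ.dist (p.getVert (p.length - j)) (p.getVert i) := hΓ.dist_triangle
  have t2 : Γ.dist v (p.getVert (p.length - j)) ≤ Γ.dist v (p.getVert i) +
    Γ.dist (p.getVert i) (p.getVert (p.length - j)) := hΓ.dist_triangle
  have t3 : Γ.dist (p.getVert i) (p.getVert (p.length - j)) ≤ Γ.dist (p.getVert i) c +
    Γ.dist c (p.getVert (p.length - j)) := hΓ.dist_triangle
  have s2 : Γ.dist (p.getVert i) c = Γ.dist c (p.getVert i) := SimpleGraph.dist_comm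
  have s3 : Γ.dist (p.getVert (p.length - j)) (p.getVert i) =
    Γ.dist (p.getVert i) (p.getVert (p.length - j)) := SimpleGraph.dist_comm
  -- Both points are within `4 * D + 1` of `c`, and `p` is a geodesic, so their indices differ by at
  -- most `8 * D + 2`.
  have hij := detour_getVert p hc (i := i) (j := p.length - j) (n := 8 * D + 2)
    (by omega) (by omega)
  -- Two legs of `2 * D + 1`, two gaps of `2 * D` and the stretch of `8 * D + 2` along `p` add up to
  -- `16 * D + 4`.
  exact ((((hau.trans hui).trans hij).trans hzj.symm).trans hbz.symm).mono (by omega)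

/-- In a fine graph, only finitely many neighbours of `c` are joined to a given one by a path of
length at most `n` that avoids `c`. -/
theorem IsFine.finite_detour (h : IsFine Γ) {c a : V} (hca : Γ.Adj c a) (n : ℕ) :
    {b : V | Γ.Adj c b ∧ Detour Γ c n a b}.Finite := by
  classical
  -- A detour shortened to a path and closed up by the edges at `c` is a circuit through the edge
  -- from `c` to `a`, of length at most `n + 2`, and `b` is its penultimate vertex. Only `b = a`
  -- gives no circuit.
  have key : {b : V | Γ.Adj c b ∧ Detour Γ c n a b} ⊆ insert a (⋃ m ∈ Set.Iic (n + 2),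
      (fun p : Γ.Walk c c => p.penultimate) ''
        {p : Γ.Walk c c | p.IsCycle ∧ p.length = m ∧ s(c, a) ∈ p.edges}) := by
    rintro b ⟨hcb, p, hp, hc⟩
    by_cases hab : b = a
    · exact .inl hab
    right
    have hlen := p.length_bypass_le_length
    set q := p.bypass
    have hqc : c ∉ q.support := fun h => hc (p.support_bypass_subset_support h)
    have hpath : (q.concat hcb.symm).IsPath := (p.bypass_isPath).concat hqc hcb.symm
    have hedge : s(c, a) ∉ (q.concat hcb.symm).edges := by
      rw [SimpleGraph.Walk.edges_concat, List.concat_eq_append, List.mem_append,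
        List.mem_singleton]
      rintro (h | h)
      · exact hqc (q.fst_mem_support_of_mem_edges h)
      · obtain ⟨h, -⟩ | ⟨-, h⟩ := Sym2.eq_iff.1 h
        · exact hcb.ne h
        · exact hab h.symm
    refine Set.mem_iUnion₂.2 ⟨q.length + 2, ?_, .cons hca (q.concat hcb.symm), ⟨?_, ?_, ?_⟩, ?_⟩
    · simp only [Set.mem_Iic]
      omega
    · exact (SimpleGraph.Walk.cons_isCycle_iff _ hca).2 ⟨hpath, hedge⟩
    · simp
    · simp
    · simp only
      rw [SimpleGraph.Walk.penultimate_cons_of_not_nil]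
      · simp
      · rw [← SimpleGraph.Walk.length_eq_zero_iff]; simp
  refine Set.Finite.subset (Set.Finite.insert _ ((Set.finite_Iic (n + 2)).biUnion fun m _ => ?_)) key
  exact (h c a hca m).image _

theorem Detour.map {Γ' : SimpleGraph V} (φ : Γ ≃g Γ') {c : V} {n : ℕ} {a b : V}
    (h : Detour Γ c n a b) : Detour Γ' (φ c) n (φ a) (φ b) := by
  obtain ⟨p, hp, hc⟩ := h
  refine ⟨p.map φ.toHom, by simpa using hp, ?_⟩
  rw [SimpleGraph.Walk.support_map]
  simpa using hc

end Detour

section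

open scoped Pointwise

/-! ### Word metrics -/

section WordMetric

variable {G : Type u} [Group G] {S : Set G} {hS : Subgroup.closure S = ⊤}

/-- An element of the group as a point of the space with the word metric. -/
def toWord (hS : Subgroup.closure S = ⊤) (g : G) : WordSpace S hS := g

theorem dist_toWord (x y : G) :
    dist (toWord hS x) (toWord hS y) = (SimpleGraph.mulCayley S).dist x y := rfl

/-- `N` is the length of some word for `g`; it is chosen before `f`, so it serves all target spaces
at once. -/
theorem exists_forall_dist_mul_le (hS : Subgroup.closure S = ⊤) (g : G) :
    ∃ N : ℝ, 0 ≤ N ∧ ∀ {Z : Type u} [MetricSpace Z] (f : G → Z) (K : ℝ),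
      (∀ x, ∀ s ∈ S, dist (f x) (f (x * s)) ≤ K) → ∀ x, dist (f x) (f (x * g)) ≤ N * K := by
  have hg : g ∈ Subgroup.closure S := hS ▸ Subgroup.mem_top g
  induction hg using Subgroup.closure_induction with
  | mem s hs => exact ⟨1, zero_le_one, fun f K h x => by simpa using h x s hs⟩
  | one => exact ⟨0, le_rfl, fun f K h x => by simp⟩
  | mul a b _ _ ha hb =>
    obtain ⟨N, hN, ha⟩ := ha
    obtain ⟨N', hN', hb⟩ := hb
    refine ⟨N + N', add_nonneg hN hN', fun f K h x => ?_⟩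
    have h1 := ha f K h x
    have h2 := hb f K h (x * a)
    have := dist_triangle (f x) (f (x * a)) (f (x * a * b))
    rw [← mul_assoc, add_mul]
    linarith
  | inv a _ ha =>
    obtain ⟨N, hN, ha⟩ := ha
    refine ⟨N, hN, fun f K h x => ?_⟩
    have := ha f K h (x * a⁻¹)
    rwa [inv_mul_cancel_right, dist_comm] at this

theorem dist_le_mul_dist_toWord {Z : Type u} [MetricSpace Z] (f : G → Z) {K : ℝ}
    (h : ∀ x, ∀ s ∈ S, dist (f x) (f (x * s)) ≤ K) (x y : G) :
    dist (f x) (f y) ≤ K * dist (toWord hS x) (toWord hS y) := by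
  rw [dist_toWord]
  obtain ⟨p, hp⟩ := (cayley_connected S hS).exists_walk_length_eq_dist x y
  rw [← hp]
  clear hp
  induction p with
  | nil => simp
  | @cons x z y hxz p ih =>
    have h1 : dist (f x) (f z) ≤ K := by
      obtain ⟨-, h' | h'⟩ := (SimpleGraph.mulCayley_adj S x z).1 hxz
      · simpa using h x _ h'
      · rw [dist_comm]
        simpa using h z _ h'
    have := dist_triangle (f x) (f z) (f y)
    rw [SimpleGraph.Walk.length_cons]
    push_cast
    linarith

/-- A map that moves the neighbours in one word metric by a bounded amount is Lipschitz for every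
other word metric. -/
theorem exists_lipschitz (hS : Subgroup.closure S = ⊤) {T : Set G}
    (hT : Subgroup.closure T = ⊤) (hfin : T.Finite) :
    ∃ N : ℝ, 0 ≤ N ∧ ∀ {Z : Type u} [MetricSpace Z] (f : G → Z) (K : ℝ), 0 ≤ K →
      (∀ x, ∀ s ∈ S, dist (f x) (f (x * s)) ≤ K) →
        ∀ x y, dist (f x) (f y) ≤ N * K * dist (toWord hT x) (toWord hT y) := by
  choose N hN0 hN using exists_forall_dist_mul_le hS
  obtain ⟨B, hB⟩ := (hfin.image N).bddAbove
  refine ⟨max B 0, le_max_right _ _, fun f K hK h => dist_le_mul_dist_toWord f fun x t ht => ?_⟩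
  refine (hN t f K h x).trans ?_
  gcongr
  exact (hB (Set.mem_image_of_mem N ht)).trans (le_max_left _ _)

theorem dist_mul_left_toWord (g x y : G) :
    dist (toWord hS (g * x)) (toWord hS (g * y)) = dist (toWord hS x) (toWord hS y) := by
  rw [dist_toWord, dist_toWord]
  exact_mod_cast Realization.dist_iso (Γ := SimpleGraph.mulCayley S)
    ⟨Equiv.mulLeft g, SimpleGraph.mulCayley_adj_mul_iff_right⟩ x y

theorem finite_pow {Q : Set G} (hQ : Q.Finite) (n : ℕ) : (Q ^ n).Finite := by
  induction n with
  | zero => simp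
  | succ n ih => rw [pow_succ]; exact ih.mul hQ

/-- Balls of a word metric are finite. -/
theorem finite_ball (hfin : S.Finite) (r : ℝ) :
    {g : G | ∃ x, dist (toWord hS x) (toWord hS (x * g)) ≤ r}.Finite := by
  -- Including 1 makes the powers of `Q` increase, so a single power contains the whole ball.
  set Q : Set G := insert 1 (S ∪ S⁻¹)
  have hQ : Q.Finite := (hfin.union hfin.inv).insert 1
  have key : ∀ {x y : G} (p : (SimpleGraph.mulCayley S).Walk x y), x⁻¹ * y ∈ Q ^ p.length := by
    intro x y p
    induction p with
    | nil => simp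
    | @cons x z y h p ih =>
      rw [SimpleGraph.Walk.length_cons, pow_succ']
      refine ⟨x⁻¹ * z, ?_, z⁻¹ * y, ih, by simp [mul_assoc]⟩
      obtain ⟨-, h' | h'⟩ := (SimpleGraph.mulCayley_adj S x z).1 h
      · exact .inr (.inl h')
      · exact .inr (.inr (by simpa using h'))
  refine (finite_pow hQ ⌊r⌋₊).subset ?_
  rintro g ⟨x, hx⟩
  rw [dist_toWord] at hx
  obtain ⟨p, hp⟩ := (cayley_connected S hS).exists_walk_length_eq_dist x (x * g)
  have := key p
  rw [inv_mul_cancel_left, hp] at this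
  exact Set.pow_subset_pow_right (Set.mem_insert 1 _) (Nat.le_floor hx) this

theorem isQuasigeodesicSpace_wordSpace (hS : Subgroup.closure S = ⊤) :
    IsQuasigeodesicSpace (WordSpace S hS) := by
  refine ⟨1, le_rfl, fun (x y : G) => ?_⟩
  have hc := cayley_connected S hS
  obtain ⟨p, hp⟩ := hc.exists_walk_length_eq_dist x y
  -- A shortest path read off at integer times; rounding changes the length of a time interval by
  -- less than 1.
  refine ⟨p.length, fun t => toWord hS (p.getVert ⌊t⌋₊), ⟨Nat.cast_nonneg _, ?_⟩, ?_, ?_⟩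
  · have key : ∀ s ∈ Set.Icc (0 : ℝ) p.length, ∀ t ∈ Set.Icc (0 : ℝ) p.length, s ≤ t →
        (t - s) - 1 ≤ dist (toWord hS (p.getVert ⌊s⌋₊)) (toWord hS (p.getVert ⌊t⌋₊)) ∧
        dist (toWord hS (p.getVert ⌊s⌋₊)) (toWord hS (p.getVert ⌊t⌋₊)) ≤ (t - s) + 1 := by
      intro s hs t ht hst
      have hi : ⌊s⌋₊ ≤ ⌊t⌋₊ := Nat.floor_le_floor hst
      have hj : ⌊t⌋₊ ≤ p.length := by
        rw [← Nat.floor_natCast (R := ℝ) p.length]; exact Nat.floor_le_floor ht.2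
      have h1 := (dist_getVert hc hp (hi.trans hj)).1
      have h2 := (dist_getVert hc hp hj).1
      have h3 : (SimpleGraph.mulCayley S).dist x (p.getVert ⌊t⌋₊) ≤
        (SimpleGraph.mulCayley S).dist x (p.getVert ⌊s⌋₊) +
        (SimpleGraph.mulCayley S).dist (p.getVert ⌊s⌋₊) (p.getVert ⌊t⌋₊) := hc.dist_triangle
      have h4 : (SimpleGraph.mulCayley S).dist (p.getVert ⌊s⌋₊) (p.getVert ⌊t⌋₊) ≤
          ⌊t⌋₊ - ⌊s⌋₊ := by
        have e : (p.drop ⌊s⌋₊).getVert (⌊t⌋₊ - ⌊s⌋₊) = p.getVert ⌊t⌋₊ := by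
          rw [SimpleGraph.Walk.drop_getVert]; congr 1; omega
        rw [← e]
        refine (SimpleGraph.dist_le ((p.drop ⌊s⌋₊).take (⌊t⌋₊ - ⌊s⌋₊))).trans ?_
        rw [SimpleGraph.Walk.take_length]
        exact min_le_left _ _
      have h5 : (SimpleGraph.mulCayley S).dist (p.getVert ⌊s⌋₊) (p.getVert ⌊t⌋₊) + ⌊s⌋₊ =
          ⌊t⌋₊ := by omega
      rw [dist_toWord]
      have h6 : ((SimpleGraph.mulCayley S).dist (p.getVert ⌊s⌋₊) (p.getVert ⌊t⌋₊) : ℝ) + ⌊s⌋₊ =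
          ⌊t⌋₊ := by exact_mod_cast h5
      have := Nat.floor_le hs.1
      have := Nat.floor_le ht.1
      have := Nat.lt_floor_add_one s
      have := Nat.lt_floor_add_one t
      constructor <;> linarith
    intro s hs t ht
    obtain hst | hst := le_total s t
    · rw [abs_sub_comm, abs_of_nonneg (sub_nonneg.2 hst), inv_one, one_mul]
      exact key s hs t ht hst
    · rw [abs_of_nonneg (sub_nonneg.2 hst), inv_one, one_mul, dist_comm]
      exact key t ht s hs hst
  · simp [toWord]
    rfl
  · simp [toWord]
    rfl

end WordMetric

/-! ### The coned-off Cayley graph -/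

section ConedOff

variable {G : Type u} [Group G] {S : Set G} {Ps : Set (Subgroup G)}

theorem conedOff_connected (hS : Subgroup.closure S = ⊤) (Ps : Set (Subgroup G)) :
    (conedOff S Ps).Connected := by
  have h1 : ∀ g h : G, (conedOff S Ps).Reachable (.inl g) (.inl h) := by
    intro g h
    let f : SimpleGraph.mulCayley S →g conedOff S Ps := ⟨Sum.inl, fun h => h⟩
    exact ((cayley_connected S hS).preconnected g h).map f
  have h2 : ∀ v : ConedVertex Ps, (conedOff S Ps).Reachable v (.inl 1) := by
    rintro (g | ⟨P, c⟩)
    · exact h1 g 1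
    · induction c using QuotientGroup.induction_on with
      | H g =>
        have : (conedOff S Ps).Adj (.inr ⟨P, (g : G ⧸ (P : Subgroup G))⟩) (.inl g) := rfl
        exact this.reachable.trans (h1 g 1)
  have : Nonempty (ConedVertex Ps) := ⟨.inl 1⟩
  exact ⟨fun v w => (h2 v).trans (h2 w).symm⟩

/-- The left translation of cosets. -/
def translate (g : G) : (Σ P : Ps, G ⧸ (P : Subgroup G)) ≃ (Σ P : Ps, G ⧸ (P : Subgroup G)) where
  toFun a := ⟨a.1, g • a.2⟩
  invFun a := ⟨a.1, g⁻¹ • a.2⟩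
  left_inv a := by simp
  right_inv a := by simp

/-- The left translation of the coned-off Cayley graph. -/
def conedIso (S : Set G) (Ps : Set (Subgroup G)) (g : G) : conedOff S Ps ≃g conedOff S Ps where
  toEquiv := Equiv.sumCongr (Equiv.mulLeft g) (translate g)
  map_rel_iff' := by
    have key : ∀ (x : G) (P : Subgroup G) (c : G ⧸ P),
        ((g * x : G) : G ⧸ P) = g • c ↔ (x : G ⧸ P) = c := by
      intro x P c
      rw [← smul_eq_mul, ← MulAction.Quotient.smul_coe, smul_left_cancel_iff]
    rintro (x | a) (y | b)
    · exact SimpleGraph.mulCayley_adj_mul_iff_right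
    · exact key x _ b.2
    · exact key y _ a.2
    · exact Iff.rfl

theorem conedIso_inl (g x : G) : conedIso S Ps g (.inl x) = .inl (g * x) := rfl

theorem conedIso_inr (g : G) (a : Σ P : Ps, G ⧸ (P : Subgroup G)) :
    conedIso S Ps g (.inr a) = .inr (translate g a) := rfl

theorem conedOff_adj_inr {a : Σ P : Ps, G ⧸ (P : Subgroup G)} {v : ConedVertex Ps} :
    (conedOff S Ps).Adj (.inr a) v ↔ ∃ g : G, v = .inl g ∧ (g : G ⧸ (a.1 : Subgroup G)) = a.2 := by
  constructor
  · rintro h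
    cases v with
    | inl g => exact ⟨g, rfl, h⟩
    | inr b => exact h.elim
  · rintro ⟨g, rfl, h⟩
    exact h

theorem conedOff_adj_inl_mul {x s : G} (hs : s ∈ S) (h : x ≠ x * s) :
    (conedOff S Ps).Adj (.inl x) (.inl (x * s)) :=
  (SimpleGraph.mulCayley_adj S x (x * s)).2 ⟨h, .inl (by simpa using hs)⟩

end ConedOff

end

/-! ### Coarse models of the peripheral subgroups and gates in their cosets -/

open Filter

/-- A coarse model of a group: a hierarchically hyperbolic space with a map that is, up to bounded
error, the orbit map of a proper cobounded action. -/
structure OrbitModel (Q : Type u) [Group Q] where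
  Z : Type u
  [metric : MetricSpace Z]
  H : HHSStructure Z
  o : Q → Z
  bounded : ∀ q, ∃ r : ℝ, ∀ p, dist (o p) (o (p * q)) ≤ r
  cobounded : ∃ r : ℝ, ∀ z, ∃ p, dist (o p) z ≤ r
  proper : ∀ r : ℝ, {q | ∃ p, dist (o p) (o (p * q)) ≤ r}.Finite

attribute [instance] OrbitModel.metric

/-- The word metric of a finite generating set. -/
def OrbitModel.ofWordSpace {Q : Type u} [Group Q] {T : Set Q} (hT : Subgroup.closure T = ⊤)
    (hfin : T.Finite) (H : HHSStructure (WordSpace T hT)) : OrbitModel Q where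
  Z := WordSpace T hT
  H := H
  o := toWord hT
  bounded q := ⟨dist (toWord hT 1) (toWord hT q), fun p => by
    have := dist_mul_left_toWord (hS := hT) p 1 q
    rw [mul_one] at this
    exact this.le⟩
  cobounded := ⟨0, fun z => ⟨z, (dist_self z).le⟩⟩
  proper r := finite_ball hfin r

/-- A group that is hyperbolic relative to a finite collection of subgroups with coarse models. -/
structure RelHypData (G : Type u) [Group G] where
  Ps : Set (Subgroup G)
  S : Set G
  hS : Subgroup.closure S = ⊤
  finPs : Ps.Finite
  finS : S.Finite
  D : ℕ
  fourPoint : IntFourPoint (conedOff S Ps) D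
  fine : IsFine (conedOff S Ps)
  model : ∀ P : Ps, OrbitModel P

namespace RelHypData

variable {G : Type u} [Group G] (R : RelHypData G)

instance : Finite R.Ps := R.finPs

/-- The coned-off Cayley graph. -/
abbrev Γ : SimpleGraph (ConedVertex R.Ps) := conedOff R.S R.Ps

theorem connected : R.Γ.Connected := conedOff_connected R.hS R.Ps

/-- The cosets of the peripheral subgroups. -/
abbrev Coset : Type u := Σ P : R.Ps, G ⧸ (P : Subgroup G)

/-- The cone point of a coset. -/
abbrev cone (a : R.Coset) : ConedVertex R.Ps := .inr a

/-- The vertex of a group element. -/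
abbrev elt (g : G) : ConedVertex R.Ps := .inl g

variable {R}

theorem eq_elt_or_eq_cone (v : ConedVertex R.Ps) : (∃ g, v = R.elt g) ∨ ∃ a, v = R.cone a := by
  cases v with
  | inl g => exact .inl ⟨g, rfl⟩
  | inr a => exact .inr ⟨a, rfl⟩

theorem exists_eq_elt_of_adj {a : R.Coset} {v : ConedVertex R.Ps} (h : R.Γ.Adj (R.cone a) v) :
    ∃ g : G, v = R.elt g ∧ (g : G ⧸ (a.1 : Subgroup G)) = a.2 :=
  conedOff_adj_inr.1 h

/-- The representative of a coset. -/
def rep (a : R.Coset) : G := a.2.out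

theorem coe_rep (a : R.Coset) : ((rep a : G) : G ⧸ (a.1 : Subgroup G)) = a.2 :=
  Quotient.out_eq' a.2

/-- The coordinate of an element of a coset. -/
def loc (a : R.Coset) (g : G) (h : (g : G ⧸ (a.1 : Subgroup G)) = a.2) :
    (a.1 : Subgroup G) :=
  ⟨(rep a)⁻¹ * g, QuotientGroup.eq.1 ((coe_rep a).trans h.symm)⟩

theorem coe_loc (a : R.Coset) (g : G) (h : (g : G ⧸ (a.1 : Subgroup G)) = a.2) :
    (loc a g h : G) = (rep a)⁻¹ * g := rfl

/-- The point of the model that corresponds to an element of a coset. -/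
def pt (a : R.Coset) (g : G) (h : (g : G ⧸ (a.1 : Subgroup G)) = a.2) : (R.model a.1).Z :=
  (R.model a.1).o (loc a g h)

/-- The gate of a vertex in a coset, as a subset of the group; the whole coset for the cone
point of the coset. -/
def IsEntrance (a : R.Coset) (v : ConedVertex R.Ps) (g : G) : Prop :=
  v = R.cone a ∨ IsGate R.Γ (R.cone a) v (R.elt g)

/-- The gate of a vertex in the model of a coset. -/
def vgate (a : R.Coset) (v : ConedVertex R.Ps) : Set (R.model a.1).Z :=
  {z | ∃ (g : G) (h : (g : G ⧸ (a.1 : Subgroup G)) = a.2), IsEntrance a v g ∧ z = pt a g h}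

theorem vgate_nonempty (a : R.Coset) (v : ConedVertex R.Ps) : (vgate a v).Nonempty := by
  by_cases h : v = R.cone a
  · exact ⟨_, rep a, coe_rep a, .inl h, rfl⟩
  · obtain ⟨w, hw⟩ := exists_isGate R.connected (Ne.symm h)
    obtain ⟨g, rfl, hg⟩ := exists_eq_elt_of_adj hw.1
    exact ⟨_, g, hg, .inr hw, rfl⟩

/-- A point in the gate. -/
def vpr (a : R.Coset) (v : ConedVertex R.Ps) : (R.model a.1).Z := (vgate_nonempty a v).some

theorem vpr_mem (a : R.Coset) (v : ConedVertex R.Ps) : vpr a v ∈ vgate a v :=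
  (vgate_nonempty a v).some_mem

theorem exists_isGate_of_mem_vgate {a : R.Coset} {v : ConedVertex R.Ps} (hv : v ≠ R.cone a)
    {z : (R.model a.1).Z} (hz : z ∈ vgate a v) :
    ∃ (g : G) (h : (g : G ⧸ (a.1 : Subgroup G)) = a.2),
      IsGate R.Γ (R.cone a) v (R.elt g) ∧ z = pt a g h := by
  obtain ⟨g, h, h' | h', rfl⟩ := hz
  · exact (hv h').elim
  · exact ⟨g, h, h', rfl⟩

variable (R)

/-- The length of the paths that join the gates of the end points of a geodesic. -/
def detourLength : ℕ := 16 * R.D + 4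

/-- Translation moves the first element to 1, so a detour determines an element of `P` in a finite
set given by fineness. Right multiplication by each of these moves the orbit map of the model by a
bounded amount, and there are finitely many `P`. -/
theorem exists_dist_pt_le_of_detour : ∃ B : ℝ, ∀ (a : R.Coset) (g g' : G)
    (h : (g : G ⧸ (a.1 : Subgroup G)) = a.2) (h' : (g' : G ⧸ (a.1 : Subgroup G)) = a.2),
    Detour R.Γ (R.cone a) R.detourLength (R.elt g) (R.elt g') →
      dist (pt a g h) (pt a g' h') ≤ B := by
  have key : ∀ P : R.Ps, ∀ᶠ B : ℝ in atTop, ∀ q : (P : Subgroup G),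
      Detour R.Γ (R.cone ⟨P, (1 : G)⟩) R.detourLength (R.elt 1) (R.elt q) →
        ∀ p, dist ((R.model P).o p) ((R.model P).o (p * q)) ≤ B := by
    intro P
    have hfin := R.fine.finite_detour (c := R.cone ⟨P, (1 : G)⟩) (a := R.elt 1) rfl R.detourLength
    have hfin' : {q : (P : Subgroup G) | Detour R.Γ (R.cone ⟨P, (1 : G)⟩) R.detourLength (R.elt 1)
        (R.elt q)}.Finite := by
      refine (hfin.preimage (f := fun q : (P : Subgroup G) => R.elt q) (fun q _ q' _ h => ?_)).subset
        fun q hq => ⟨?_, hq⟩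
      · exact Subtype.ext (Sum.inl_injective h)
      · exact (QuotientGroup.eq.2 (by simp) : ((q : G) : G ⧸ (P : Subgroup G)) = ((1 : G) : _))
    choose r hr using (R.model P).bounded
    obtain ⟨B, hB⟩ := (hfin'.image r).bddAbove
    filter_upwards [eventually_ge_atTop B] with B' hB' q hq p
    exact ((hr q p).trans (hB (Set.mem_image_of_mem r hq))).trans hB'
  obtain ⟨B, hB⟩ := (eventually_all.2 key).exists
  refine ⟨B, fun a g g' h h' hd => ?_⟩
  have e : loc a g' h' = loc a g h * ⟨g⁻¹ * g', QuotientGroup.eq.1 (h.trans h'.symm)⟩ := by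
    apply Subtype.ext
    simp [coe_loc, mul_assoc]
  rw [pt, pt, e]
  refine hB a.1 _ ?_ _
  have := hd.map (conedIso R.S R.Ps g⁻¹)
  rw [conedIso_inl, conedIso_inl, conedIso_inr, inv_mul_cancel] at this
  have e' : translate g⁻¹ a = ⟨a.1, ((1 : G) : G ⧸ (a.1 : Subgroup G))⟩ := by
    simp only [translate, Equiv.coe_fn_mk, ← h]
    rw [MulAction.Quotient.smul_coe, smul_eq_mul, inv_mul_cancel]
  rwa [e'] at this

/-- A bound for the distances in the models between points that are joined by a short detour. -/
def B : ℝ := R.exists_dist_pt_le_of_detour.choose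

variable {R}

theorem dist_pt_le {a : R.Coset} {g g' : G}
    (h : (g : G ⧸ (a.1 : Subgroup G)) = a.2) (h' : (g' : G ⧸ (a.1 : Subgroup G)) = a.2)
    (hd : Detour R.Γ (R.cone a) R.detourLength (R.elt g) (R.elt g')) :
    dist (pt a g h) (pt a g' h') ≤ R.B :=
  R.exists_dist_pt_le_of_detour.choose_spec a g g' h h' hd

theorem dist_vgate_le {a : R.Coset} {v w : ConedVertex R.Ps} (p : R.Γ.Walk v w)
    (hp : p.length = R.Γ.dist v w) (hc : R.cone a ∉ p.support) {z z' : (R.model a.1).Z}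
    (hz : z ∈ vgate a v) (hz' : z' ∈ vgate a w) : dist z z' ≤ R.B := by
  have hv : v ≠ R.cone a := by rintro rfl; exact hc p.start_mem_support
  have hw : w ≠ R.cone a := by rintro rfl; exact hc p.end_mem_support
  obtain ⟨g, h, hg, rfl⟩ := exists_isGate_of_mem_vgate hv hz
  obtain ⟨g', h', hg', rfl⟩ := exists_isGate_of_mem_vgate hw hz'
  exact dist_pt_le h h' (hg.detour_of_geodesic R.connected R.fourPoint hg' p hp hc)

theorem dist_vgate_le_of_gromovProduct {a : R.Coset} {v w : ConedVertex R.Ps}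
    (hv : v ≠ R.cone a) (hw : w ≠ R.cone a)
    (hvw : 2 * (2 * R.D + 1) + R.Γ.dist v w ≤ R.Γ.dist (R.cone a) v + R.Γ.dist (R.cone a) w)
    {z z' : (R.model a.1).Z} (hz : z ∈ vgate a v) (hz' : z' ∈ vgate a w) : dist z z' ≤ R.B := by
  obtain ⟨g, h, hg, rfl⟩ := exists_isGate_of_mem_vgate hv hz
  obtain ⟨g', h', hg', rfl⟩ := exists_isGate_of_mem_vgate hw hz'
  exact dist_pt_le h h' ((hg.detour_of_gromovProduct R.connected R.fourPoint hg' hvw).mono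
    (by unfold detourLength; omega))

theorem dist_vgate_self_le {a : R.Coset} {v : ConedVertex R.Ps} (hv : v ≠ R.cone a)
    {z z' : (R.model a.1).Z} (hz : z ∈ vgate a v) (hz' : z' ∈ vgate a v) : dist z z' ≤ R.B :=
  dist_vgate_le .nil (by simp) (by simpa using hv.symm) hz hz'

theorem dist_vgate_le_of_adj {a : R.Coset} {v w : ConedVertex R.Ps} (hvw : R.Γ.Adj v w)
    (hv : v ≠ R.cone a) (hw : w ≠ R.cone a)
    {z z' : (R.model a.1).Z} (hz : z ∈ vgate a v) (hz' : z' ∈ vgate a w) : dist z z' ≤ R.B :=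
  dist_vgate_le (.cons hvw .nil) (by simp [SimpleGraph.dist_eq_one_iff_adj.2 hvw])
    (by simp [hv.symm, hw.symm]) hz hz'

theorem elt_ne_cone (g : G) (a : R.Coset) : R.elt g ≠ R.cone a := by simp

theorem B_nonneg_of (a : R.Coset) : 0 ≤ R.B :=
  dist_nonneg.trans (dist_vgate_self_le (elt_ne_cone 1 a) (vpr_mem a _) (vpr_mem a _))

/-- Take a geodesic from `g` to the cone point of `b`. If it avoids the cone point of `a`, the two
gates in `a` are close. Otherwise its initial part up to that cone point avoids the cone point of
`b`, which lies further on, and the gates in `b` are close. -/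
theorem vgate_consistency {a b : R.Coset} (hab : a ≠ b) (g : G) :
    dist (vpr a (R.elt g)) (vpr a (R.cone b)) ≤ R.B ∨
      dist (vpr b (R.elt g)) (vpr b (R.cone a)) ≤ R.B := by
  classical
  obtain ⟨p, hp⟩ := R.connected.exists_walk_length_eq_dist (R.elt g) (R.cone b)
  by_cases hc : R.cone a ∈ p.support
  · right
    have h1 := congrArg SimpleGraph.Walk.length (p.take_spec hc)
    rw [SimpleGraph.Walk.length_append] at h1
    have h2 := SimpleGraph.dist_le (p.takeUntil _ hc)
    have h3 := SimpleGraph.dist_le (p.dropUntil _ hc)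
    have h4 : R.Γ.dist (R.elt g) (R.cone b) ≤ R.Γ.dist (R.elt g) (R.cone a) +
      R.Γ.dist (R.cone a) (R.cone b) := R.connected.dist_triangle
    have h5 : 0 < R.Γ.dist (R.cone a) (R.cone b) :=
      R.connected.pos_dist_of_ne fun h => hab (Sum.inr_injective h)
    refine dist_vgate_le (p.takeUntil _ hc) (by omega) (fun hb => ?_) (vpr_mem b _) (vpr_mem b _)
    have h6 := congrArg SimpleGraph.Walk.length ((p.takeUntil _ hc).take_spec hb)
    rw [SimpleGraph.Walk.length_append] at h6
    have h7 := SimpleGraph.dist_le ((p.takeUntil _ hc).takeUntil _ hb)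
    omega
  · exact .inl (dist_vgate_le p hp hc (vpr_mem a _) (vpr_mem a _))

/-- The set consists of the cosets whose cone points lie on one fixed geodesic. -/
theorem vgate_links (x y : G) : ∃ s : Finset R.Coset,
    s.card ≤ R.Γ.dist (R.elt x) (R.elt y) + 1 ∧
    (∀ a ∈ s, R.Γ.dist (R.elt x) (R.cone a) ≤ R.Γ.dist (R.elt x) (R.elt y)) ∧
    ∀ a, a ∉ s → dist (vpr a (R.elt x)) (vpr a (R.elt y)) ≤ R.B := by
  classical
  obtain ⟨p, hp⟩ := R.connected.exists_walk_length_eq_dist (R.elt x) (R.elt y)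
  refine ⟨(p.support.filterMap Sum.getRight?).toFinset, ?_, fun a ha => ?_, fun a ha => ?_⟩
  · refine (List.toFinset_card_le _).trans ((List.length_filterMap_le _ _).trans ?_)
    rw [SimpleGraph.Walk.length_support, hp]
  · simp only [List.mem_toFinset, List.mem_filterMap, Sum.getRight?_eq_some_iff] at ha
    obtain ⟨_, ha, rfl⟩ := ha
    have := SimpleGraph.dist_le (p.takeUntil _ ha)
    have := p.length_takeUntil_le_length ha
    rw [← hp]
    exact (SimpleGraph.dist_le (p.takeUntil _ ha)).trans this
  · refine dist_vgate_le p hp (fun h => ha ?_) (vpr_mem a _) (vpr_mem a _)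
    simp only [List.mem_toFinset, List.mem_filterMap, Sum.getRight?_eq_some_iff]
    exact ⟨_, h, rfl⟩

theorem mem_vgate_elt {a : R.Coset} {g : G} (h : (g : G ⧸ (a.1 : Subgroup G)) = a.2)
    {z : (R.model a.1).Z} (hz : z ∈ vgate a (R.elt g)) : z = pt a g h := by
  obtain ⟨g', h', hg', rfl⟩ := exists_isGate_of_mem_vgate (elt_ne_cone g a) hz
  have hadj : R.Γ.Adj (R.cone a) (R.elt g) := h
  rw [isGate_iff_of_adj R.connected hadj] at hg'
  have := Sum.inl_injective hg'
  subst this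
  rfl

/-- An element of the coset is its own gate, so this is the coboundedness of the orbit maps. -/
theorem exists_realization : ∃ r : ℝ, ∀ (a : R.Coset) (z : (R.model a.1).Z), ∃ g : G,
    (g : G ⧸ (a.1 : Subgroup G)) = a.2 ∧ dist (vpr a (R.elt g)) z ≤ r := by
  have key : ∀ P : R.Ps, ∀ᶠ r : ℝ in atTop, ∀ z, ∃ p, dist ((R.model P).o p) z ≤ r := by
    intro P
    obtain ⟨r, hr⟩ := (R.model P).cobounded
    filter_upwards [eventually_ge_atTop r] with r' hr' z
    exact (hr z).imp fun p hp => hp.trans hr'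
  obtain ⟨r, hr⟩ := (eventually_all.2 key).exists
  refine ⟨r, fun a z => ?_⟩
  obtain ⟨p, hp⟩ := hr a.1 z
  have h : ((rep a * p : G) : G ⧸ (a.1 : Subgroup G)) = a.2 := by
    rw [← coe_rep a, QuotientGroup.eq]
    simp
  refine ⟨rep a * p, h, ?_⟩
  have e : loc a (rep a * p) h = p := Subtype.ext (by simp [coe_loc])
  rw [mem_vgate_elt h (vpr_mem a _), pt, e]
  exact hp

variable (R)

-- A geodesic of the coned-off graph from `x` to `xg` consists of Cayley edges and passages through
-- cosets. The entrance and exit of a passage are gates of the end points, so they differ by at most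
-- `r + 2 * R.B` in the model, and properness leaves finitely many possible jumps. Hence `g` is a
-- product of at most `r` factors from a finite set.
open scoped Pointwise in
theorem finite_of_dist_le (r : ℝ) : {g : G | ∃ x,
    (R.Γ.dist (R.elt x) (R.elt (x * g)) : ℝ) ≤ r ∧
      ∀ a, dist (vpr a (R.elt x)) (vpr a (R.elt (x * g))) ≤ r}.Finite := by
  set F : Set G := ⋃ P : R.Ps, (fun q : (P : Subgroup G) => (q : G)) ''
    {q | ∃ p, dist ((R.model P).o p) ((R.model P).o (p * q)) ≤ r + 2 * R.B} with hF
  have hFfin : F.Finite := Set.finite_iUnion fun P => ((R.model P).proper _).image _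
  set Q : Set G := insert 1 ((R.S ∪ R.S⁻¹) ∪ F) with hQ
  have hQfin : Q.Finite := ((R.finS.union R.finS.inv).union hFfin).insert 1
  have h1Q : (1 : G) ∈ Q := Set.mem_insert 1 _
  refine (finite_pow hQfin ⌊r⌋₊).subset ?_
  rintro g ⟨x, hx, hxa⟩
  set y := x * g with hy
  -- Induction over the elements `z` on geodesics from `x` to `y`. One step back along a geodesic is
  -- a Cayley edge; if it ends at a cone point, a second step leads to the entrance of the coset.
  -- Such a passage has length 2 but costs one factor; the spare factor is 1.
  have key : ∀ n : ℕ, ∀ z : G, R.Γ.dist (R.elt x) (R.elt z) = n →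
      R.Γ.dist (R.elt x) (R.elt z) + R.Γ.dist (R.elt z) (R.elt y) =
        R.Γ.dist (R.elt x) (R.elt y) → x⁻¹ * z ∈ Q ^ n := by
    intro n
    induction n using Nat.strong_induction_on with
    | _ n ih =>
      intro z hz hzy
      obtain rfl | hn := Nat.eq_zero_or_pos n
      · have : x = z := Sum.inl_injective (R.connected.dist_eq_zero_iff.1 hz)
        simp [this]
      obtain ⟨m, hm, hmz⟩ := exists_dist_eq R.connected (v := R.elt x) (w := R.elt z)
        (i := n - 1) (by omega)
      have t1 : R.Γ.dist m (R.elt y) ≤ R.Γ.dist m (R.elt z) + R.Γ.dist (R.elt z) (R.elt y) :=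
        R.connected.dist_triangle
      have t2 : R.Γ.dist (R.elt x) (R.elt y) ≤ R.Γ.dist (R.elt x) m + R.Γ.dist m (R.elt y) :=
        R.connected.dist_triangle
      have hadj : R.Γ.Adj m (R.elt z) := SimpleGraph.dist_eq_one_iff_adj.1 (by omega)
      obtain ⟨w, rfl⟩ | ⟨a, rfl⟩ := eq_elt_or_eq_cone m
      · have hw := ih (n - 1) (by omega) w hm (by omega)
        have e : n = n - 1 + 1 := by omega
        rw [e, pow_succ]
        refine ⟨x⁻¹ * w, hw, w⁻¹ * z, .inr (.inl ?_), by simp [mul_assoc]⟩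
        obtain ⟨-, h' | h'⟩ := (SimpleGraph.mulCayley_adj R.S w z).1 hadj
        · exact .inl h'
        · exact .inr (by simpa using h')
      · have hza : (z : G ⧸ (a.1 : Subgroup G)) = a.2 := hadj
        have hn2 : 2 ≤ n := by
          by_contra hlt
          have : R.elt x = R.cone a := R.connected.dist_eq_zero_iff.1 (by omega)
          exact elt_ne_cone x a this
        obtain ⟨m, hm', hma⟩ := exists_dist_eq R.connected (v := R.elt x) (w := R.cone a)
          (i := n - 2) (by omega)
        have s1 : R.Γ.dist (R.cone a) m = R.Γ.dist m (R.cone a) := SimpleGraph.dist_comm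
        have s2 : R.Γ.dist (R.cone a) (R.elt x) = R.Γ.dist (R.elt x) (R.cone a) :=
          SimpleGraph.dist_comm
        have s3 : R.Γ.dist m (R.elt x) = R.Γ.dist (R.elt x) m := SimpleGraph.dist_comm
        have t3 : R.Γ.dist m (R.elt y) ≤ R.Γ.dist m (R.cone a) +
          R.Γ.dist (R.cone a) (R.elt y) := R.connected.dist_triangle
        have t4 : R.Γ.dist (R.elt x) (R.elt y) ≤ R.Γ.dist (R.elt x) m + R.Γ.dist m (R.elt y) :=
          R.connected.dist_triangle
        have hadj' : R.Γ.Adj (R.cone a) m := SimpleGraph.dist_eq_one_iff_adj.1 (by omega)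
        obtain ⟨w, rfl, hwa⟩ := exists_eq_elt_of_adj hadj'
        have hw := ih (n - 2) (by omega) w hm' (by omega)
        -- Since `w`, the cone point and `z` lie in this order on a geodesic from `x` to `y`, the
        -- elements `w` and `z` are gates of `x` and `y`.
        have g1 : IsGate R.Γ (R.cone a) (R.elt x) (R.elt w) := ⟨hadj', by omega⟩
        have g2 : IsGate R.Γ (R.cone a) (R.elt y) (R.elt z) := ⟨hadj.symm, by omega⟩
        have d1 : dist (pt a w hwa) (vpr a (R.elt x)) ≤ R.B :=
          dist_vgate_self_le (elt_ne_cone x a) ⟨w, hwa, .inr g1, rfl⟩ (vpr_mem a _)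
        have d2 : dist (vpr a (R.elt y)) (pt a z hza) ≤ R.B :=
          dist_vgate_self_le (elt_ne_cone y a) (vpr_mem a _) ⟨z, hza, .inr g2, rfl⟩
        have d3 := dist_triangle4 (pt a w hwa) (vpr a (R.elt x)) (vpr a (R.elt y)) (pt a z hza)
        have d4 := hxa a
        have hwz : w⁻¹ * z ∈ F := by
          refine Set.mem_iUnion.2 ⟨a.1, ⟨w⁻¹ * z, QuotientGroup.eq.1 (hwa.trans hza.symm)⟩,
            ⟨loc a w hwa, ?_⟩, rfl⟩
          have e : loc a w hwa * ⟨w⁻¹ * z, QuotientGroup.eq.1 (hwa.trans hza.symm)⟩ =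
            loc a z hza := Subtype.ext (by simp [coe_loc, mul_assoc])
          rw [e]
          change dist (pt a w hwa) (pt a z hza) ≤ _
          linarith
        have e : n = (n - 2) + 1 + 1 := by omega
        rw [e, pow_succ]
        exact ⟨x⁻¹ * w, Set.pow_subset_pow_right h1Q (Nat.le_succ _) hw, w⁻¹ * z,
          .inr (.inr hwz), by simp [mul_assoc]⟩
  have := key _ y rfl (by rw [SimpleGraph.dist_self, add_zero])
  rw [hy, inv_mul_cancel_left] at this
  exact Set.pow_subset_pow_right h1Q (Nat.le_floor hx) this

end RelHypData

/-- In a hyperbolic space the Gromov product at `c` of two points of a geodesic is, up to an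
additive error, at least the distance from `c` to the geodesic between them. -/
theorem IsGeodesic.le_gromovProduct {Y : Type*} [MetricSpace Y] {δ M ℓ s t : ℝ} {γ : ℝ → Y} {c : Y}
    (hδ : FourPoint (fun x y : Y => dist x y) δ) (hγ : IsGeodesic ℓ γ)
    (hM : ∀ t ∈ Set.Icc 0 ℓ, M ≤ dist c (γ t)) (hs : s ∈ Set.Icc 0 ℓ) (ht : t ∈ Set.Icc 0 ℓ) :
    2 * (M - 2 * δ) + dist (γ s) (γ t) ≤ dist c (γ s) + dist c (γ t) := by
  wlog hst : s ≤ t generalizing s t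
  · have := this ht hs (le_of_not_ge hst)
    rw [dist_comm (γ s)]
    linarith
  have d0 : dist (γ s) (γ t) = t - s := by
    rw [hγ.2 s hs t ht, abs_sub_comm, abs_of_nonneg (sub_nonneg.2 hst)]
  have t1 := dist_triangle c (γ s) (γ t)
  have t2 := dist_triangle_right c (γ s) (γ t)
  -- The internal point of the comparison tripod: it makes the two sums in the four-point condition
  -- equal.
  set τ := (t + s + dist c (γ s) - dist c (γ t)) / 2 with hτ
  have h1 : s ≤ τ := by linarith
  have h2 : τ ≤ t := by linarith
  have hm : τ ∈ Set.Icc 0 ℓ := ⟨hs.1.trans h1, h2.trans ht.2⟩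
  have d1 : dist (γ τ) (γ t) = t - τ := by
    rw [hγ.2 τ hm t ht, abs_sub_comm, abs_of_nonneg (sub_nonneg.2 h2)]
  have d2 : dist (γ τ) (γ s) = τ - s := by
    rw [hγ.2 τ hm s hs, abs_of_nonneg (sub_nonneg.2 h1)]
  have h4 := hδ c (γ τ) (γ s) (γ t)
  simp only at h4
  rw [d0, d1, d2] at h4
  have h5 := hM τ hm
  obtain h | h := max_choice (dist c (γ s) + (t - τ)) (dist c (γ t) + (τ - s)) <;>
    rw [h] at h4 <;> linarith

/-! ### The combination data of a relatively hyperbolic group -/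

namespace RelHypData

variable {G : Type u} [Group G] (R : RelHypData G) {T : Set G} (hT : Subgroup.closure T = ⊤)

theorem fourPoint_realization :
    FourPoint (fun x y : Realization R.Γ R.connected => dist x y) (R.D + 4) := by
  refine Realization.fourPoint fun x y z w => ?_
  have h : ((R.Γ.dist x y + R.Γ.dist z w : ℕ) : ℝ) ≤ _ := Nat.cast_le.2 (R.fourPoint x y z w)
  push_cast at h
  have : (0 : ℝ) ≤ R.D := Nat.cast_nonneg _
  simp only
  linarith

-- If the geodesic stays farther than `M` from the cone point, Gromov products there are at least `M
-- - 2 * (D + 4)`, which is at least `2 * D + 4`. Doubling and subtracting 6 for rounding three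
-- distances to vertices leaves the `2 * (2 * D + 1)` needed for a detour.
variable {R} in
theorem gate_geodesic {a : R.Coset} {M ℓ : ℝ} {γ : ℝ → Realization R.Γ R.connected}
    (hM : 4 * R.D + 12 ≤ M) (hγ : IsGeodesic ℓ γ) :
    (∃ t ∈ Set.Icc 0 ℓ, dist (γ t) (Realization.vertex _ (R.cone a)) ≤ M) ∨
      ∀ s ∈ Set.Icc 0 ℓ, ∀ t ∈ Set.Icc 0 ℓ, ∀ z ∈ vgate a (γ s).src, ∀ w ∈ vgate a (γ t).src,
        dist z w ≤ R.B := by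
  have hD : (0 : ℝ) ≤ R.D := Nat.cast_nonneg _
  by_cases h : ∃ t ∈ Set.Icc 0 ℓ, dist (γ t) (Realization.vertex _ (R.cone a)) ≤ M
  · exact .inl h
  push Not at h
  have hne : ∀ t ∈ Set.Icc 0 ℓ, (γ t).src ≠ R.cone a := by
    intro t ht e
    have h1 := h t ht
    rw [← e] at h1
    have h2 := (γ t).dist_src_le
    linarith
  right
  intro s hs t ht z hz w hw
  have h1 := hγ.le_gromovProduct R.fourPoint_realization (M := M)
    (c := Realization.vertex _ (R.cone a))
    (fun t ht => by rw [dist_comm]; exact (h t ht).le) hs ht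
  have h2 := abs_le.1 (Realization.abs_dist_sub_le (γ s) (γ t))
  have h3 := abs_le.1 (Realization.abs_dist_sub_le (Realization.vertex _ (R.cone a)) (γ s))
  have h4 := abs_le.1 (Realization.abs_dist_sub_le (Realization.vertex _ (R.cone a)) (γ t))
  refine dist_vgate_le_of_gromovProduct (hne s hs) (hne t ht) ?_ hz hw
  have : ((2 * (2 * R.D + 1) + R.Γ.dist (γ s).src (γ t).src : ℕ) : ℝ) ≤
      ((R.Γ.dist (R.cone a) (γ s).src + R.Γ.dist (R.cone a) (γ t).src : ℕ) : ℝ) := by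
    push_cast
    rw [Realization.src_vertex] at h3 h4
    linarith
  exact_mod_cast this

theorem dist_vertex_mul_le (x s : G) (hs : s ∈ R.S) :
    dist (Realization.vertex R.connected (R.elt x)) (Realization.vertex R.connected
      (R.elt (x * s))) ≤ 1 := by
  rw [Realization.dist_vertex]
  by_cases h : x = x * s
  · rw [← h]; simp
  · rw [SimpleGraph.dist_eq_one_iff_adj.2 (conedOff_adj_inl_mul hs h)]; simp

theorem dist_vpr_mul_le (a : R.Coset) (x s : G) (hs : s ∈ R.S) :
    dist (vpr a (R.elt x)) (vpr a (R.elt (x * s))) ≤ R.B := by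
  by_cases h : x = x * s
  · rw [← h, dist_self]; exact B_nonneg_of a
  · exact dist_vgate_le_of_adj (conedOff_adj_inl_mul hs h) (elt_ne_cone _ a) (elt_ne_cone _ a)
      (vpr_mem a _) (vpr_mem a _)

/-- The conditions on a constant that is used for all axioms of the combination. -/
structure IsBound (M : ℝ) : Prop where
  one_le : 1 ≤ M
  δ_le : ∀ P, (R.model P).H.δ ≤ M
  ξ_le : ∀ P, (R.model P).H.ξ ≤ M
  K_le : ∀ P, (R.model P).H.K ≤ M
  κ₀_le : ∀ P, (R.model P).H.κ₀ ≤ M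
  lam_le : ∀ P, (R.model P).H.lam ≤ M
  E_le : ∀ P, (R.model P).H.E ≤ M
  α_le : ∀ P, (R.model P).H.α ≤ M
  B_le : R.B ≤ M
  D_le : 4 * R.D + 12 ≤ M
  lipschitz : ∀ {Z : Type u} [MetricSpace Z] (f : G → Z) (K : ℝ), 0 ≤ K → K ≤ max 1 R.B →
    (∀ x, ∀ s ∈ R.S, dist (f x) (f (x * s)) ≤ K) →
      ∀ x y, dist (f x) (f y) ≤ M * dist (toWord hT x) (toWord hT y)
  realization : ∀ (a : R.Coset) (z : (R.model a.1).Z), ∃ g : G,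
    (g : G ⧸ (a.1 : Subgroup G)) = a.2 ∧ dist (vpr a (R.elt g)) z ≤ M

variable {R hT} in
theorem IsBound.toY_lipschitz {M : ℝ} (hM : R.IsBound hT M) (x y : G) :
    dist (Realization.vertex R.connected (R.elt x)) (Realization.vertex R.connected (R.elt y)) ≤
      M * dist (toWord hT x) (toWord hT y) :=
  hM.lipschitz (fun x => Realization.vertex R.connected (R.elt x)) 1 zero_le_one (le_max_left _ _)
    R.dist_vertex_mul_le x y

variable {R hT} in
theorem IsBound.pr_lipschitz {M : ℝ} (hM : R.IsBound hT M) (a : R.Coset) (x y : G) :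
    dist (vpr a (R.elt x)) (vpr a (R.elt y)) ≤ M * dist (toWord hT x) (toWord hT y) :=
  hM.lipschitz (fun x => vpr a (R.elt x)) R.B (B_nonneg_of a) (le_max_right _ _)
    (R.dist_vpr_mul_le a) x y

/-- All conditions hold for every large constant, and there are finitely many peripheral subgroups.
The Lipschitz condition is meant for the inclusion into the coned-off graph, with step 1, and for
the gates, with step `R.B`. -/
theorem exists_isBound (hfin : T.Finite) : ∃ M, R.IsBound hT M := by
  have h (f : R.Ps → ℝ) : ∀ᶠ M : ℝ in atTop, ∀ P, f P ≤ M :=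
    eventually_all.2 fun P => eventually_ge_atTop (f P)
  obtain ⟨N, hN0, hN⟩ := exists_lipschitz R.hS hT hfin
  obtain ⟨r, hr⟩ := R.exists_realization
  obtain ⟨M, h1, h2, h3, h4, h5, h6, h7, h8, h9, h10, h11, h12⟩ :=
    ((eventually_ge_atTop (1 : ℝ)).and <| (h fun P => (R.model P).H.δ).and <|
      (h fun P => (R.model P).H.ξ).and <| (h fun P => (R.model P).H.K).and <|
      (h fun P => (R.model P).H.κ₀).and <| (h fun P => (R.model P).H.lam).and <|
      (h fun P => (R.model P).H.E).and <| (h fun P => (R.model P).H.α).and <|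
      (eventually_ge_atTop R.B).and <| (eventually_ge_atTop (4 * (R.D : ℝ) + 12)).and <|
      (eventually_ge_atTop (N * max 1 R.B)).and (eventually_ge_atTop r)).exists
  refine ⟨M, h1, h2, h3, h4, h5, h6, h7, h8, h9, h10, ?_, fun a z => ?_⟩
  · intro Z _ f K hK hKB hf x y
    refine (hN f K hK hf x y).trans ?_
    gcongr
    exact (mul_le_mul_of_nonneg_left hKB hN0).trans h11
  · obtain ⟨g, hg, hd⟩ := hr a z
    exact ⟨g, hg, hd.trans h12⟩

theorem exists_complexity : ∃ n, ∀ P, (R.model P).H.complexity ≤ n := by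
  obtain ⟨n, hn⟩ := (Set.finite_range fun P => (R.model P).H.complexity).bddAbove
  exact ⟨n, fun P => hn ⟨P, rfl⟩⟩

theorem exists_θ : ∃ θ₀ : ℝ → ℝ, ∀ P κ, (R.model P).H.θ κ ≤ θ₀ κ := by
  have : ∀ κ : ℝ, ∃ r : ℝ, ∀ P, (R.model P).H.θ κ ≤ r := by
    intro κ
    obtain ⟨n, hn⟩ := (Set.finite_range fun P => (R.model P).H.θ κ).bddAbove
    exact ⟨n, fun P => hn ⟨P, rfl⟩⟩
  choose θ₀ h using this
  exact ⟨θ₀, fun P κ => h κ P⟩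

/-- A group that is hyperbolic relative to a collection of subgroups with coarse models is
hyperbolic relative to the family of models of the cosets. -/
def combinationData (hfin : T.Finite) : CombinationData (WordSpace T hT) :=
  have hM := (R.exists_isBound hT hfin).choose_spec
  { Y := Realization R.Γ R.connected
    A := R.Coset
    Z := fun a => (R.model a.1).Z
    H := fun a => (R.model a.1).H
    toY := fun x : G => Realization.vertex R.connected (R.elt x)
    cone := fun a => Realization.vertex R.connected (R.cone a)
    gate := fun a y => vgate a y.src
    gate_nonempty := fun a y => vgate_nonempty a y.src
    pr := fun a (x : G) => vpr a (R.elt x)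
    coneGate := fun a b => vpr b (R.cone a)
    M := (R.exists_isBound hT hfin).choose
    n := R.exists_complexity.choose
    θ₀ := R.exists_θ.choose
    one_le_M := hM.one_le
    δ_le := fun a => hM.δ_le a.1
    ξ_le := fun a => hM.ξ_le a.1
    K_le := fun a => hM.K_le a.1
    κ₀_le := fun a => hM.κ₀_le a.1
    lam_le := fun a => hM.lam_le a.1
    E_le := fun a => hM.E_le a.1
    α_le := fun a => hM.α_le a.1
    complexity_le := fun a => R.exists_complexity.choose_spec a.1
    θ_le := fun a => R.exists_θ.choose_spec a.1
    hyperbolicY := ⟨Realization.isGeodesicSpace, fun x y z w => by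
      have := R.fourPoint_realization x y z w
      have := hM.D_le
      have : (0 : ℝ) ≤ R.D := Nat.cast_nonneg _
      linarith⟩
    toY_lipschitz := hM.toY_lipschitz
    pr_lipschitz := hM.pr_lipschitz
    dist_gate_pr_le := fun a (x : G) z hz =>
      (dist_vgate_self_le (elt_ne_cone x a) hz (vpr_mem a _)).trans hM.B_le
    gate_geodesic := fun a ℓ γ hγ => (gate_geodesic hM.D_le hγ).imp_right
      fun h s hs t ht z hz w hw => (h s hs t ht z hz w hw).trans hM.B_le
    consistency := fun a b hab x => (vgate_consistency hab x).imp (fun h => h.trans hM.B_le)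
      fun h => h.trans hM.B_le
    links := fun x y => by
      obtain ⟨s, h1, h2, h3⟩ := vgate_links (R := R) x y
      refine ⟨s, ?_, fun a ha => ?_, fun a ha => (h3 a ha).trans hM.B_le⟩
      · rw [Realization.dist_vertex]; exact_mod_cast h1
      · rw [Realization.dist_vertex, Realization.dist_vertex]; exact_mod_cast h2 a ha
    realization := fun a z => by
      obtain ⟨g, hg, hd⟩ := hM.realization a z
      -- The realizing element is adjacent to the cone point of `a`; crossing this edge moves the
      -- gate in any other coset by at most `R.B`.
      have hadj : R.Γ.Adj (R.elt g) (R.cone a) := hg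
      refine ⟨g, hd, ?_, fun b hab => ?_⟩
      · rw [Realization.dist_vertex, SimpleGraph.dist_eq_one_iff_adj.2 hadj]
        exact_mod_cast hM.one_le
      · exact (dist_vgate_le_of_adj hadj (elt_ne_cone g b)
          (fun h => hab (Sum.inr_injective h)) (vpr_mem b _) (vpr_mem b _)).trans hM.B_le
    uniqueness := fun r => by
      -- Only finitely many differences `x⁻¹ * y` are invisible at scale `r`, so their word lengths
      -- are bounded.
      obtain ⟨C, hC⟩ := ((R.finite_of_dist_le r).image
        fun g => dist (toWord hT 1) (toWord hT g)).bddAbove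
      refine ⟨C + 1, fun (x y : G) hxy => ?_⟩
      by_contra! h
      rw [Realization.dist_vertex] at h
      have hmem : x⁻¹ * y ∈ {g : G | ∃ x,
          (R.Γ.dist (R.elt x) (R.elt (x * g)) : ℝ) ≤ r ∧
            ∀ a, dist (vpr a (R.elt x)) (vpr a (R.elt (x * g))) ≤ r} := by
        refine ⟨x, ?_, fun a => ?_⟩
        · rw [mul_inv_cancel_left]; exact h.1.le
        · rw [mul_inv_cancel_left]; exact (h.2 a).le
      have h1 := hC (Set.mem_image_of_mem _ hmem)
      have h2 := dist_mul_left_toWord (hS := hT) x 1 (x⁻¹ * y)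
      rw [mul_one, mul_inv_cancel_left] at h2
      change C + 1 ≤ dist (toWord hT x) (toWord hT y) at hxy
      linarith }

instance : Nonempty (WordSpace T hT) := ⟨toWord hT 1⟩

end RelHypData

/-! ### Group actions on combinations -/

section CoarselyEqual

variable {X : Type*} [MetricSpace X] {A B C : Set X} {r s : ℝ}

theorem CoarselyEqual.mono (h : CoarselyEqual r A B) (hrs : r ≤ s) : CoarselyEqual s A B :=
  ⟨fun a ha => (h.1 a ha).imp fun _ hb => ⟨hb.1, hb.2.trans hrs⟩,
    fun b hb => (h.2 b hb).imp fun _ ha => ⟨ha.1, ha.2.trans hrs⟩⟩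

theorem CoarselyEqual.trans (h : CoarselyEqual r A B) (h' : CoarselyEqual s B C) :
    CoarselyEqual (r + s) A C := by
  refine ⟨fun a ha => ?_, fun c hc => ?_⟩
  · obtain ⟨b, hb, h1⟩ := h.1 a ha
    obtain ⟨c, hc, h2⟩ := h'.1 b hb
    exact ⟨c, hc, (dist_triangle a b c).trans (add_le_add h1 h2)⟩
  · obtain ⟨b, hb, h1⟩ := h'.2 c hc
    obtain ⟨a, ha, h2⟩ := h.2 b hb
    exact ⟨a, ha, (dist_triangle a b c).trans (add_le_add h2 h1)⟩

theorem coarselyEqual_singleton {a b : X} (h : a = b) (hr : 0 ≤ r) :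
    CoarselyEqual r {a} {b} := by
  subst h
  constructor <;> rintro _ rfl <;> exact ⟨_, rfl, by rwa [dist_self]⟩

theorem CoarselyEqual.biUnion {ι κ : Type*} {s : Set ι} {t : Set κ} {f : ι → Set X}
    {g : κ → Set X} (h : ∀ i ∈ s, ∃ j ∈ t, CoarselyEqual r (f i) (g j))
    (h' : ∀ j ∈ t, ∃ i ∈ s, CoarselyEqual r (f i) (g j)) :
    CoarselyEqual r (⋃ i ∈ s, f i) (⋃ j ∈ t, g j) := by
  refine ⟨fun a ha => ?_, fun b hb => ?_⟩
  · obtain ⟨i, hi, ha⟩ := Set.mem_iUnion₂.1 ha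
    obtain ⟨j, hj, h⟩ := h i hi
    obtain ⟨b, hb, hab⟩ := h.1 a ha
    exact ⟨b, Set.mem_iUnion₂.2 ⟨j, hj, hb⟩, hab⟩
  · obtain ⟨j, hj, hb⟩ := Set.mem_iUnion₂.1 hb
    obtain ⟨i, hi, h⟩ := h' j hj
    obtain ⟨a, ha, hab⟩ := h.2 b hb
    exact ⟨a, Set.mem_iUnion₂.2 ⟨i, hi, ha⟩, hab⟩

end CoarselyEqual

namespace CombIdx

variable {A : Type u} {I : A → Type u}

/-- The map of index sets that is induced by maps of the members of the family. -/
def map (e : A ≃ A) (f : ∀ a, I a ≃ I (e a)) : CombIdx I → CombIdx I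
  | top => top
  | piece a U => piece (e a) (f a U)

theorem map_bijective (e : A ≃ A) (f : ∀ a, I a ≃ I (e a)) : Function.Bijective (map e f) := by
  constructor
  · rintro (_ | ⟨a, U⟩) (_ | ⟨b, V⟩) h
    · rfl
    · cases h
    · cases h
    · have hab : a = b := by
        injection h with h
        exact e.injective h
      subst hab
      injection h with _ h
      rw [(f a).injective h]
  · rintro (_ | ⟨b, V⟩)
    · exact ⟨top, rfl⟩
    · obtain ⟨a, rfl⟩ := e.surjective b
      obtain ⟨U, rfl⟩ := (f a).surjective V
      exact ⟨piece a U, rfl⟩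

/-- The bijection of index sets that is induced by bijections of the members of the family. -/
def congr (e : A ≃ A) (f : ∀ a, I a ≃ I (e a)) : CombIdx I ≃ CombIdx I :=
  Equiv.ofBijective (map e f) (map_bijective e f)

end CombIdx

namespace CombinationData

variable {X : Type u} [MetricSpace X]

/-- An action of a group by isometries on a space with combination data that permutes the pieces
and acts on them by coarse automorphisms. -/
structure Action (G : Type u) [Group G] (D : CombinationData X) where
  k : ℝ
  one_le_k : 1 ≤ k
  move : G → X → X
  φ : G → D.Y ≃ᵢ D.Y
  e : G → D.A ≃ D.A
  idx : ∀ g a, (D.H a).Idx ≃ (D.H (e g a)).Idx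
  iso : ∀ g a U, (D.H a).C U ≃ᵢ (D.H (e g a)).C (idx g a U)
  trans : ∀ g a, D.Z a → D.Z (e g a)
  map_le : ∀ g a U V, U ≤ V → idx g a U ≤ idx g a V
  map_perp : ∀ g a U V, (D.H a).perp U V → (D.H (e g a)).perp (idx g a U) (idx g a V)
  map_transverse : ∀ g a U V, IsTransverse (D.H a).perp U V →
    IsTransverse (D.H (e g a)).perp (idx g a U) (idx g a V)
  proj : ∀ g a U z, CoarselyEqual k (iso g a U '' (D.H a).proj U z)
    ((D.H (e g a)).proj (idx g a U) (trans g a z))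
  rhoSet : ∀ g a U V, (U < V ∨ IsTransverse (D.H a).perp U V) →
    CoarselyEqual k (iso g a V '' (D.H a).rhoSet U V)
      ((D.H (e g a)).rhoSet (idx g a U) (idx g a V))
  rhoMap : ∀ g a U V, V < U → ∀ p, CoarselyEqual k (iso g a V '' (D.H a).rhoMap U V p)
    ((D.H (e g a)).rhoMap (idx g a U) (idx g a V) (iso g a U p))
  map_toY : ∀ g x, φ g (D.toY x) = D.toY (move g x)
  map_cone : ∀ g a, φ g (D.cone a) = D.cone (e g a)
  map_pr : ∀ g a x, dist (trans g a (D.pr a x)) (D.pr (e g a) (move g x)) ≤ k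
  map_coneGate : ∀ g a b, a ≠ b →
    dist (trans g b (D.coneGate a b)) (D.coneGate (e g a) (e g b)) ≤ k
  map_gate : ∀ g a y, ∀ z ∈ D.gate a y, ∃ w ∈ D.gate (e g a) (φ g y), dist (trans g a z) w ≤ k
  exists_map_gate : ∀ g a y, ∀ w ∈ D.gate (e g a) (φ g y), ∃ z ∈ D.gate a y,
    dist (trans g a z) w ≤ k
  φ_mul : ∀ g h y, φ (g * h) y = φ g (φ h y)
  idx_mul : ∀ g h a U, (⟨e (g * h) a, idx (g * h) a U⟩ : Σ a, (D.H a).Idx) =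
    ⟨e g (e h a), idx g (e h a) (idx h a U)⟩
  iso_mul : ∀ g h a U p, (⟨⟨e (g * h) a, idx (g * h) a U⟩, iso (g * h) a U p⟩ :
      Σ V : Σ a, (D.H a).Idx, (D.H V.1).C V.2) =
    ⟨⟨e g (e h a), idx g (e h a) (idx h a U)⟩, iso g (e h a) (idx h a U) (iso h a U p)⟩
  move_one : ∀ x, move 1 x = x
  move_mul : ∀ g h x, move (g * h) x = move g (move h x)
  dist_move : ∀ g x y, dist (move g x) (move g y) = dist x y

namespace Action

variable {G : Type u} [Group G] {D : CombinationData X} (T : D.Action G)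

/-- The constant for the commuting diagrams of the combination. -/
def bound : ℝ := T.k + (D.M * T.k + 3 * D.M)

theorem k_le_bound : T.k ≤ T.bound := by
  have := D.one_le_M
  have := T.one_le_k
  have : 0 ≤ D.M * T.k := by positivity
  unfold bound
  linarith

theorem coarselyEqual_proj_of_near (D : CombinationData X) {r : ℝ} {a : D.A} {z w : D.Z a}
    (h : dist z w ≤ r) (U : (D.H a).Idx) :
    CoarselyEqual (D.M * r + 3 * D.M) ((D.H a).proj U z) ((D.H a).proj U w) := by
  have key := fun p hp q hq => (D.H a).dist_proj_le (D.K_le a) (D.ξ_le a)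
    (zero_le_one.trans D.one_le_M) h (U := U) (p := p) (q := q) hp hq
  obtain ⟨p₀, hp₀⟩ := (D.H a).proj_nonempty U z
  obtain ⟨q₀, hq₀⟩ := (D.H a).proj_nonempty U w
  exact ⟨fun p hp => ⟨q₀, hq₀, key p hp q₀ hq₀⟩, fun q hq => ⟨p₀, hp₀, key p₀ hp₀ q hq⟩⟩

/-- The error of the piece's own automorphism adds to the effect of moving the base point by `T.k`.
-/
theorem coarselyEqual_proj (g : G) (a : D.A) (U : (D.H a).Idx) {z : D.Z a} {w : D.Z (T.e g a)}
    (h : dist (T.trans g a z) w ≤ T.k) :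
    CoarselyEqual T.bound (T.iso g a U '' (D.H a).proj U z)
      ((D.H (T.e g a)).proj (T.idx g a U) w) :=
  (T.proj g a U z).trans (coarselyEqual_proj_of_near D h _)

/-- The isometries of the hyperbolic spaces of the combination. -/
def isoC (g : G) : ∀ U : D.Idx, D.C U ≃ᵢ D.C (CombIdx.congr (T.e g) (T.idx g) U)
  | .top => T.φ g
  | .piece a U => T.iso g a U

variable [Nonempty X]

/-- The automorphism of the combination that belongs to a group element. -/
def preAut (g : G) : D.toHHSStructure.PreAut where
  toFun := T.move g
  idx := CombIdx.congr (T.e g) (T.idx g)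
  iso := T.isoC g
  map_le U V h := by
    cases V with
    | top => exact CombIdx.le_top _
    | piece a V =>
      obtain ⟨U, rfl, h'⟩ := CombIdx.le_piece.1 h
      exact CombIdx.piece_le_piece.2 (T.map_le g a U V h')
  map_perp := by
    rintro _ _ ⟨a, U, V, h⟩
    exact CombIdx.side_piece.2 (T.map_perp g a U V h)
  map_transverse U V h := by
    cases U with
    | top => exact (CombIdx.not_isTransverse_top_left _ h).elim
    | piece a U =>
      cases V with
      | top => exact (CombIdx.not_isTransverse_top_right _ h).elim
      | piece b V =>
        by_cases hab : a = b
        · subst hab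
          exact CombIdx.isTransverse_piece.2
            (T.map_transverse g a U V (CombIdx.isTransverse_piece.1 h))
        · exact CombIdx.isTransverse_piece_of_ne (fun h => hab ((T.e g).injective h)) _ _

theorem coarselyCommutes (g : G) : (T.preAut g).CoarselyCommutes T.bound where
  proj U x := by
    cases U with
    | top =>
      change CoarselyEqual T.bound (T.φ g '' {D.toY x}) {D.toY (T.move g x)}
      rw [Set.image_singleton]
      exact coarselyEqual_singleton (T.map_toY g x)
        (zero_le_one.trans (T.one_le_k.trans T.k_le_bound))
    | piece a U => exact T.coarselyEqual_proj g a U (T.map_pr g a x)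
  rhoSet U V h := by
    cases V with
    | top =>
      cases U with
      | top =>
        obtain h | h := h
        · exact (lt_irrefl _ h).elim
        · exact (CombIdx.not_isTransverse_top_right _ h).elim
      | piece a U =>
        change CoarselyEqual T.bound (T.φ g '' {D.cone a}) {D.cone (T.e g a)}
        rw [Set.image_singleton]
        exact coarselyEqual_singleton (T.map_cone g a)
          (zero_le_one.trans (T.one_le_k.trans T.k_le_bound))
    | piece b V =>
      cases U with
      | top =>
        obtain h | h := h
        · exact (CombIdx.not_top_lt _ h).elim
        · exact (CombIdx.not_isTransverse_top_left _ h).elim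
      | piece a U =>
        by_cases hab : a = b
        · subst hab
          change CoarselyEqual T.bound (T.iso g a V '' D.rhoSet (.piece a U) (.piece a V))
            (D.rhoSet (.piece (T.e g a) (T.idx g a U)) (.piece (T.e g a) (T.idx g a V)))
          rw [rhoSet_piece, rhoSet_piece]
          refine (T.rhoSet g a U V ?_).mono T.k_le_bound
          exact h.imp CombIdx.piece_lt_piece.1 CombIdx.isTransverse_piece.1
        · change CoarselyEqual T.bound (T.iso g b V '' D.rhoSet (.piece a U) (.piece b V))
            (D.rhoSet (.piece (T.e g a) (T.idx g a U)) (.piece (T.e g b) (T.idx g b V)))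
          rw [rhoSet_piece_of_ne _ hab, rhoSet_piece_of_ne _ fun h => hab ((T.e g).injective h)]
          exact T.coarselyEqual_proj g b V (T.map_coneGate g a b hab)
  rhoMap U V h p := by
    cases U with
    | top =>
      cases V with
      | top => exact (lt_irrefl _ h).elim
      | piece a V =>
        change CoarselyEqual T.bound (T.iso g a V '' ⋃ z ∈ D.gate a p, (D.H a).proj V z)
          (⋃ w ∈ D.gate (T.e g a) (T.φ g p), (D.H (T.e g a)).proj (T.idx g a V) w)
        rw [Set.image_iUnion₂]
        exact CoarselyEqual.biUnion
          (fun z hz => (T.map_gate g a p z hz).imp fun w hw =>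
            ⟨hw.1, T.coarselyEqual_proj g a V hw.2⟩)
          (fun w hw => (T.exists_map_gate g a p w hw).imp fun z hz =>
            ⟨hz.1, T.coarselyEqual_proj g a V hz.2⟩)
    | piece a U =>
      obtain ⟨V, rfl, h'⟩ := CombIdx.lt_piece.1 h
      change CoarselyEqual T.bound (T.iso g a V '' D.rhoMap (.piece a U) (.piece a V) p)
        (D.rhoMap (.piece (T.e g a) (T.idx g a U)) (.piece (T.e g a) (T.idx g a V))
          (T.iso g a U p))
      have e1 := D.rhoMap_piece a U V p
      have e2 := D.rhoMap_piece (T.e g a) (T.idx g a U) (T.idx g a V) (T.iso g a U p)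
      rw [e2]
      refine (CoarselyEqual.mono ?_ T.k_le_bound)
      have e := congrArg (fun A => T.iso g a V '' A) e1
      exact e ▸ T.rhoMap g a U V h' p

/-- The action on the combination. -/
def toHHSAction : HHSAction G D.toHHSStructure where
  aut := T.preAut
  k := T.bound
  one_le_k := T.one_le_k.trans T.k_le_bound
  commutes := T.coarselyCommutes
  idx_mul g h U := by
    cases U with
    | top => rfl
    | piece a U =>
      exact congrArg (fun V : Σ a, (D.H a).Idx => (CombIdx.piece V.1 V.2 : D.Idx))
        (T.idx_mul g h a U)
  iso_mul g h U p := by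
    cases U with
    | top => exact congrArg (fun y : D.Y => (⟨.top, y⟩ : Σ V : D.Idx, D.C V)) (T.φ_mul g h p)
    | piece a U =>
      exact congrArg (fun q : Σ V : Σ a, (D.H a).Idx, (D.H V.1).C V.2 =>
        (⟨.piece q.1.1 q.1.2, q.2⟩ : Σ V : D.Idx, D.C V)) (T.iso_mul g h a U p)
  quasi_one x := by
    change dist (T.move 1 x) x ≤ _
    rw [T.move_one, dist_self]
    exact zero_le_one.trans (T.one_le_k.trans T.k_le_bound)
  quasi_mul g h x := by
    change dist (T.move (g * h) x) (T.move g (T.move h x)) ≤ _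
    rw [T.move_mul, dist_self]
    exact zero_le_one.trans (T.one_le_k.trans T.k_le_bound)
  quasi_isometry g x y := by
    change _ ≤ dist (T.move g x) (T.move g y) ∧ dist (T.move g x) (T.move g y) ≤ _
    rw [T.dist_move]
    have hk := T.one_le_k.trans T.k_le_bound
    have hd := dist_nonneg (x := x) (y := y)
    have h1 : T.bound⁻¹ * dist x y ≤ 1 * dist x y :=
      mul_le_mul_of_nonneg_right (inv_le_one_of_one_le₀ hk) hd
    have h2 : 1 * dist x y ≤ T.bound * dist x y := mul_le_mul_of_nonneg_right hk hd
    constructor <;> linarith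

end Action

end CombinationData

/-- The coarse model of a hierarchically hyperbolic group. -/
def OrbitModel.ofAction {Q : Type u} [Group Q] {X : Type u} [MetricSpace X] {H : HHSStructure X}
    (A : HHSAction Q H) (x₀ : X)
    (hproper : ∀ (x : X) (r : ℝ),
      {g : Q | ∃ y, dist y x ≤ r ∧ dist ((A.aut g).toFun y) x ≤ r}.Finite)
    (hcob : ∃ r : ℝ, ∀ y, ∃ g : Q, dist y ((A.aut g).toFun x₀) ≤ r) : OrbitModel Q where
  Z := X
  H := H
  o g := (A.aut g).toFun x₀
  bounded q := ⟨A.k * dist x₀ ((A.aut q).toFun x₀) + A.k + A.k, fun p => by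
    have h1 := A.quasi_mul p q x₀
    have h2 := (A.quasi_isometry p x₀ ((A.aut q).toFun x₀)).2
    have := dist_triangle_right ((A.aut p).toFun x₀) ((A.aut (p * q)).toFun x₀)
      ((A.aut p).toFun ((A.aut q).toFun x₀))
    linarith⟩
  cobounded := hcob.imp fun r hr z => (hr z).imp fun p hp => by rwa [dist_comm]
  proper r := by
    -- The first term bounds the displacement of `x₀`; the maximum with 0 keeps the radius
    -- nonnegative, so that `x₀` is its own witness.
    refine (hproper x₀ (max (A.k * (r + 2 * A.k)) 0)).subset ?_
    rintro q ⟨p, hp⟩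
    refine ⟨x₀, by simp, le_max_of_le_left ?_⟩
    have hk : 0 < A.k := zero_lt_one.trans_le A.one_le_k
    have h1 := A.quasi_mul p q x₀
    have h2 := (A.quasi_isometry p x₀ ((A.aut q).toFun x₀)).1
    have h3 := dist_triangle ((A.aut p).toFun x₀) ((A.aut (p * q)).toFun x₀)
      ((A.aut p).toFun ((A.aut q).toFun x₀))
    have h4 : A.k⁻¹ * dist x₀ ((A.aut q).toFun x₀) ≤ r + 2 * A.k := by linarith
    rwa [inv_mul_le_iff₀ hk, dist_comm] at h4

theorem HHSAction.idx_of_eq_mul {Q : Type u} [Group Q] {X : Type u} [MetricSpace X]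
    {H : HHSStructure X} (A : HHSAction Q H) {r p q : Q} (h : r = p * q) (U : H.Idx) :
    (A.aut r).idx U = (A.aut p).idx ((A.aut q).idx U) := by
  subst h
  exact A.idx_mul p q U

theorem HHSAction.iso_of_eq_mul {Q : Type u} [Group Q] {X : Type u} [MetricSpace X]
    {H : HHSStructure X} (A : HHSAction Q H) {r p q : Q} (h : r = p * q) (U : H.Idx)
    (x : H.C U) : (⟨(A.aut r).idx U, (A.aut r).iso U x⟩ : Σ V, H.C V) =
      ⟨(A.aut p).idx ((A.aut q).idx U), (A.aut p).iso ((A.aut q).idx U) ((A.aut q).iso U x)⟩ := by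
  subst h
  exact A.iso_mul p q U x

/-- A coarse model on which the group acts. -/
structure ActedModel (Q : Type u) [Group Q] extends OrbitModel Q where
  A : HHSAction Q H
  finiteOrbits : ∃ F : Set H.Idx, F.Finite ∧ ∀ U, ∃ V ∈ F, ∃ g : Q, U = (A.aut g).idx V
  equivariant : ∃ r : ℝ, ∀ p q, dist ((A.aut p).toFun (o q)) (o (p * q)) ≤ r

theorem IsHHG.nonempty_actedModel {Q : Type u} [Group Q] (h : IsHHG Q) :
    Nonempty (ActedModel Q) := by
  obtain ⟨-, X, _, H, A, -, hproper, ⟨x₀, hcob⟩, hF⟩ := h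
  exact ⟨{ OrbitModel.ofAction A x₀ hproper hcob with
    A := A
    finiteOrbits := hF
    equivariant := ⟨A.k, fun p q => by
      rw [dist_comm]; exact A.quasi_mul p q x₀⟩ }⟩

/-! ### The action of the group on the structures of the cosets -/

namespace RelHypData

variable {G : Type u} [Group G] {R : RelHypData G}

/-- The left translation of the coned-off Cayley graph. -/
abbrev move (R : RelHypData G) (g : G) : R.Γ ≃g R.Γ := conedIso R.S R.Ps g

theorem coe_translate {a : R.Coset} {x : G} (g : G)
    (h : (x : G ⧸ (a.1 : Subgroup G)) = a.2) :
    ((g * x : G) : G ⧸ ((translate g a).1 : Subgroup G)) = (translate g a).2 := by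
  change ((g * x : G) : G ⧸ (a.1 : Subgroup G)) = g • a.2
  rw [← h]
  rfl

/-- The cocycle of the chosen representatives of the cosets. -/
def cocycle (g : G) (a : R.Coset) : (a.1 : Subgroup G) :=
  ⟨(rep (translate g a))⁻¹ * (g * rep a), QuotientGroup.eq.1
    ((coe_rep (translate g a)).trans (coe_translate g (coe_rep a)).symm)⟩

theorem translate_mul (g h : G) (a : R.Coset) :
    translate (g * h) a = translate g (translate h a) := by
  simp only [translate, Equiv.coe_fn_mk, mul_smul]

/-- `cocycle g a` is the element p with g · rep a = rep (g a) · p. This identity makes the induced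
maps between models compose as an action. Translation keeps the subgroup of a coset, so both factors
are read in the subgroup of `a`. -/
theorem cocycle_mul (g h : G) (a : R.Coset) :
    cocycle (g * h) a = HMul.hMul (α := (a.1 : Subgroup G)) (β := (a.1 : Subgroup G))
      (cocycle g (translate h a)) (cocycle h a) := by
  apply Subtype.ext
  change (rep (translate (g * h) a))⁻¹ * (g * h * rep a) =
    ((rep (translate g (translate h a)))⁻¹ * (g * rep (translate h a))) *
      ((rep (translate h a))⁻¹ * (h * rep a))
  rw [translate_mul]
  simp [mul_assoc]

theorem loc_translate (g : G) {a : R.Coset} {x : G}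
    (h : (x : G ⧸ (a.1 : Subgroup G)) = a.2) :
    (loc (translate g a) (g * x) (coe_translate g h) : (a.1 : Subgroup G)) =
      cocycle g a * loc a x h := by
  apply Subtype.ext
  change (rep (translate g a))⁻¹ * (g * x) =
    ((rep (translate g a))⁻¹ * (g * rep a)) * ((rep a)⁻¹ * x)
  simp [mul_assoc]

theorem isEntrance_move {a : R.Coset} {v : ConedVertex R.Ps} {x : G} (g : G)
    (h : IsEntrance a v x) : IsEntrance (translate g a) (R.move g v) (g * x) := by
  refine h.imp (by rintro rfl; rfl) fun h => ⟨?_, ?_⟩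
  · exact (R.move g).map_adj_iff.2 h.1
  · have h1 := Realization.dist_iso (R.move g) (R.elt x) v
    have h2 := Realization.dist_iso (R.move g) (R.cone a) v
    have := h.2
    rw [← h1, ← h2] at this
    exact this

/-- Take g = rep d · p · (rep c)⁻¹. Hence the translations from one coset to another induce all of
`P`, which is why finitely many orbits in each model give finitely many orbits overall. -/
theorem exists_translate_eq (P : R.Ps) (c d : G ⧸ (P : Subgroup G)) (p : (P : Subgroup G)) :
    ∃ g : G, g • c = d ∧ cocycle (R := R) g ⟨P, c⟩ = p := by
  let a : R.Coset := ⟨P, d⟩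
  let b : R.Coset := ⟨P, c⟩
  have hb : (rep a * p * (rep b)⁻¹) • c = d := by
    have h1 : ((rep b : G) : G ⧸ (P : Subgroup G)) = c := coe_rep b
    have h2 : ((rep a : G) : G ⧸ (P : Subgroup G)) = d := coe_rep a
    rw [← h1, MulAction.Quotient.smul_coe, smul_eq_mul, inv_mul_cancel_right, ← h2,
      QuotientGroup.eq]
    simp
  have ht : translate (rep a * p * (rep b)⁻¹) b = a := Sigma.ext rfl (heq_of_eq hb)
  refine ⟨rep a * p * (rep b)⁻¹, hb, Subtype.ext ?_⟩
  change (rep (translate (rep a * p * (rep b)⁻¹) b))⁻¹ * (rep a * p * (rep b)⁻¹ * rep b) = p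
  rw [ht]
  simp

variable (act : ∀ P : R.Ps, HHSAction P (R.model P).H)

/-- The map of models that is induced by a translation. -/
def trans (g : G) (a : R.Coset) (z : (R.model a.1).Z) : (R.model (translate g a).1).Z :=
  ((act a.1).aut (cocycle g a)).toFun z

variable {act} in
theorem dist_trans_pt_le {r : ℝ}
    (hr : ∀ P p q, dist (((act P).aut p).toFun ((R.model P).o q)) ((R.model P).o (p * q)) ≤ r)
    (g : G) {a : R.Coset} {x : G} (h : (x : G ⧸ (a.1 : Subgroup G)) = a.2) :
    dist (trans act g a (pt a x h)) (pt (translate g a) (g * x) (coe_translate g h)) ≤ r := by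
  have := hr a.1 (cocycle g a) (loc a x h)
  rw [← loc_translate] at this
  exact this

variable {act} in
theorem map_vgate {r : ℝ}
    (hr : ∀ P p q, dist (((act P).aut p).toFun ((R.model P).o q)) ((R.model P).o (p * q)) ≤ r)
    (g : G) {a : R.Coset} {v : ConedVertex R.Ps} {z : (R.model a.1).Z} (hz : z ∈ vgate a v) :
    ∃ w ∈ vgate (translate g a) (R.move g v), dist (trans act g a z) w ≤ r := by
  obtain ⟨x, h, hx, rfl⟩ := hz
  exact ⟨_, ⟨g * x, coe_translate g h, isEntrance_move g hx, rfl⟩, dist_trans_pt_le hr g h⟩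

-- Translation by the inverse carries entrances back, so every gate of the image comes from a gate.
variable {act} in
theorem exists_map_vgate {r : ℝ}
    (hr : ∀ P p q, dist (((act P).aut p).toFun ((R.model P).o q)) ((R.model P).o (p * q)) ≤ r)
    (g : G) {a : R.Coset} {v : ConedVertex R.Ps} {w : (R.model (translate g a).1).Z}
    (hw : w ∈ vgate (translate g a) (R.move g v)) :
    ∃ z ∈ vgate a v, dist (trans act g a z) w ≤ r := by
  obtain ⟨y, h, hy, rfl⟩ := hw
  obtain ⟨x, rfl⟩ : ∃ x, y = g * x := ⟨g⁻¹ * y, by simp⟩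
  have ha : translate g⁻¹ (translate g a) = a := (translate g).symm_apply_apply a
  have hv : R.move g⁻¹ (R.move g v) = v := (R.move g).symm_apply_apply v
  have h' : (x : G ⧸ (a.1 : Subgroup G)) = a.2 := by
    change ((g * x : G) : G ⧸ (a.1 : Subgroup G)) = g • a.2 at h
    exact (smul_left_cancel_iff g).1 h
  have hx := isEntrance_move g⁻¹ hy
  rw [ha, hv, inv_mul_cancel_left] at hx
  exact ⟨_, ⟨x, h', hx, rfl⟩, dist_trans_pt_le hr g h'⟩

-- The chosen gate points are not equivariant, but the gates of a vertex other than the cone point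
-- have diameter at most `R.B`.
variable {act} in
theorem dist_trans_vpr_le {r : ℝ}
    (hr : ∀ P p q, dist (((act P).aut p).toFun ((R.model P).o q)) ((R.model P).o (p * q)) ≤ r)
    (g : G) {a : R.Coset} {v : ConedVertex R.Ps} (hv : v ≠ R.cone a) :
    dist (trans act g a (vpr a v)) (vpr (translate g a) (R.move g v)) ≤ r + R.B := by
  obtain ⟨w, hw, h⟩ := map_vgate hr g (vpr_mem a v)
  have hne : R.move g v ≠ R.cone (translate g a) := fun h => hv ((R.move g).injective h)
  exact (dist_triangle _ _ _).trans (add_le_add h (dist_vgate_self_le hne hw (vpr_mem _ _)))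

variable {act} in
theorem exists_actionBound (heq : ∀ P, ∃ r : ℝ, ∀ p q,
    dist (((act P).aut p).toFun ((R.model P).o q)) ((R.model P).o (p * q)) ≤ r) :
    ∃ k : ℝ, 1 ≤ k ∧ (∀ P, (act P).k ≤ k) ∧ ∃ r : ℝ, r ≤ k ∧ r + R.B ≤ k ∧
      ∀ P p q, dist (((act P).aut p).toFun ((R.model P).o q)) ((R.model P).o (p * q)) ≤ r := by
  choose r hr using heq
  have h (f : R.Ps → ℝ) : ∀ᶠ M : ℝ in atTop, ∀ P, f P ≤ M :=
    eventually_all.2 fun P => eventually_ge_atTop (f P)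
  obtain ⟨r', hr'⟩ := (h r).exists
  obtain ⟨k, h1, h2, h3, h4⟩ := ((eventually_ge_atTop (1 : ℝ)).and <| (h fun P => (act P).k).and <|
    (eventually_ge_atTop r').and (eventually_ge_atTop (r' + R.B))).exists
  exact ⟨k, h1, h2, r', h3, h4, fun P p q => (hr P p q).trans (hr' P)⟩

/-- The model depends only on `P`, so nothing is transported when the coset is replaced by an equal
one, such as (gh)c by g(hc). -/
theorem sigma_idx_ext {P : R.Ps} {c c' : G ⧸ (P : Subgroup G)} (hc : c = c')
    {U V : (R.model P).H.Idx} (h : U = V) :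
    (⟨⟨P, c⟩, U⟩ : Σ a : R.Coset, (R.model a.1).H.Idx) = ⟨⟨P, c'⟩, V⟩ := by
  subst hc h
  rfl

theorem sigma_space_ext {P : R.Ps} {c c' : G ⧸ (P : Subgroup G)} (hc : c = c')
    {p q : Σ U, (R.model P).H.C U} (h : p = q) :
    (⟨⟨⟨P, c⟩, p.1⟩, p.2⟩ : Σ V : Σ a : R.Coset, (R.model a.1).H.Idx, (R.model V.1.1).H.C V.2) =
      ⟨⟨⟨P, c'⟩, q.1⟩, q.2⟩ := by
  subst hc h
  rfl

variable {T : Set G} (hT : Subgroup.closure T = ⊤)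

/-- The left multiplication acts on the combination data. -/
def action (hfin : T.Finite) (heq : ∀ P, ∃ r : ℝ, ∀ p q,
    dist (((act P).aut p).toFun ((R.model P).o q)) ((R.model P).o (p * q)) ≤ r) :
    (R.combinationData hT hfin).Action G where
  k := (exists_actionBound heq).choose
  one_le_k := (exists_actionBound heq).choose_spec.1
  move g x := g * (show G from x)
  φ g := Realization.mapEquiv (R.move g)
  e g := translate g
  idx g a := ((act a.1).aut (cocycle g a)).idx
  iso g a U := ((act a.1).aut (cocycle g a)).iso U
  trans g a z := trans act g a z
  map_le g a := ((act a.1).aut (cocycle g a)).map_le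
  map_perp g a := ((act a.1).aut (cocycle g a)).map_perp
  map_transverse g a := ((act a.1).aut (cocycle g a)).map_transverse
  proj g a U z := (((act a.1).commutes (cocycle g a)).proj U z).mono
    ((exists_actionBound heq).choose_spec.2.1 a.1)
  rhoSet g a U V h := (((act a.1).commutes (cocycle g a)).rhoSet U V h).mono
    ((exists_actionBound heq).choose_spec.2.1 a.1)
  rhoMap g a U V h p := (((act a.1).commutes (cocycle g a)).rhoMap U V h p).mono
    ((exists_actionBound heq).choose_spec.2.1 a.1)
  map_toY g x := rfl
  map_cone g a := rfl
  map_pr g a x := by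
    obtain ⟨r, -, h2, h3⟩ := (exists_actionBound heq).choose_spec.2.2
    exact (dist_trans_vpr_le h3 g (elt_ne_cone (show G from x) a)).trans h2
  map_coneGate g a b hab := by
    obtain ⟨r, -, h2, h3⟩ := (exists_actionBound heq).choose_spec.2.2
    exact (dist_trans_vpr_le h3 g (fun h => hab (Sum.inr_injective h))).trans h2
  map_gate g a y z hz := by
    obtain ⟨r, h1, -, h3⟩ := (exists_actionBound heq).choose_spec.2.2
    exact (map_vgate h3 g hz).imp fun w hw => ⟨hw.1, hw.2.trans h1⟩
  exists_map_gate g a y w hw := by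
    obtain ⟨r, h1, -, h3⟩ := (exists_actionBound heq).choose_spec.2.2
    exact (exists_map_vgate h3 g hw).imp fun z hz => ⟨hz.1, hz.2.trans h1⟩
  φ_mul g h y := by
    have key : ∀ v, R.move (g * h) v = R.move g (R.move h v) := by
      rintro (x | a)
      · exact congrArg Sum.inl (mul_assoc g h x)
      · exact congrArg Sum.inr (translate_mul g h a)
    exact Realization.ext (key _) (key _) rfl
  idx_mul g h a U := by
    refine sigma_idx_ext (mul_smul g h a.2) ?_
    exact (act a.1).idx_of_eq_mul (cocycle_mul g h a) U
  iso_mul g h a U p := by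
    exact sigma_space_ext (mul_smul g h a.2) ((act a.1).iso_of_eq_mul (cocycle_mul g h a) U p)
  move_one x := one_mul (show G from x)
  move_mul g h x := mul_assoc g h (show G from x)
  dist_move g x y := dist_mul_left_toWord g (show G from x) (show G from y)

end RelHypData

/-! ### The two statements -/

theorem finite_setOf_near {G : Type u} [Group G] {S : Set G} (hS : Subgroup.closure S = ⊤)
    (hfin : S.Finite) (x : G) (r : ℝ) :
    {g : G | ∃ y, dist (toWord hS y) (toWord hS x) ≤ r ∧
      dist (toWord hS (g * y)) (toWord hS x) ≤ r}.Finite := by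
  -- Here b = x⁻¹ y and c = x⁻¹ g y lie in a finite ball, and they determine g = x c b⁻¹ x⁻¹.
  refine (Set.Finite.image2 (fun b c => x * c * b⁻¹ * x⁻¹) (finite_ball (hS := hS) hfin r)
    (finite_ball (hS := hS) hfin r)).subset ?_
  rintro g ⟨y, h1, h2⟩
  refine ⟨x⁻¹ * y, ⟨x, ?_⟩, x⁻¹ * (g * y), ⟨x, ?_⟩, by group⟩
  · rwa [mul_inv_cancel_left, dist_comm]
  · rwa [mul_inv_cancel_left, dist_comm]

theorem IsHyperbolicRelativeTo.isHHG {G : Type u} [Group G] {Ps : Set (Subgroup G)}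
    (h : IsHyperbolicRelativeTo G Ps) (hfin : Ps.Finite) (hPs : ∀ P ∈ Ps, IsHHG P) :
    IsHHG G := by
  obtain ⟨S, hfinS, hS, hhyp, hfine⟩ := h
  obtain ⟨D, hD⟩ := hhyp.exists_intFourPoint
  have : Finite Ps := hfin.to_subtype
  let m : ∀ P : Ps, ActedModel P := fun P => (hPs P P.2).nonempty_actedModel.some
  let R : RelHypData G := ⟨Ps, S, hS, hfin, hfinS, D, hD, hfine, fun P => (m P).toOrbitModel⟩
  have heq := fun P => (m P).equivariant
  let A := RelHypData.action (R := R) (fun P => (m P).A) hS hfinS heq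
  refine ⟨⟨hfinS.toFinset, by simpa using hS⟩, WordSpace S hS, inferInstance, _, A.toHHSAction,
    isQuasigeodesicSpace_wordSpace hS, fun x r => finite_setOf_near hS hfinS x r,
    ⟨toWord hS 1, 0, fun y => ⟨(y : G), ?_⟩⟩, ?_⟩
  · have : (A.toHHSAction.aut (y : G)).toFun (toWord hS 1) = y := mul_one (show G from y)
    rw [this, dist_self]
  · choose F hF hF' using fun P => (m P).finiteOrbits
    -- Representatives of the orbits are the top and, for each `P`, the representatives of its own
    -- orbits placed in the trivial coset.
    refine ⟨insert .top (⋃ P : Ps, CombIdx.piece (A := R.Coset) ⟨P, (1 : G)⟩ '' F P),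
      (Set.finite_iUnion fun P => (hF P).image _).insert _, fun U => ?_⟩
    cases U with
    | top => exact ⟨.top, .inl rfl, 1, rfl⟩
    | piece a U =>
      obtain ⟨V, hV, p, hp⟩ := hF' a.1 U
      obtain ⟨g, hg, hc⟩ := RelHypData.exists_translate_eq (R := R) a.1 (1 : G) a.2 p
      refine ⟨.piece ⟨a.1, (1 : G)⟩ V, .inr (Set.mem_iUnion.2 ⟨a.1, V, hV, rfl⟩), g, ?_⟩
      have hU : U = ((m a.1).A.aut (RelHypData.cocycle (R := R) g ⟨a.1, (1 : G)⟩)).idx V :=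
        hp.trans (congrArg (fun q => ((m a.1).A.aut q).idx V) hc.symm)
      exact congrArg (fun W : Σ a : R.Coset, (R.model a.1).H.Idx =>
          CombIdx.piece (A := R.Coset) (I := fun a => (R.model a.1).H.Idx) W.1 W.2)
        (RelHypData.sigma_idx_ext (R := R) hg.symm hU)

theorem IsHyperbolicRelativeTo.isHHS {G : Type u} [Group G] {Ps : Set (Subgroup G)}
    (h : IsHyperbolicRelativeTo G Ps) (hfin : Ps.Finite)
    (hPs : ∀ P ∈ Ps, ∃ (T : Set P) (hT : Subgroup.closure T = ⊤),
      T.Finite ∧ IsHHS (WordSpace T hT))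
    (S : Set G) (hS : Subgroup.closure S = ⊤) (hfinS : S.Finite) : IsHHS (WordSpace S hS) := by
  obtain ⟨S', hfinS', hS', hhyp, hfine⟩ := h
  obtain ⟨D, hD⟩ := hhyp.exists_intFourPoint
  have m : ∀ P : Ps, Nonempty (OrbitModel P) := by
    intro P
    obtain ⟨T, hT, hfinT, -, ⟨H⟩⟩ := hPs P P.2
    exact ⟨OrbitModel.ofWordSpace hT hfinT H⟩
  -- The coned-off graph uses the generating set `S'` from relative hyperbolicity, while the word
  -- metric uses the given `S`; the Lipschitz bound in `IsBound` compares the two.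
  let R : RelHypData G := ⟨Ps, S', hS', hfin, hfinS', D, hD, hfine, fun P => (m P).some⟩
  exact ⟨isQuasigeodesicSpace_wordSpace hS, ⟨(R.combinationData hS hfinS).toHHSStructure⟩⟩

end HHS

end

theorem mainTheorem6 (G : Type u) [Group G] (Ps : Set (Subgroup G)) (hfin : Ps.Finite)
    (hrel : HHS.IsHyperbolicRelativeTo G Ps) :
    ((∀ P ∈ Ps, ∃ (T : Set P) (hT : Subgroup.closure T = ⊤),
        T.Finite ∧ HHS.IsHHS (HHS.WordSpace T hT)) →
      ∀ (S : Set G) (hS : Subgroup.closure S = ⊤),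
        S.Finite → HHS.IsHHS (HHS.WordSpace S hS)) ∧
    ((∀ P ∈ Ps, HHS.IsHHG P) → HHS.IsHHG G) :=
  ⟨hrel.isHHS hfin, hrel.isHHG hfin⟩
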